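/- Let $N,d\ge 1$, $p>1$, $q=p/(p-1)$; let $|\cdot|$ and $|\cdot|_*$ be the $\ell_p$- and $\ell_q$-norms on $\mathbb R^d$. Let $\mathcal X=\{0\}\times(\mathbb R^d)^N$ with canonical process $X=(X_n)_{n=0}^N$ and its natural filtration $(\mathcal F_n)_{n=0}^N$, and write $\Delta x_n=x_n-x_{n-1}$. Let $\mathcal M(\mathcal X)$ be the set of Borel probability measures on $\mathcal X$ with finite $p$-th moment under which $X$ is an $(\mathcal F_n)$-martingale. A coupling $\pi$ of $\mu$ and $\nu$ is *causal* from $\mu$ to $\nu$ if, for all $n$ and $U\in\mathcal F_n$, the map $x\mapsto\pi_y(x,U)$ is measurable with respect to the $\mu$-completion of $\mathcal F_n$, where $\pi(dx,dy)=\mu(dx)\,\pi_y(x,dy)$; it is *bicausal* if, moreover, its image under $(x,y)\mapsto(y,x)$ is causal from $\nu$ to $\mu$. Let $$d_{\mathfrak{bc}}(\mu,\nu)=\inf_{\pi\text{ bicausal}}E_\pi\Big[\sum_{n=1}^N|\Delta x_n-\Delta y_n|^p\Big].$$ Let $L:[0,\infty)\to[0,\infty]$ be lower semicontinuous (for instance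 continuous, or $L=+\infty\mathbf 1_{(1,\infty)}$) and non-decreasing, with $L(0)=0$ and $\liminf_{u\to\infty}L(u)/u^p=+\infty$. Put $L^*(v)=\sup_{u\ge0}\{uv-L(u)\}$, $L_\delta(u)=\delta L(u/\delta)$ for $\delta>0$, and $L_0=+\infty\mathbf 1_{(0,\infty)}$. Let $f:\mathcal X\to\mathbb R$ be continuously differentiable, let $\mathbb D_nf=\sum_{k=n}^N\partial_kf$ for $1\le n\le N$, where $\partial_kf$ is the gradient of $f$ in the variable $x_k\in\mathbb R^d$, and assume that $|\mathbb Df(x)|\le C(1+|x|^{p-1})$ for some constant $C$ and all $x\in\mathcal X$ (here $|\cdot|$ is the $\ell_p$-norm on $(\mathbb R^d)^N$). Let $\mu\in\mathcal M(\mathcal X)$ and, for $\delta\ge0$, $$V_{\mathrm{Mart}}(\delta)=\sup_{\nu\in\mathcal M(\mathcal X)}\big\{E_\nu[f(X)]-L_\delta\big(d_{\mathfrak{bc}}(\mu,\nu)^{1/p}\big)\big\}.$$ Let ${}^{\mathrm o}\mathbb D_nf=E_\mu[\mathbb D_nf\mid\mathcal F_n]$, ${}^{\mathrm p}\mathbb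 D_nf=E_\mu[\mathbb D_nf\mid\mathcal F_{n-1}]$ and $\|A\|_{L^q(\mu)}=\big(\sum_{n=1}^NE_\mu[|A_n|_*^q]\big)^{1/q}$, and let $\mathcal H$ be the set of predictable processes $h=(h_1,\dots,h_N)$ ($h_n$ is $\mathbb R^d$-valued and $\mathcal F_{n-1}$-measurable) with $\|h\|_{L^q(\mu)}<\infty$. **Theorem.** $V_{\mathrm{Mart}}(0)=E_\mu[f(X)]$, $V_{\mathrm{Mart}}(\delta)$ is finite for all sufficiently small $\delta>0$, and as $\delta\downarrow0$ $$V_{\mathrm{Mart}}(\delta)=V_{\mathrm{Mart}}(0)+\Upsilon_{\mathrm{Mart}}\,\delta+o(\delta),$$ where $\Upsilon_{\mathrm{Mart}}$ is the real number $$\Upsilon_{\mathrm{Mart}}=L^*\Big(\inf_{h\in\mathcal H}\big\|{}^{\mathrm o}\mathbb Df-h\big\|_{L^q(\mu)}\Big).$$ In particular, if $p=2$, then $\Upsilon_{\mathrm{Mart}}=L^*\big(\|{}^{\mathrm o}\mathbb Df-{}^{\mathrm p}\mathbb Df\|_{L^2(\mu)}\big)$. -/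

import Mathlib

open MeasureTheory ProbabilityTheory Filter Topology Asymptotics
open scoped NNReal ENNReal

namespace MartDRO

/-- The path space `{0} × (ℝ^d)^N`. The initial value `0` is not stored: `x k` is the position at
time `k + 1`; see `pathAt`. -/
abbrev PathSpace (N d : ℕ) : Type := Fin N → Fin d → ℝ

/-- The canonical process `X_n`, `n = 0, …, N`, with `X_0 = 0`. -/
def pathAt {N d : ℕ} (n : Fin (N + 1)) (x : PathSpace N d) : Fin d → ℝ :=
  Fin.cons (α := fun _ => Fin d → ℝ) 0 x n

theorem stronglyMeasurable_pathAt {N d : ℕ} (n : Fin (N + 1)) :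
    StronglyMeasurable (pathAt (N := N) (d := d) n) := by
  refine Fin.cases ?_ (fun k => ?_) n
  · exact (stronglyMeasurable_const (b := (0 : Fin d → ℝ)))
  · exact (measurable_pi_apply k).stronglyMeasurable

/-- The natural filtration `(F_n)_{n = 0, …, N}` of the canonical process. -/
noncomputable def canonFiltration (N d : ℕ) :
    Filtration (Fin (N + 1)) (inferInstance : MeasurableSpace (PathSpace N d)) :=
  Filtration.natural (fun n => pathAt (N := N) (d := d) n) stronglyMeasurable_pathAt

/-- The increments: `increment x k = x_{k+1} - x_k`, `k = 0, …, N - 1`. -/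
def increment {N d : ℕ} (x : PathSpace N d) (k : Fin N) : Fin d → ℝ :=
  pathAt k.succ x - pathAt k.castSucc x

/-- The `l_r` norm on `ℝ^d`. -/
noncomputable def lrNorm {d : ℕ} (r : ℝ) (v : Fin d → ℝ) : ℝ :=
  (∑ i, |v i| ^ r) ^ (1 / r)

/-- The `l_r` norm on `(ℝ^d)^N`. -/
noncomputable def pathNorm {N d : ℕ} (r : ℝ) (x : PathSpace N d) : ℝ :=
  (∑ k, lrNorm r (x k) ^ r) ^ (1 / r)

/-- The cost `c_N(x, y) = ∑_n |Δx_n - Δy_n|^p`. -/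
noncomputable def cost {N d : ℕ} (p : ℝ) (x y : PathSpace N d) : ℝ :=
  ∑ k, lrNorm p (increment x k - increment y k) ^ p

/-- A finite measure `π` on `X × X` is causal (from its first marginal to its second one) if for
every time `n` and every `U ∈ F_n` the map `x ↦ π_y(x, U)` is measurable with respect to the
completion of `F_n` under the first marginal, where `π_y` is the disintegration kernel of `π` with
respect to its first marginal. -/
def IsCausal {N d : ℕ} (π : Measure (PathSpace N d × PathSpace N d)) [IsFiniteMeasure π] : Prop :=
  ∀ (n : Fin (N + 1)) (U : Set (PathSpace N d)), MeasurableSet[canonFiltration N d n] U →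
    AEStronglyMeasurable[canonFiltration N d n] (fun x => (π.condKernel x).real U) π.fst

/-- The set of bicausal couplings of `μ` and `ν`. -/
def bicausalCouplings {N d : ℕ} (μ ν : Measure (PathSpace N d)) :
    Set (Measure (PathSpace N d × PathSpace N d)) :=
  {π | ∃ _ : IsProbabilityMeasure π, π.fst = μ ∧ π.snd = ν ∧
    IsCausal π ∧ IsCausal (π.map Prod.swap)}

/-- The bicausal transport cost `d_bc(μ, ν)`. -/
noncomputable def bicausalCost {N d : ℕ} (p : ℝ) (μ ν : Measure (PathSpace N d)) : ℝ≥0∞ :=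
  ⨅ π ∈ bicausalCouplings μ ν, ∫⁻ z, ENNReal.ofReal (cost p z.1 z.2) ∂π

/-- The martingale measures on the path space (with finite `p`-th moment, so that the transport
cost and the expectation of the objective are meaningful). -/
def martingaleMeasures (N d : ℕ) (p : ℝ) : Set (Measure (PathSpace N d)) :=
  {ν | IsProbabilityMeasure ν ∧
    (∫⁻ x, ENNReal.ofReal (pathNorm p x ^ p) ∂ν) < ⊤ ∧
    Martingale (fun n => pathAt (N := N) (d := d) n) (canonFiltration N d) ν}

/-- The scaled penalty `L_δ(u) = δ L(u / δ)` for `δ > 0`; for `δ = 0` it is the limiting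
penalty, `0` at `u = 0` and `∞` for `u > 0`. Moreover `L_δ(∞) = ∞`. -/
noncomputable def scaledPenalty (L : ℝ≥0 → ℝ≥0∞) (δ : ℝ≥0) (u : ℝ≥0∞) : ℝ≥0∞ :=
  if u = ⊤ then ⊤
  else if δ = 0 then (if u = 0 then 0 else ⊤)
  else δ * L (u.toNNReal / δ)

/-- The convex conjugate `L*(v) = sup_{u ≥ 0} (u v - L(u))`. -/
noncomputable def convexConj (L : ℝ≥0 → ℝ≥0∞) (v : ℝ≥0∞) : EReal :=
  ⨆ u : ℝ≥0, (((u : ℝ≥0∞) * v : ℝ≥0∞) : EReal) - (L u : EReal)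

/-- The value `V_Mart(δ)` of the martingale constrained, bicausally penalized problem. -/
noncomputable def VMart {N d : ℕ} (p : ℝ) (L : ℝ≥0 → ℝ≥0∞) (f : PathSpace N d → ℝ)
    (μ : Measure (PathSpace N d)) (δ : ℝ≥0) : EReal :=
  ⨆ ν ∈ martingaleMeasures N d p,
    ((∫ x, f x ∂ν : ℝ) : EReal) - (scaledPenalty L δ (bicausalCost p μ ν ^ (1 / p)) : EReal)

/-- The gradient of `f` in the `k`-th position, a vector of `ℝ^d`. -/
noncomputable def partialGrad {N d : ℕ} (f : PathSpace N d → ℝ) (k : Fin N) (x : PathSpace N d) :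
    Fin d → ℝ :=
  fun i => fderiv ℝ f x (Pi.single k (Pi.single i 1))

/-- The discrete pathwise Malliavin derivative `𝔻_n f = ∑_{k ≥ n} ∂_k f`. -/
noncomputable def malliavin {N d : ℕ} (f : PathSpace N d → ℝ) (n : Fin N) (x : PathSpace N d) :
    Fin d → ℝ :=
  ∑ k ∈ Finset.Ici n, partialGrad f k x

/-- The optional projection of `A`. The index `n : Fin N` stands for the time `n + 1`. -/
noncomputable def optionalProj {N d : ℕ} (μ : Measure (PathSpace N d))
    (A : Fin N → PathSpace N d → Fin d → ℝ) : Fin N → PathSpace N d → Fin d → ℝ :=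
  fun n => μ[A n | canonFiltration N d n.succ]

/-- The predictable projection of `A`. The index `n : Fin N` stands for the time `n + 1`. -/
noncomputable def predictableProj {N d : ℕ} (μ : Measure (PathSpace N d))
    (A : Fin N → PathSpace N d → Fin d → ℝ) : Fin N → PathSpace N d → Fin d → ℝ :=
  fun n => μ[A n | canonFiltration N d n.castSucc]

/-- `‖A‖_{L^q(μ)} = (∑_n E_μ[|A_n|_*^q])^{1/q}`, with `|·|_*` the `l_q` norm on `ℝ^d`. -/
noncomputable def LqNorm {N d : ℕ} (q : ℝ) (μ : Measure (PathSpace N d))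
    (A : Fin N → PathSpace N d → Fin d → ℝ) : ℝ≥0∞ :=
  (∑ n, ∫⁻ x, ENNReal.ofReal (lrNorm q (A n x) ^ q) ∂μ) ^ (1 / q)

/-- The predictable processes `h = (h_1, …, h_N)` with `‖h‖_{L^q(μ)} < ∞`. -/
def predictableLq {N d : ℕ} (q : ℝ) (μ : Measure (PathSpace N d)) :
    Set (Fin N → PathSpace N d → Fin d → ℝ) :=
  {h | (∀ n : Fin N, Measurable[canonFiltration N d n.castSucc] (h n)) ∧ LqNorm q μ h < ⊤}

end MartDRO

/-! Let π be a bicausal coupling of μ and ν. To first order, f(y) - f(x) is the derivative of f at x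
in the direction y - x, and summation by parts (`fderiv_apply_eq_sum`) turns it into ∑ₙ 𝔻ₙf(x)·(Δyₙ
- Δxₙ). Causality from μ to ν makes 𝔻ₙf - ᵒ𝔻ₙf orthogonal to Δyₙ as well as to Δxₙ, so 𝔻f may be
replaced by ᵒ𝔻f. Causality from ν to μ, with the martingale property of both measures, makes every
predictable hₙ orthogonal to Δyₙ - Δxₙ, so any such h may be subtracted. Hölder's inequality then
bounds the first-order gain by ‖ᵒ𝔻f - h‖ in L^q times the transport distance
(`exists_objective_sub_le`). The Taylor remainder is negligible uniformly in π, because growth of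
order p - 1 makes the tails of the gradient small in L^q(μ) (`exists_integral_remainder_le`).

For the converse, let h be the best predictable approximation of A = ᵒ𝔻f. Its first-order condition
says that sign(A - h)|A - h|^(q-1) has zero conditional expectation given the strict past. Suitably
scaled, this is a martingale difference Z with equality in Hölder's inequality
(`IsBestPredictable.exists_dual`). Adding tZ to the increments gives a martingale with first-order
gain t‖A - h‖ at cost of order t, but the shift may destroy information, and then the coupling is
not causal backwards. So Z is replaced by G minus its predictable projection, with G adapted and
Lipschitz: for small t the new path determines the old one step by step
(`freeze_eq_of_freeze_perturb_eq`), and the coupling is bicausal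
(`map_graph_mem_bicausalCouplings`). This yields `exists_le_objective_sub`.

Finally write the transport distance as δu, and let a be the least distance from A to the
predictable processes. The two bounds say that the best gain minus penalty at distance δu is δ(ua -
L(u)) up to o(δ). The growth of L beyond u^p keeps u bounded, and the supremum over u is L*(a). -/

namespace MartDRO

/-! ### Frozen paths, increments and comparison of norms -/

variable {N d : ℕ}

/-- The path `x` up to time `n`, extended by `0`. -/
def freeze (n : Fin (N + 1)) (x : PathSpace N d) : PathSpace N d :=
  fun k => if k.succ ≤ n then x k else 0

lemma freeze_apply_of_le {n : Fin (N + 1)} {k : Fin N} (h : k.succ ≤ n) (x : PathSpace N d) :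
    freeze n x k = x k := if_pos h

lemma measurable_freeze (n : Fin (N + 1)) : Measurable (freeze (N := N) (d := d) n) := by
  refine measurable_pi_lambda _ fun k => ?_
  by_cases h : k.succ ≤ n
  · simpa [freeze, h] using measurable_pi_apply k
  · simp [freeze, h]

@[simp] lemma pathAt_succ (k : Fin N) (x : PathSpace N d) : pathAt k.succ x = x k := rfl

@[simp] lemma pathAt_zero (x : PathSpace N d) : pathAt 0 x = 0 := rfl

lemma pathAt_freeze {m n : Fin (N + 1)} (h : m ≤ n) (x : PathSpace N d) :
    pathAt m (freeze n x) = pathAt m x := by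
  induction m using Fin.cases with
  | zero => rfl
  | succ k => simp [freeze, h]

lemma freeze_eq_freeze_iff {n : Fin (N + 1)} {x y : PathSpace N d} :
    freeze n x = freeze n y ↔ ∀ k : Fin N, k.succ ≤ n → x k = y k := by
  constructor
  · intro h k hk
    have := congrFun h k
    rwa [freeze_apply_of_le hk, freeze_apply_of_le hk] at this
  · intro h
    funext k
    by_cases hk : k.succ ≤ n
    · rw [freeze_apply_of_le hk, freeze_apply_of_le hk, h k hk]
    · simp [freeze, hk]

@[simp] lemma freeze_freeze_self (n : Fin (N + 1)) (x : PathSpace N d) :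
    freeze n (freeze n x) = freeze n x :=
  freeze_eq_freeze_iff.2 fun _ hk => freeze_apply_of_le hk x

lemma freeze_eq_of_le {m n : Fin (N + 1)} (h : m ≤ n) {x y : PathSpace N d}
    (hxy : freeze n x = freeze n y) : freeze m x = freeze m y :=
  freeze_eq_freeze_iff.2 fun k hk => freeze_eq_freeze_iff.1 hxy k (hk.trans h)

/-- A single map generates F_n, so measurability with respect to F_n becomes factorization through
the frozen path. The coordinate `k` is the position at time `k.succ`, which is why freezing compares
`k.succ` with `n`. -/
lemma canonFiltration_eq_comap (n : Fin (N + 1)) :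
    (canonFiltration N d n : MeasurableSpace (PathSpace N d))
      = MeasurableSpace.comap (freeze n) inferInstance := by
  apply le_antisymm
  · refine iSup₂_le fun j hj => ?_
    have : pathAt (N := N) (d := d) j = pathAt j ∘ freeze n := by
      funext x
      exact (pathAt_freeze hj x).symm
    change MeasurableSpace.comap (pathAt j) _ ≤ _
    rw [this, ← MeasurableSpace.comap_comp]
    exact MeasurableSpace.comap_mono (stronglyMeasurable_pathAt j).measurable.comap_le
  · rw [← measurable_iff_comap_le]
    refine @measurable_pi_lambda _ _ _ (_) _ _ fun k => ?_
    by_cases h : k.succ ≤ n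
    · simp only [freeze, h, if_true]
      have h1 : Measurable[MeasurableSpace.comap (pathAt (N := N) (d := d) k.succ) inferInstance]
          (fun x : PathSpace N d => x k) := comap_measurable _
      refine h1.mono ?_ le_rfl
      exact le_iSup₂_of_le (f := fun j (_ : j ≤ n) =>
        MeasurableSpace.comap (pathAt (N := N) (d := d) j) inferInstance) k.succ h le_rfl
    · simp only [freeze, h, if_false]
      exact @measurable_const _ _ _ (_) _

lemma canonFiltration_le (n : Fin (N + 1)) :
    (canonFiltration N d n : MeasurableSpace (PathSpace N d)) ≤ MeasurableSpace.pi :=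
  (canonFiltration N d).le n

lemma measurable_canonFiltration_freeze (n : Fin (N + 1)) :
    Measurable[canonFiltration N d n] (freeze (N := N) (d := d) n) := by
  rw [canonFiltration_eq_comap]
  exact comap_measurable _

lemma measurable_canonFiltration_of_freeze {β : Type*} [MeasurableSpace β] {n : Fin (N + 1)}
    {g : PathSpace N d → β} (hg : Measurable g) (h : ∀ x, g (freeze n x) = g x) :
    Measurable[canonFiltration N d n] g := by
  have : g = g ∘ freeze n := funext fun x => (h x).symm
  rw [this]
  exact hg.comp (measurable_canonFiltration_freeze n)

/-- Level sets of an F_n-measurable function are preimages under `freeze n`, so the function depends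
on the past at every path, not merely almost surely. The recursive inversion of the perturbation
needs this pointwise form. -/
lemma eq_of_freeze_eq {β : Type*} [MeasurableSpace β] [MeasurableSingletonClass β] {n : Fin (N + 1)}
    {g : PathSpace N d → β} (hg : Measurable[canonFiltration N d n] g) {x y : PathSpace N d}
    (h : freeze n x = freeze n y) : g x = g y := by
  rw [canonFiltration_eq_comap] at hg
  obtain ⟨s, -, hs⟩ := hg (measurableSet_singleton (g y))
  have hy : y ∈ g ⁻¹' {g y} := rfl
  rw [← hs] at hy
  have hx : x ∈ freeze n ⁻¹' s := by
    rw [Set.mem_preimage, h]; exact hy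
  rw [hs] at hx
  exact hx

lemma increment_sub (x y : PathSpace N d) (k : Fin N) :
    increment (x - y) k = increment x k - increment y k := by
  have h : ∀ n : Fin (N + 1), pathAt n (x - y) = pathAt n x - pathAt n y := by
    intro n
    induction n using Fin.cases with
    | zero => simp
    | succ k => rfl
  simp only [increment, h]
  abel

lemma measurable_increment (k : Fin N) :
    Measurable (fun x : PathSpace N d => increment x k) :=
  (stronglyMeasurable_pathAt _).measurable.sub (stronglyMeasurable_pathAt _).measurable

lemma measurable_canonFiltration_increment (k : Fin N) :
    Measurable[canonFiltration N d k.succ] (fun x : PathSpace N d => increment x k) := by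
  refine measurable_canonFiltration_of_freeze (measurable_increment k) fun x => ?_
  simp only [increment]
  rw [pathAt_freeze le_rfl, pathAt_freeze k.castSucc_lt_succ.le]

lemma pathAt_eq_sum_increment (x : PathSpace N d) (n : Fin (N + 1)) :
    pathAt n x = ∑ j : Fin N, if j.castSucc < n then increment x j else 0 := by
  induction n using Fin.induction with
  | zero => simp
  | succ k ih =>
    have h : ∀ j : Fin N, (if j.castSucc < k.succ then increment x j else 0)
        = (if j.castSucc < k.castSucc then increment x j else 0)
          + if j = k then increment x j else 0 := by
      intro j
      rcases lt_trichotomy j k with h | h | h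
      · have h1 : j.castSucc < k.castSucc := h
        simp [h1, h.ne, h1.trans k.castSucc_lt_succ]
      · subst h; simp
      · have h1 : ¬ j.castSucc < k.castSucc := not_lt.2 (le_of_lt h)
        have h2 : ¬ j.castSucc < k.succ := by
          rw [Fin.lt_def] at h ⊢; simp; omega
        simp [h1, h2, h.ne']
    simp only [h, Finset.sum_add_distrib, ← ih]
    simp [increment]

lemma path_eq_sum_increment (x : PathSpace N d) (k : Fin N) :
    x k = ∑ j : Fin N, if j ≤ k then increment x j else 0 := by
  rw [← pathAt_succ k x, pathAt_eq_sum_increment]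
  refine Finset.sum_congr rfl fun j _ => ?_
  simp only [Fin.castSucc_lt_succ_iff]

/-- Summation by parts: each position is the sum of the increments up to it, and exchanging the sums
collects the gradients ∂ₖf with k ≥ n in front of the n-th increment. -/
lemma fderiv_apply_eq_sum (f : PathSpace N d → ℝ) (x z : PathSpace N d) :
    fderiv ℝ f x z = ∑ n, ∑ i, malliavin f n x i * increment z n i := by
  have hz : z = ∑ k, ∑ i, z k i • (Pi.single k (Pi.single i 1) : PathSpace N d) := by
    funext k i
    simp [Finset.sum_apply, Pi.single_apply, ite_apply]
  have h1 : fderiv ℝ f x z = ∑ k, ∑ i, z k i * partialGrad f k x i := by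
    conv_lhs => rw [hz]
    simp [map_sum, partialGrad]
  have h2 : ∀ k i, z k i = ∑ j : Fin N, if j ≤ k then increment z j i else 0 := by
    intro k i
    conv_lhs => rw [path_eq_sum_increment z k]
    rw [Finset.sum_apply]
    refine Finset.sum_congr rfl fun j _ => ?_
    split_ifs <;> rfl
  rw [h1]
  simp only [malliavin, Finset.sum_apply, Finset.sum_mul]
  simp only [h2, Finset.sum_mul]
  rw [Finset.sum_comm, Finset.sum_comm (s := (Finset.univ : Finset (Fin N)))]
  refine Finset.sum_congr rfl fun i _ => ?_
  rw [Finset.sum_comm]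
  refine Finset.sum_congr rfl fun n _ => ?_
  rw [show Finset.Ici n = Finset.univ.filter (fun k => n ≤ k) by ext; simp, Finset.sum_filter]
  refine Finset.sum_congr rfl fun k _ => ?_
  split_ifs <;> ring

lemma lrNorm_nonneg (r : ℝ) (v : Fin d → ℝ) : 0 ≤ lrNorm r v :=
  Real.rpow_nonneg (Finset.sum_nonneg fun _ _ => Real.rpow_nonneg (abs_nonneg _) _) _

lemma lrNorm_rpow {r : ℝ} (hr : 0 < r) (v : Fin d → ℝ) : lrNorm r v ^ r = ∑ i, |v i| ^ r := by
  rw [lrNorm, ← Real.rpow_mul (Finset.sum_nonneg fun _ _ => Real.rpow_nonneg (abs_nonneg _) _),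
    one_div_mul_cancel hr.ne', Real.rpow_one]

lemma pathNorm_nonneg (r : ℝ) (x : PathSpace N d) : 0 ≤ pathNorm r x :=
  Real.rpow_nonneg (Finset.sum_nonneg fun _ _ => Real.rpow_nonneg (lrNorm_nonneg _ _) _) _

lemma pathNorm_rpow {r : ℝ} (hr : 0 < r) (x : PathSpace N d) :
    pathNorm r x ^ r = ∑ k, ∑ i, |x k i| ^ r := by
  rw [pathNorm, ← Real.rpow_mul
    (Finset.sum_nonneg fun _ _ => Real.rpow_nonneg (lrNorm_nonneg _ _) _),
    one_div_mul_cancel hr.ne', Real.rpow_one]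
  exact Finset.sum_congr rfl fun k _ => lrNorm_rpow hr _

lemma cost_eq_sum {p : ℝ} (hp : 0 < p) (x y : PathSpace N d) :
    cost p x y = ∑ k, ∑ i, |increment (y - x) k i| ^ p := by
  refine Finset.sum_congr rfl fun k _ => ?_
  rw [lrNorm_rpow hp]
  refine Finset.sum_congr rfl fun i _ => ?_
  rw [increment_sub, Pi.sub_apply, Pi.sub_apply, abs_sub_comm]

lemma cost_nonneg (p : ℝ) (x y : PathSpace N d) : 0 ≤ cost p x y :=
  Finset.sum_nonneg fun _ _ => Real.rpow_nonneg (lrNorm_nonneg _ _) _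

lemma measurable_cost (p : ℝ) :
    Measurable (fun z : PathSpace N d × PathSpace N d => cost p z.1 z.2) := by
  have h : ∀ k : Fin N, Measurable (fun z : PathSpace N d × PathSpace N d =>
      increment z.1 k - increment z.2 k) := fun k =>
    ((measurable_increment k).comp measurable_fst).sub
      ((measurable_increment k).comp measurable_snd)
  have h2 : ∀ (k : Fin N) (i : Fin d), Measurable (fun z : PathSpace N d × PathSpace N d =>
      (increment z.1 k - increment z.2 k) i) := fun k i => (measurable_pi_apply i).comp (h k)
  unfold cost lrNorm
  refine Finset.measurable_sum _ fun k _ => Measurable.pow_const (Measurable.pow_const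
    (Finset.measurable_sum _ fun i _ => Measurable.pow_const ?_ _) _) _
  exact (h2 k i).abs

lemma abs_le_pathNorm {p : ℝ} (hp : 0 < p) (x : PathSpace N d) (k : Fin N) (i : Fin d) :
    |x k i| ≤ pathNorm p x := by
  rw [← Real.rpow_le_rpow_iff (abs_nonneg _) (pathNorm_nonneg _ _) hp, pathNorm_rpow hp]
  refine (Finset.single_le_sum (f := fun i => |x k i| ^ p) (fun i _ => by positivity)
    (Finset.mem_univ i)).trans ?_
  exact Finset.single_le_sum (f := fun k => ∑ i, |x k i| ^ p) (fun i _ => by positivity)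
    (Finset.mem_univ k)

lemma norm_le_pathNorm {p : ℝ} (hp : 0 < p) (x : PathSpace N d) : ‖x‖ ≤ pathNorm p x :=
  (pi_norm_le_iff_of_nonneg (pathNorm_nonneg _ _)).2 fun k =>
    (pi_norm_le_iff_of_nonneg (pathNorm_nonneg _ _)).2 fun i => abs_le_pathNorm hp x k i

lemma abs_apply_le_norm (x : PathSpace N d) (k : Fin N) (i : Fin d) : |x k i| ≤ ‖x‖ :=
  (norm_le_pi_norm (x k) i).trans (norm_le_pi_norm x k)

lemma pathNorm_rpow_le {p : ℝ} (hp : 0 < p) (x : PathSpace N d) :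
    pathNorm p x ^ p ≤ (N * d : ℝ) * ‖x‖ ^ p := by
  rw [pathNorm_rpow hp]
  calc ∑ k, ∑ i, |x k i| ^ p ≤ ∑ _k : Fin N, ∑ _i : Fin d, ‖x‖ ^ p := by
        gcongr with k _ i _
        exact abs_apply_le_norm x k i
    _ = _ := by simp [mul_assoc]

lemma pathNorm_le {p : ℝ} (hp : 0 < p) (x : PathSpace N d) :
    pathNorm p x ≤ (N * d : ℝ) ^ (1 / p) * ‖x‖ := by
  rw [← Real.rpow_le_rpow_iff (pathNorm_nonneg _ _) (by positivity) hp,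
    Real.mul_rpow (by positivity) (norm_nonneg _), ← Real.rpow_mul (by positivity),
    one_div_mul_cancel hp.ne', Real.rpow_one]
  exact pathNorm_rpow_le hp x

lemma abs_increment_le (x : PathSpace N d) (k : Fin N) (i : Fin d) :
    |increment x k i| ≤ 2 * ‖x‖ := by
  have h : ∀ n : Fin (N + 1), |pathAt n x i| ≤ ‖x‖ := by
    intro n
    induction n using Fin.cases with
    | zero => simp
    | succ k => exact abs_apply_le_norm x k i
  calc |increment x k i| ≤ |pathAt k.succ x i| + |pathAt k.castSucc x i| := abs_sub _ _
    _ ≤ 2 * ‖x‖ := by linarith [h k.succ, h k.castSucc]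

lemma abs_increment_le_cost {p : ℝ} (hp : 0 < p) (x y : PathSpace N d) (k : Fin N) (i : Fin d) :
    |increment (y - x) k i| ≤ cost p x y ^ (1 / p) := by
  rw [← Real.rpow_le_rpow_iff (abs_nonneg _) (Real.rpow_nonneg (cost_nonneg _ _ _) _) hp,
    ← Real.rpow_mul (cost_nonneg _ _ _), one_div_mul_cancel hp.ne', Real.rpow_one,
    cost_eq_sum hp]
  refine (Finset.single_le_sum (f := fun i => |increment (y - x) k i| ^ p)
    (fun i _ => by positivity) (Finset.mem_univ i)).trans ?_
  exact Finset.single_le_sum (f := fun k => ∑ i, |increment (y - x) k i| ^ p)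
    (fun i _ => by positivity) (Finset.mem_univ k)

/-- Every position is a sum of at most `N` increments, each bounded by the p-th root of the cost.
This links the sup norm, in which the Taylor estimates are made, to the cost. -/
lemma norm_sub_le_cost {p : ℝ} (hp : 0 < p) (x y : PathSpace N d) :
    ‖y - x‖ ≤ N * cost p x y ^ (1 / p) := by
  have hc : 0 ≤ cost p x y ^ (1 / p) := Real.rpow_nonneg (cost_nonneg _ _ _) _
  refine (pi_norm_le_iff_of_nonneg (by positivity)).2 fun k =>
    (pi_norm_le_iff_of_nonneg (by positivity)).2 fun i => ?_
  rw [path_eq_sum_increment (y - x) k, Finset.sum_apply]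
  refine (norm_sum_le _ _).trans ?_
  calc ∑ j, ‖(if j ≤ k then increment (y - x) j else 0) i‖
      ≤ ∑ _j : Fin N, cost p x y ^ (1 / p) := by
        refine Finset.sum_le_sum fun j _ => ?_
        split_ifs
        · exact abs_increment_le_cost hp x y j i
        · simpa using hc
    _ = _ := by simp

lemma exists_abs_malliavin_le {p : ℝ} (hp : 1 < p) {f : PathSpace N d → ℝ}
    (hfgrowth : ∃ C : ℝ, ∀ x : PathSpace N d,
      pathNorm p (fun n => malliavin f n x) ≤ C * (1 + pathNorm p x ^ (p - 1))) :
    ∃ C : ℝ, 0 ≤ C ∧ ∀ x n i, |malliavin f n x i| ≤ C * (1 + ‖x‖ ^ (p - 1)) := by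
  obtain ⟨C, hC⟩ := hfgrowth
  have hp0 : 0 < p := by linarith
  set K : ℝ := ((N * d : ℝ) ^ (1 / p)) ^ (p - 1) with hK
  have hK0 : 0 ≤ K := by positivity
  refine ⟨|C| * (1 + K), by positivity, fun x n i => ?_⟩
  have h1 : pathNorm p x ^ (p - 1) ≤ K * ‖x‖ ^ (p - 1) := by
    rw [hK, ← Real.mul_rpow (by positivity) (norm_nonneg _)]
    exact Real.rpow_le_rpow (pathNorm_nonneg _ _) (pathNorm_le hp0 x) (by linarith)
  have h2 : 0 ≤ pathNorm p x ^ (p - 1) := Real.rpow_nonneg (pathNorm_nonneg _ _) _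
  have h3 : 0 ≤ ‖x‖ ^ (p - 1) := by positivity
  calc |malliavin f n x i| ≤ pathNorm p (fun n => malliavin f n x) :=
        abs_le_pathNorm hp0 (fun n => malliavin f n x) n i
    _ ≤ C * (1 + pathNorm p x ^ (p - 1)) := hC x
    _ ≤ |C| * (1 + K * ‖x‖ ^ (p - 1)) :=
        mul_le_mul (le_abs_self C) (by linarith) (by linarith) (abs_nonneg _)
    _ ≤ |C| * (1 + K) * (1 + ‖x‖ ^ (p - 1)) := by
        rw [mul_assoc]
        refine mul_le_mul_of_nonneg_left ?_ (abs_nonneg _)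
        nlinarith

lemma exists_norm_fderiv_le {p : ℝ} (hp : 1 < p) {f : PathSpace N d → ℝ}
    (hfgrowth : ∃ C : ℝ, ∀ x : PathSpace N d,
      pathNorm p (fun n => malliavin f n x) ≤ C * (1 + pathNorm p x ^ (p - 1))) :
    ∃ C : ℝ, 0 ≤ C ∧ ∀ x, ‖fderiv ℝ f x‖ ≤ C * (1 + ‖x‖ ^ (p - 1)) := by
  obtain ⟨C, hC0, hC⟩ := exists_abs_malliavin_le hp hfgrowth
  refine ⟨N * d * (C * 2), by positivity, fun x => ?_⟩
  refine ContinuousLinearMap.opNorm_le_bound _ (by positivity) fun z => ?_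
  rw [fderiv_apply_eq_sum]
  refine (norm_sum_le _ _).trans ?_
  calc ∑ n, ‖∑ i, malliavin f n x i * increment z n i‖
      ≤ ∑ _n : Fin N, ∑ _i : Fin d, (C * (1 + ‖x‖ ^ (p - 1))) * (2 * ‖z‖) := by
        refine Finset.sum_le_sum fun n _ => (norm_sum_le _ _).trans
          (Finset.sum_le_sum fun i _ => ?_)
        rw [norm_mul]
        exact mul_le_mul (hC x n i) (abs_increment_le z n i) (norm_nonneg _) (by positivity)
    _ = _ := by simp; ring

lemma continuous_malliavin {f : PathSpace N d → ℝ} (hf : ContDiff ℝ 1 f) (n : Fin N) (i : Fin d) :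
    Continuous (fun x => malliavin f n x i) := by
  simp only [malliavin, Finset.sum_apply, partialGrad]
  exact continuous_finsetSum _ fun k _ =>
    (hf.continuous_fderiv (by simp)).clm_apply continuous_const

end MartDRO

/-! ### Causality: orthogonality relations and couplings carried by graphs -/

namespace MartDRO

variable {N d : ℕ}

/-- Pull `ψ` out of the conditional expectation. Both orthogonality relations and every use of the
first-order condition reduce to this. -/
lemma integral_mul_eq_zero_of_condExp {Ω : Type*} {m m0 : MeasurableSpace Ω} {μ : Measure Ω}
    [IsFiniteMeasure μ] (hm : m ≤ m0) {D ψ : Ω → ℝ} (hD : Integrable D μ) (hD0 : μ[D | m] =ᵐ[μ] 0)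
    (hψ : AEStronglyMeasurable[m] ψ μ) (hint : Integrable (fun x => D x * ψ x) μ) :
    ∫ x, D x * ψ x ∂μ = 0 := by
  have h := condExp_mul_of_aestronglyMeasurable_right hψ (f := D) hint hD
  rw [← integral_condExp hm (f := fun x => D x * ψ x)]
  refine integral_eq_zero_of_ae (EventuallyEq.trans h ?_)
  filter_upwards [hD0] with x hx
  simp [hx]

/-- For U in F_n, disintegration gives E_π[D(x) 1_U(y)] = E[D(x) π_y(x, U)] under the first
marginal. Causality makes the bounded factor π_y(x, U) measurable for the completion of F_n, so the
expectation vanishes. -/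
lemma IsCausal.condExp_comap_snd_eq_zero
    {π : Measure (PathSpace N d × PathSpace N d)} [IsProbabilityMeasure π] (hπ : IsCausal π)
    {n : Fin (N + 1)} {D : PathSpace N d → ℝ} (hD : Integrable D π.fst)
    (hD0 : π.fst[D | canonFiltration N d n] =ᵐ[π.fst] 0) :
    π[fun z => D z.1 | (canonFiltration N d n : MeasurableSpace (PathSpace N d)).comap Prod.snd]
      =ᵐ[π] 0 := by
  have hm : (canonFiltration N d n : MeasurableSpace (PathSpace N d)).comap Prod.snd
      ≤ (inferInstance : MeasurableSpace (PathSpace N d × PathSpace N d)) := by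
    rw [← measurable_iff_comap_le]
    exact measurable_snd.mono le_rfl (canonFiltration_le n)
  have hDπ : Integrable (fun z : PathSpace N d × PathSpace N d => D z.1) π :=
    hD.comp_measurable measurable_fst
  symm
  refine ae_eq_condExp_of_forall_setIntegral_eq hm hDπ
    (fun s _ _ => (integrable_zero _ _ _).integrableOn) ?_
    (stronglyMeasurable_zero.aestronglyMeasurable)
  rintro s ⟨U, hU, rfl⟩ -
  have hU' : MeasurableSet U := canonFiltration_le n _ hU
  simp only [Pi.zero_apply, integral_zero]
  have h := Measure.setIntegral_condKernel (ρ := π) (f := fun z => D z.1) MeasurableSet.univ hU'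
    hDπ.integrableOn
  rw [Set.univ_prod] at h
  rw [← h]
  simp only [Measure.restrict_univ, integral_const, smul_eq_mul, MeasurableSet.univ,
    measureReal_restrict_apply, Set.univ_inter]
  have hcomm : ∀ x, (π.condKernel x).real U * D x = D x * (π.condKernel x).real U :=
    fun x => mul_comm _ _
  simp only [hcomm]
  symm
  refine integral_mul_eq_zero_of_condExp (canonFiltration_le n) hD hD0 (hπ n U hU) ?_
  refine hD.mul_bdd (c := 1) ((hπ n U hU).mono (canonFiltration_le n)) ?_
  refine ae_of_all _ fun x => ?_
  rw [Real.norm_of_nonneg measureReal_nonneg]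
  exact measureReal_le_one

/-- Under a causal coupling, a function of the first path whose conditional expectation given
the past vanishes is orthogonal to every function of the past of the second path. -/
lemma IsCausal.integral_mul_eq_zero
    {π : Measure (PathSpace N d × PathSpace N d)} [IsProbabilityMeasure π] (hπ : IsCausal π)
    {n : Fin (N + 1)} {D ψ : PathSpace N d → ℝ} (hD : Integrable D π.fst)
    (hD0 : π.fst[D | canonFiltration N d n] =ᵐ[π.fst] 0)
    (hψ : Measurable[canonFiltration N d n] ψ)
    (hint : Integrable (fun z : PathSpace N d × PathSpace N d => D z.1 * ψ z.2) π) :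
    ∫ z, D z.1 * ψ z.2 ∂π = 0 := by
  have hm : (canonFiltration N d n : MeasurableSpace (PathSpace N d)).comap Prod.snd
      ≤ (inferInstance : MeasurableSpace (PathSpace N d × PathSpace N d)) := by
    rw [← measurable_iff_comap_le]
    exact measurable_snd.mono le_rfl (canonFiltration_le n)
  refine integral_mul_eq_zero_of_condExp hm (D := fun z => D z.1) (ψ := fun z => ψ z.2)
    (hD.comp_measurable measurable_fst) (hπ.condExp_comap_snd_eq_zero hD hD0) ?_ hint
  have : Measurable[(canonFiltration N d n : MeasurableSpace (PathSpace N d)).comap Prod.snd]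
      (fun z : PathSpace N d × PathSpace N d => ψ z.2) := hψ.comp (comap_measurable _)
  exact this.stronglyMeasurable.aestronglyMeasurable

/-- The disintegration kernel of a graph is the Dirac kernel, so π_y(x, U) is the indicator of `T
⁻¹' U`. Asking for `V` only up to null sets is what makes the lemma applicable to the inverse of a
map that is not onto. -/
lemma isCausal_map_graph {μ : Measure (PathSpace N d)} [IsProbabilityMeasure μ]
    {T : PathSpace N d → PathSpace N d} (hT : Measurable T)
    (h : ∀ (n : Fin (N + 1)) (U : Set (PathSpace N d)), MeasurableSet[canonFiltration N d n] U →
      ∃ V, MeasurableSet[canonFiltration N d n] V ∧ T ⁻¹' U =ᵐ[μ] V)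
    [IsFiniteMeasure (μ.map fun x => (x, T x))] :
    IsCausal (μ.map fun x => (x, T x)) := by
  intro n U hU
  obtain ⟨V, hV, hUV⟩ := h n U hU
  have hfst : (μ.map fun x => (x, T x)).fst = μ := by
    rw [Measure.fst_map_prodMk hT, Measure.map_id']
  have hker := eq_condKernel_of_measure_eq_compProd (ρ := μ.map fun x => (x, T x))
    (Kernel.deterministic T hT) (by rw [hfst, Measure.compProd_deterministic hT])
  rw [hfst] at hker ⊢
  refine ⟨V.indicator fun _ => 1, ?_, ?_⟩
  · exact stronglyMeasurable_const.indicator hV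
  · filter_upwards [hker, hUV] with x hx hxV
    rw [← hx, Kernel.deterministic_apply]
    have hU' : MeasurableSet U := canonFiltration_le n _ hU
    have hiff : T x ∈ U ↔ x ∈ V := by
      have : (T ⁻¹' U) x = V x := hxV
      exact iff_of_eq this
    by_cases hxU : x ∈ V
    · simp [Measure.real, Measure.dirac_apply' _ hU', hxU, hiff.2 hxU]
    · have : T x ∉ U := fun h => hxU (hiff.1 h)
      simp [Measure.real, Measure.dirac_apply' _ hU', hxU, this]

lemma freeze_last (x : PathSpace N d) : freeze (Fin.last N) x = x :=
  funext fun _ => freeze_apply_of_le (Fin.le_last _) x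

/-- A map that is adapted and injective along the filtration induces a bicausal coupling. -/
lemma map_graph_mem_bicausalCouplings {μ : Measure (PathSpace N d)} [IsProbabilityMeasure μ]
    {T : PathSpace N d → PathSpace N d} (hT : Measurable T)
    (hadapted : ∀ (n : Fin (N + 1)) x, freeze n (T (freeze n x)) = freeze n (T x))
    (hinj : ∀ (n : Fin (N + 1)) x y, freeze n (T x) = freeze n (T y) → freeze n x = freeze n y) :
    (μ.map fun x => (x, T x)) ∈ bicausalCouplings μ (μ.map T) := by
  have hgraph : Measurable fun x => (x, T x) := measurable_id.prodMk hT
  have hprob : IsProbabilityMeasure (μ.map fun x => (x, T x)) :=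
    Measure.isProbabilityMeasure_map hgraph.aemeasurable
  refine ⟨hprob, ?_, ?_, ?_, ?_⟩
  · rw [Measure.fst_map_prodMk hT, Measure.map_id']
  · rw [Measure.snd_map_prodMk (X := fun x => x) measurable_id]
  · refine isCausal_map_graph hT fun n U hU => ?_
    rw [canonFiltration_eq_comap] at hU
    obtain ⟨U', hU', rfl⟩ := hU
    refine ⟨T ⁻¹' (freeze n ⁻¹' U'), ?_, ae_eq_refl _⟩
    have : T ⁻¹' (freeze n ⁻¹' U') = (fun x => freeze n (T x)) ⁻¹' U' := rfl
    rw [this]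
    exact measurable_canonFiltration_of_freeze ((measurable_freeze n).comp hT) (hadapted n) hU'
  · have hTinj : Function.Injective T := fun x y hxy => by
      have := hinj (Fin.last N) x y (by rw [hxy])
      rwa [freeze_last, freeze_last] at this
    -- An injective Borel map between standard Borel spaces has a Borel left inverse; nothing is
    -- known about `S` off the range of `T`.
    obtain ⟨S, hS, hST⟩ := (hT.measurableEmbedding hTinj).exists_measurable_extend measurable_id
      (fun _ => inferInstance)
    have hST' : ∀ x, S (T x) = x := fun x => congrFun hST x
    have hgraphS : Measurable fun y => (y, S y) := measurable_id.prodMk hS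
    have hswap : (μ.map fun x => (x, T x)).map Prod.swap = (μ.map T).map fun y => (y, S y) := by
      rw [Measure.map_map measurable_swap hgraph, Measure.map_map hgraphS hT]
      congr 1
      funext x
      simp [hST']
    have hT' : IsProbabilityMeasure (μ.map T) := Measure.isProbabilityMeasure_map hT.aemeasurable
    have hfin : IsFiniteMeasure ((μ.map T).map fun y => (y, S y)) := inferInstance
    have key : IsCausal ((μ.map T).map fun y => (y, S y)) := by
      refine isCausal_map_graph hS fun n U hU => ?_
      rw [canonFiltration_eq_comap] at hU
      obtain ⟨U', hU', rfl⟩ := hU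
      -- On frozen paths `freeze n ∘ T` is injective, so by Lusin–Souslin the image of this Borel
      -- set is Borel. Its preimage under `freeze n` is the F_n-set that represents the preimage
      -- under `S`.
      set B : Set (PathSpace N d) := U' ∩ {x | freeze n x = x} with hB
      have hBm : MeasurableSet B :=
        hU'.inter (measurableSet_eq_fun (measurable_freeze n) measurable_id)
      have himg : MeasurableSet ((fun x => freeze n (T x)) '' B) := by
        refine hBm.image_of_measurable_injOn ((measurable_freeze n).comp hT) ?_
        rintro x ⟨-, hx⟩ y ⟨-, hy⟩ hxy
        have := hinj n x y hxy
        rwa [hx, hy] at this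
      refine ⟨freeze n ⁻¹' ((fun x => freeze n (T x)) '' B), ?_, ?_⟩
      · exact measurable_canonFiltration_freeze n himg
      · have hm1 : MeasurableSet (S ⁻¹' (freeze n ⁻¹' U')) := hS (measurable_freeze n hU')
        have hm2 : MeasurableSet (freeze n ⁻¹' ((fun x => freeze n (T x)) '' B)) :=
          measurable_freeze n himg
        have hiff : ∀ x,
            freeze n (S (T x)) ∈ U' ↔ freeze n (T x) ∈ (fun x => freeze n (T x)) '' B := by
          intro x
          rw [hST']
          constructor
          · intro hx
            exact ⟨freeze n x, ⟨hx, freeze_freeze_self n x⟩, hadapted n x⟩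
          · rintro ⟨y, ⟨hyU, hy⟩, hxy⟩
            have h1 : freeze n y = freeze n x := hinj n y x hxy
            rw [← h1, hy]
            exact hyU
        have hae : ∀ᵐ y ∂(μ.map T), freeze n (S y) ∈ U' ↔
            freeze n y ∈ (fun x => freeze n (T x)) '' B := by
          refine (ae_map_iff hT.aemeasurable ?_).2 (ae_of_all _ hiff)
          exact hm1.iff hm2
        filter_upwards [hae] with y hy
        exact propext hy
    convert key

end MartDRO

/-! ### The Taylor remainder along couplings -/

namespace MartDRO

variable {N d : ℕ}

lemma add_rpow_le {s a b : ℝ} (hs : 0 ≤ s) (ha : 0 ≤ a) (hb : 0 ≤ b) :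
    (a + b) ^ s ≤ 2 ^ s * (a ^ s + b ^ s) := by
  have h1 : a + b ≤ 2 * max a b := by
    have := le_max_left a b
    have := le_max_right a b
    linarith
  have h2 : (max a b) ^ s ≤ a ^ s + b ^ s := by
    rcases le_total a b with h | h
    · rw [max_eq_right h]
      have := Real.rpow_nonneg ha s
      linarith
    · rw [max_eq_left h]
      have := Real.rpow_nonneg hb s
      linarith
  calc (a + b) ^ s ≤ (2 * max a b) ^ s := Real.rpow_le_rpow (by positivity) h1 hs
    _ = 2 ^ s * (max a b) ^ s := Real.mul_rpow (by norm_num) (le_max_of_le_left ha)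
    _ ≤ _ := by gcongr

/-- Mean value inequality on the ball of radius ‖z‖ around x, where the growth bound controls the
variation of the derivative. -/
lemma exists_taylor_remainder_le_rpow {p : ℝ} (hp : 1 < p) {f : PathSpace N d → ℝ}
    (hf : ContDiff ℝ 1 f) {c : ℝ} (hc0 : 0 ≤ c)
    (hc : ∀ x, ‖fderiv ℝ f x‖ ≤ c * (1 + ‖x‖ ^ (p - 1))) :
    ∃ C : ℝ, 0 ≤ C ∧ ∀ x z : PathSpace N d, |f (x + z) - f x - fderiv ℝ f x z|
      ≤ C * (1 + ‖x‖ ^ (p - 1)) * ‖z‖ + C * ‖z‖ ^ p := by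
  have hs : 0 ≤ p - 1 := by linarith
  set M : ℝ := 2 ^ (p - 1) with hM
  have hM0 : 0 ≤ M := by positivity
  refine ⟨c * (2 + M), by positivity, fun x z => ?_⟩
  have hxs : 0 ≤ ‖x‖ ^ (p - 1) := by positivity
  have hzs : 0 ≤ ‖z‖ ^ (p - 1) := by positivity
  have hbound : ∀ y ∈ Metric.closedBall x ‖z‖, ‖fderiv ℝ f y - fderiv ℝ f x‖
      ≤ c * (2 + M) * (1 + ‖x‖ ^ (p - 1)) + c * (2 + M) * ‖z‖ ^ (p - 1) := by
    intro y hy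
    have hy' : ‖y‖ ≤ ‖x‖ + ‖z‖ := by
      rw [mem_closedBall_iff_norm] at hy
      calc ‖y‖ = ‖x + (y - x)‖ := by rw [add_sub_cancel]
        _ ≤ ‖x‖ + ‖y - x‖ := norm_add_le _ _
        _ ≤ _ := by linarith
    have h1 : ‖y‖ ^ (p - 1) ≤ M * (‖x‖ ^ (p - 1) + ‖z‖ ^ (p - 1)) :=
      (Real.rpow_le_rpow (norm_nonneg _) hy' hs).trans
        (add_rpow_le hs (norm_nonneg _) (norm_nonneg _))
    calc ‖fderiv ℝ f y - fderiv ℝ f x‖ ≤ ‖fderiv ℝ f y‖ + ‖fderiv ℝ f x‖ := norm_sub_le _ _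
      _ ≤ c * (1 + ‖y‖ ^ (p - 1)) + c * (1 + ‖x‖ ^ (p - 1)) := add_le_add (hc y) (hc x)
      _ ≤ c * (1 + M * (‖x‖ ^ (p - 1) + ‖z‖ ^ (p - 1))) + c * (1 + ‖x‖ ^ (p - 1)) := by gcongr
      _ = c * (2 + (M + 1) * ‖x‖ ^ (p - 1) + M * ‖z‖ ^ (p - 1)) := by ring
      _ ≤ c * ((2 + M) * (1 + ‖x‖ ^ (p - 1)) + (2 + M) * ‖z‖ ^ (p - 1)) := by
          refine mul_le_mul_of_nonneg_left ?_ hc0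
          nlinarith
      _ = _ := by ring
  have h := (convex_closedBall x ‖z‖).norm_image_sub_le_of_norm_fderiv_le'
    (fun y _ => (hf.differentiable one_ne_zero) y) hbound
    (Metric.mem_closedBall_self (norm_nonneg z)) (y := x + z) (by simp)
  rw [add_sub_cancel_left, Real.norm_eq_abs] at h
  refine h.trans (le_of_eq ?_)
  have hzp : ‖z‖ ^ p = ‖z‖ ^ (p - 1) * ‖z‖ := by
    rw [← Real.rpow_add_one' (norm_nonneg _) (by linarith)]
    congr 1
    ring
  rw [hzp]
  ring

/-- A first order Taylor estimate which is uniform in the base point, up to a tail. -/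
lemma exists_taylor_remainder_le {p : ℝ} (hp : 1 < p) {f : PathSpace N d → ℝ}
    (hf : ContDiff ℝ 1 f) {c : ℝ} (hc0 : 0 ≤ c)
    (hc : ∀ x, ‖fderiv ℝ f x‖ ≤ c * (1 + ‖x‖ ^ (p - 1))) :
    ∃ C₀ : ℝ, 0 ≤ C₀ ∧ ∀ K ε : ℝ, 0 < ε → ∃ C : ℝ, 0 ≤ C ∧ ∀ x z : PathSpace N d,
      |f (x + z) - f x - fderiv ℝ f x z|
        ≤ ε * ‖z‖ + C₀ * ({x : PathSpace N d | K < ‖x‖}.indicator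
            (fun x => 1 + ‖x‖ ^ (p - 1)) x * ‖z‖) + C * ‖z‖ ^ p := by
  obtain ⟨C₁, hC₁, hglob⟩ := exists_taylor_remainder_le_rpow hp hf hc0 hc
  refine ⟨C₁, hC₁, fun K ε hε => ?_⟩
  have hs : 0 < p - 1 := by linarith
  have huc := (isCompact_closedBall (0 : PathSpace N d) (K + 1)).uniformContinuousOn_of_continuous
    (hf.continuous_fderiv one_ne_zero).continuousOn
  obtain ⟨r', hr', hr⟩ := Metric.uniformContinuousOn_iff.1 huc ε hε
  -- The cap at 1 keeps the ball of radius ‖z‖ < r around x inside the compact ball of radius K + 1.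
  set r := min r' 1 with hrdef
  have hr0 : 0 < r := lt_min hr' one_pos
  -- The quotient serves the case ‖x‖ ≤ K, ‖z‖ ≥ r, where ‖z‖ ≤ ‖z‖^p / r^(p-1). For ‖z‖ < r,
  -- uniform continuity of the derivative gives `ε`; for ‖x‖ > K the global bound goes into the tail
  -- term, with a constant independent of `K` and `ε`.
  refine ⟨C₁ + C₁ * (1 + |K| ^ (p - 1)) / r ^ (p - 1), by positivity, fun x z => ?_⟩
  have hzp : ‖z‖ ^ p = ‖z‖ ^ (p - 1) * ‖z‖ := by
    rw [← Real.rpow_add_one' (norm_nonneg _) (by linarith)]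
    congr 1
    ring
  have hzp0 : 0 ≤ ‖z‖ ^ p := by positivity
  have hE : 0 ≤ C₁ * (1 + |K| ^ (p - 1)) / r ^ (p - 1) := by positivity
  by_cases hx : K < ‖x‖
  · rw [Set.indicator_of_mem (by exact hx)]
    have := hglob x z
    have := mul_nonneg hE hzp0
    have := mul_nonneg hε.le (norm_nonneg z)
    linarith
  · rw [Set.indicator_of_notMem (by exact hx)]
    push Not at hx
    rcases lt_or_ge ‖z‖ r with hz | hz
    · have hmem : ∀ y ∈ Metric.closedBall x ‖z‖,
          y ∈ Metric.closedBall (0 : PathSpace N d) (K + 1) := by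
        intro y hy
        rw [mem_closedBall_iff_norm] at hy
        rw [mem_closedBall_zero_iff]
        have h1 : r ≤ 1 := min_le_right _ _
        calc ‖y‖ = ‖x + (y - x)‖ := by rw [add_sub_cancel]
          _ ≤ ‖x‖ + ‖y - x‖ := norm_add_le _ _
          _ ≤ _ := by linarith
      have hbound : ∀ y ∈ Metric.closedBall x ‖z‖, ‖fderiv ℝ f y - fderiv ℝ f x‖ ≤ ε := by
        intro y hy
        rw [← dist_eq_norm]
        refine (hr y (hmem y hy) x (hmem x (Metric.mem_closedBall_self (norm_nonneg _))) ?_).le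
        exact (Metric.mem_closedBall.1 hy).trans_lt (hz.trans_le (min_le_left _ _))
      have h := (convex_closedBall x ‖z‖).norm_image_sub_le_of_norm_fderiv_le'
        (fun y _ => (hf.differentiable one_ne_zero) y) hbound
        (Metric.mem_closedBall_self (norm_nonneg z)) (y := x + z) (by simp)
      rw [add_sub_cancel_left, Real.norm_eq_abs] at h
      have : 0 ≤ (C₁ + C₁ * (1 + |K| ^ (p - 1)) / r ^ (p - 1)) * ‖z‖ ^ p := by positivity
      linarith
    · have hxK : ‖x‖ ^ (p - 1) ≤ |K| ^ (p - 1) :=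
        Real.rpow_le_rpow (norm_nonneg _) (hx.trans (le_abs_self K)) hs.le
      have hz1 : 1 ≤ ‖z‖ ^ (p - 1) / r ^ (p - 1) := by
        rw [one_le_div (by positivity)]
        exact Real.rpow_le_rpow hr0.le hz hs.le
      have h1 : C₁ * (1 + ‖x‖ ^ (p - 1)) * ‖z‖
          ≤ C₁ * (1 + |K| ^ (p - 1)) / r ^ (p - 1) * ‖z‖ ^ p := by
        calc C₁ * (1 + ‖x‖ ^ (p - 1)) * ‖z‖
            ≤ C₁ * (1 + |K| ^ (p - 1)) * ‖z‖ := by gcongr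
          _ ≤ C₁ * (1 + |K| ^ (p - 1)) * ‖z‖ * (‖z‖ ^ (p - 1) / r ^ (p - 1)) :=
              le_mul_of_one_le_right (by positivity) hz1
          _ = _ := by rw [hzp]; ring
      have := hglob x z
      have := mul_nonneg hε.le (norm_nonneg z)
      linarith

lemma memLp_ofReal_iff {Ω : Type*} {m : MeasurableSpace Ω} {μ : Measure Ω} {r : ℝ} (hr : 0 < r)
    {E : Type*} [NormedAddCommGroup E] {u : Ω → E} (hu : AEStronglyMeasurable u μ) :
    MemLp u (ENNReal.ofReal r) μ ↔ Integrable (fun x => ‖u x‖ ^ r) μ := by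
  rw [← integrable_norm_rpow_iff hu (by simpa using hr) ENNReal.ofReal_ne_top,
    ENNReal.toReal_ofReal hr.le]

lemma integrable_mul_of_memLp {Ω : Type*} {m : MeasurableSpace Ω} {μ : Measure Ω} {p q : ℝ}
    (hpq : p.HolderConjugate q) {u v : Ω → ℝ} (hu : MemLp u (ENNReal.ofReal q) μ)
    (hv : MemLp v (ENNReal.ofReal p) μ) : Integrable (fun x => u x * v x) μ := by
  have := hpq.symm.ennrealOfReal
  exact hu.integrable_mul hv

lemma memLp_rpow_inv {Ω : Type*} {m : MeasurableSpace Ω} {μ : Measure Ω} {p : ℝ} (hp : 0 < p)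
    {u : Ω → ℝ} (hu0 : ∀ x, 0 ≤ u x) (hu : Integrable u μ) :
    MemLp (fun x => u x ^ (1 / p)) (ENNReal.ofReal p) μ := by
  have hm : AEStronglyMeasurable (fun x => u x ^ (1 / p)) μ :=
    (hu.aestronglyMeasurable.aemeasurable.pow_const _).aestronglyMeasurable
  rw [memLp_ofReal_iff hp hm]
  refine hu.congr (ae_of_all _ fun x => ?_)
  simp only
  rw [Real.norm_of_nonneg (Real.rpow_nonneg (hu0 x) _), ← Real.rpow_mul (hu0 x),
    one_div_mul_cancel hp.ne', Real.rpow_one]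

/-- Hölder's inequality for a nonnegative function of the first path and the transport cost. -/
lemma integral_mul_cost_le {p q : ℝ} (hpq : p.HolderConjugate q)
    {π : Measure (PathSpace N d × PathSpace N d)}
    (hcost : Integrable (fun z => cost p z.1 z.2) π)
    {H : PathSpace N d → ℝ} (hH0 : ∀ x, 0 ≤ H x) (hH : MemLp H (ENNReal.ofReal q) π.fst) :
    ∫ z, H z.1 * cost p z.1 z.2 ^ (1 / p) ∂π
      ≤ (∫ x, H x ^ q ∂π.fst) ^ (1 / q) * (∫ z, cost p z.1 z.2 ∂π) ^ (1 / p) := by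
  have hfst : MeasurePreserving Prod.fst π π.fst := ⟨measurable_fst, rfl⟩
  have h1 : MemLp (fun z : PathSpace N d × PathSpace N d => H z.1) (ENNReal.ofReal q) π :=
    hH.comp_measurePreserving hfst
  have h2 := memLp_rpow_inv hpq.pos
    (u := fun z : PathSpace N d × PathSpace N d => cost p z.1 z.2)
    (fun z => cost_nonneg p z.1 z.2) hcost
  have h3 := integral_mul_le_Lp_mul_Lq_of_nonneg hpq.symm
    (f := fun z : PathSpace N d × PathSpace N d => H z.1)
    (g := fun z : PathSpace N d × PathSpace N d => cost p z.1 z.2 ^ (1 / p))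
    (ae_of_all _ fun z => hH0 z.1)
    (ae_of_all _ fun z => Real.rpow_nonneg (cost_nonneg p z.1 z.2) _) h1 h2
  have h4 : ∫ z, H z.1 ^ q ∂π = ∫ x, H x ^ q ∂π.fst := by
    rw [Measure.fst, integral_map measurable_fst.aemeasurable]
    exact (hH.aestronglyMeasurable.aemeasurable.pow_const q).aestronglyMeasurable
  have h5 : ∀ z : PathSpace N d × PathSpace N d,
      (cost p z.1 z.2 ^ (1 / p)) ^ p = cost p z.1 z.2 := fun z => by
    rw [← Real.rpow_mul (cost_nonneg _ _ _), one_div_mul_cancel hpq.ne_zero, Real.rpow_one]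
  simp only [h5, h4] at h3
  exact h3

/-- Since (p - 1)q = p, the integrand is dominated by a multiple of 1 + ‖x‖^p, and at each x it
vanishes once K ≥ ‖x‖. -/
lemma tendsto_integral_tail {p q : ℝ} (hpq : p.HolderConjugate q) {μ : Measure (PathSpace N d)}
    [IsFiniteMeasure μ] (hμ : Integrable (fun x => ‖x‖ ^ p) μ) :
    Tendsto (fun K : ℕ => ∫ x, ({x : PathSpace N d | (K : ℝ) < ‖x‖}.indicator
      (fun x => 1 + ‖x‖ ^ (p - 1)) x) ^ q ∂μ) atTop (𝓝 0) := by
  have hp1 : 0 < p - 1 := by linarith [hpq.lt]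
  have hbound : ∀ x : PathSpace N d, (1 + ‖x‖ ^ (p - 1)) ^ q ≤ 2 ^ q * (1 + ‖x‖ ^ p) := by
    intro x
    refine (add_rpow_le hpq.symm.nonneg zero_le_one (by positivity)).trans (le_of_eq ?_)
    rw [Real.one_rpow, ← Real.rpow_mul (norm_nonneg _), hpq.sub_one_mul_conj]
  have hmeas : ∀ K : ℕ, MeasurableSet {x : PathSpace N d | (K : ℝ) < ‖x‖} := fun K =>
    measurableSet_lt measurable_const measurable_norm
  have h0 : (0 : ℝ) = ∫ _x : PathSpace N d, (0 : ℝ) ∂μ := by simp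
  rw [h0]
  refine tendsto_integral_of_dominated_convergence (fun x => 2 ^ q * (1 + ‖x‖ ^ p)) ?_ ?_ ?_ ?_
  · intro K
    refine (Measurable.pow_const (Measurable.indicator ?_ (hmeas K)) q).aestronglyMeasurable
    exact measurable_const.add (measurable_norm.pow_const _)
  · exact ((integrable_const _).add hμ).const_mul _
  · intro K
    refine ae_of_all _ fun x => ?_
    by_cases hx : (K : ℝ) < ‖x‖
    · rw [Set.indicator_of_mem (by exact hx), Real.norm_of_nonneg (by positivity)]
      exact hbound x
    · rw [Set.indicator_of_notMem (by exact hx), Real.zero_rpow hpq.symm.ne_zero, norm_zero]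
      positivity
  · refine ae_of_all _ fun x => ?_
    obtain ⟨K₀, hK₀⟩ := exists_nat_ge ‖x‖
    refine tendsto_const_nhds.congr' ?_
    filter_upwards [eventually_ge_atTop K₀] with K hK
    have : ¬ (K : ℝ) < ‖x‖ := not_lt.2 (hK₀.trans (by exact_mod_cast hK))
    rw [Set.indicator_of_notMem (by exact this), Real.zero_rpow hpq.symm.ne_zero]

/-- The tail depends on x alone, so Hölder's inequality meets it only through its norm in L^q(μ),
which the choice of K makes small. Hence the estimate is uniform over all couplings with first
marginal μ; causality plays no role. -/
lemma exists_integral_remainder_le {p q : ℝ} (hpq : p.HolderConjugate q) {f : PathSpace N d → ℝ}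
    (hf : ContDiff ℝ 1 f) {c : ℝ} (hc0 : 0 ≤ c)
    (hc : ∀ x, ‖fderiv ℝ f x‖ ≤ c * (1 + ‖x‖ ^ (p - 1)))
    {μ : Measure (PathSpace N d)} [IsProbabilityMeasure μ]
    (hμ : Integrable (fun x => ‖x‖ ^ p) μ) {ε : ℝ} (hε : 0 < ε) :
    ∃ C : ℝ, 0 ≤ C ∧ ∀ π : Measure (PathSpace N d × PathSpace N d), π.fst = μ →
      Integrable (fun z => cost p z.1 z.2) π →
      ∫ z, |f z.2 - f z.1 - fderiv ℝ f z.1 (z.2 - z.1)| ∂π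
        ≤ ε * (∫ z, cost p z.1 z.2 ∂π) ^ (1 / p) + C * ∫ z, cost p z.1 z.2 ∂π := by
  have hp1 : 0 < p - 1 := by linarith [hpq.lt]
  obtain ⟨C₀, hC₀, hR⟩ := exists_taylor_remainder_le hpq.lt hf hc0 hc
  have htail := (tendsto_integral_tail hpq hμ).rpow_const (p := 1 / q)
    (Or.inr (by have := hpq.symm.pos; positivity))
  rw [Real.zero_rpow (by have := hpq.symm.pos; positivity)] at htail
  -- The uniform term contributes N ε' and the tail C₀ N ε', and (1 + C₀) N ε' ≤ ε.
  set ε' : ℝ := ε / (2 * (N + 1) * (C₀ + 1)) with hε'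
  have hε'0 : 0 < ε' := by positivity
  obtain ⟨K, hK⟩ := ((htail.eventually (gt_mem_nhds hε'0)).exists)
  obtain ⟨C, hC, hR⟩ := hR K ε' hε'0
  refine ⟨C * N ^ p, by positivity, fun π hπ hcost => ?_⟩
  set G : PathSpace N d → ℝ := {x : PathSpace N d | (K : ℝ) < ‖x‖}.indicator
    (fun x => 1 + ‖x‖ ^ (p - 1)) with hG
  have hG0 : ∀ x, 0 ≤ G x := fun x => Set.indicator_nonneg (fun x _ => by positivity) x
  have hmeasK : MeasurableSet {x : PathSpace N d | (K : ℝ) < ‖x‖} :=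
    measurableSet_lt measurable_const measurable_norm
  have hGm : Measurable G :=
    (measurable_const.add (measurable_norm.pow_const _)).indicator hmeasK
  have hGL : MemLp G (ENNReal.ofReal q) μ := by
    rw [memLp_ofReal_iff hpq.symm.pos hGm.aestronglyMeasurable]
    refine Integrable.mono' (g := fun x => 2 ^ q * (1 + ‖x‖ ^ p))
      (((integrable_const _).add hμ).const_mul _)
      (hGm.norm.pow_const q).aestronglyMeasurable (ae_of_all _ fun x => ?_)
    rw [Real.norm_of_nonneg (by positivity), Real.norm_of_nonneg (hG0 x)]
    calc G x ^ q ≤ (1 + ‖x‖ ^ (p - 1)) ^ q := by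
          refine Real.rpow_le_rpow (hG0 x) ?_ hpq.symm.nonneg
          exact Set.indicator_le_self' (fun x _ => by positivity) x
      _ ≤ 2 ^ q * (1 ^ q + (‖x‖ ^ (p - 1)) ^ q) :=
          add_rpow_le hpq.symm.nonneg zero_le_one (by positivity)
      _ = _ := by rw [Real.one_rpow, ← Real.rpow_mul (norm_nonneg _), hpq.sub_one_mul_conj]
  have h1L : MemLp (fun _ : PathSpace N d => (1 : ℝ)) (ENNReal.ofReal q) μ := memLp_const 1
  set ρ := (∫ z, cost p z.1 z.2 ∂π) ^ (1 / p) with hρ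
  have hρ0 : 0 ≤ ρ := Real.rpow_nonneg (integral_nonneg fun z => cost_nonneg _ _ _) _
  have hi1 := integral_mul_cost_le hpq hcost (H := fun _ => 1) (fun _ => zero_le_one)
    (by rw [hπ]; exact h1L)
  have hi2 := integral_mul_cost_le hpq hcost hG0 (by rw [hπ]; exact hGL)
  rw [hπ, ← hρ] at hi1 hi2
  simp only [one_mul, Real.one_rpow, integral_const, probReal_univ, smul_eq_mul] at hi1
  have hi2' : ∫ z, G z.1 * cost p z.1 z.2 ^ (1 / p) ∂π ≤ ε' * ρ :=
    hi2.trans (mul_le_mul_of_nonneg_right hK.le hρ0)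
  have hfst : MeasurePreserving Prod.fst π μ := ⟨measurable_fst, hπ⟩
  have hcL := memLp_rpow_inv hpq.pos
    (u := fun z : PathSpace N d × PathSpace N d => cost p z.1 z.2)
    (fun z => cost_nonneg p z.1 z.2) hcost
  have hint1 :
      Integrable (fun z : PathSpace N d × PathSpace N d => cost p z.1 z.2 ^ (1 / p)) π := by
    have := integrable_mul_of_memLp hpq (h1L.comp_measurePreserving hfst) hcL
    simpa using this
  have hint2 : Integrable (fun z : PathSpace N d × PathSpace N d =>
      G z.1 * cost p z.1 z.2 ^ (1 / p)) π :=
    integrable_mul_of_memLp hpq (hGL.comp_measurePreserving hfst) hcL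
  have hpt : ∀ z : PathSpace N d × PathSpace N d,
      |f z.2 - f z.1 - fderiv ℝ f z.1 (z.2 - z.1)|
        ≤ ε' * N * cost p z.1 z.2 ^ (1 / p) + C₀ * N * (G z.1 * cost p z.1 z.2 ^ (1 / p))
          + C * N ^ p * cost p z.1 z.2 := by
    intro z
    have h := hR z.1 (z.2 - z.1)
    rw [add_sub_cancel] at h
    have hn := norm_sub_le_cost hpq.pos z.1 z.2
    have hn2 : ‖z.2 - z.1‖ ^ p ≤ N ^ p * cost p z.1 z.2 := by
      refine (Real.rpow_le_rpow (norm_nonneg _) hn hpq.nonneg).trans (le_of_eq ?_)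
      rw [Real.mul_rpow (by positivity) (Real.rpow_nonneg (cost_nonneg _ _ _) _),
        ← Real.rpow_mul (cost_nonneg _ _ _), one_div_mul_cancel hpq.ne_zero, Real.rpow_one]
    calc _ ≤ _ := h
      _ ≤ ε' * (N * cost p z.1 z.2 ^ (1 / p)) + C₀ * (G z.1 * (N * cost p z.1 z.2 ^ (1 / p)))
          + C * (N ^ p * cost p z.1 z.2) := by
          have := hG0 z.1
          gcongr
      _ = _ := by ring
  calc ∫ z, |f z.2 - f z.1 - fderiv ℝ f z.1 (z.2 - z.1)| ∂π
      ≤ ∫ z, (ε' * N * cost p z.1 z.2 ^ (1 / p) + C₀ * N * (G z.1 * cost p z.1 z.2 ^ (1 / p))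
          + C * N ^ p * cost p z.1 z.2) ∂π := by
        refine integral_mono_of_nonneg (ae_of_all _ fun z => abs_nonneg _) ?_ (ae_of_all _ hpt)
        exact ((hint1.const_mul _).add (hint2.const_mul _)).add (hcost.const_mul _)
    _ = ε' * N * ∫ z, cost p z.1 z.2 ^ (1 / p) ∂π
          + C₀ * N * ∫ z, G z.1 * cost p z.1 z.2 ^ (1 / p) ∂π
          + C * N ^ p * ∫ z, cost p z.1 z.2 ∂π := by
        have i1 := hint1.const_mul (ε' * N)
        have i2 := hint2.const_mul (C₀ * N)
        have i12 : Integrable (fun z : PathSpace N d × PathSpace N d =>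
          ε' * N * cost p z.1 z.2 ^ (1 / p) + C₀ * N * (G z.1 * cost p z.1 z.2 ^ (1 / p))) π :=
          i1.add i2
        rw [integral_add i12 (hcost.const_mul _), integral_add i1 i2]
        simp only [integral_const_mul]
    _ ≤ ε' * N * ρ + C₀ * N * (ε' * ρ) + C * N ^ p * ∫ z, cost p z.1 z.2 ∂π := by
        gcongr
    _ ≤ ε * ρ + C * N ^ p * ∫ z, cost p z.1 z.2 ∂π := by
        have : ε' * N + C₀ * N * ε' ≤ ε := by
          have h1 : ε' * (2 * (N + 1) * (C₀ + 1)) = ε := by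
            rw [hε']; field_simp
          have h2 : 0 ≤ ε' * (C₀ + 1) := by positivity
          have h3 : (0:ℝ) ≤ N := Nat.cast_nonneg N
          nlinarith [mul_nonneg h2 h3]
        nlinarith [mul_le_mul_of_nonneg_right this hρ0]

end MartDRO

/-! ### Integrability, projections and Hölder's inequality for processes -/

namespace MartDRO

variable {N d : ℕ}

/-- The real number `(∑_n E_μ[|B_n|_q^q])^{1/q}`. -/
noncomputable def lqDist (q : ℝ) (μ : Measure (PathSpace N d))
    (B : Fin N → PathSpace N d → Fin d → ℝ) : ℝ :=
  (∑ n, ∑ i, ∫ x, |B n x i| ^ q ∂μ) ^ (1 / q)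

lemma lqDist_nonneg (q : ℝ) (μ : Measure (PathSpace N d))
    (B : Fin N → PathSpace N d → Fin d → ℝ) : 0 ≤ lqDist q μ B :=
  Real.rpow_nonneg (Finset.sum_nonneg fun _ _ => Finset.sum_nonneg fun _ _ =>
    integral_nonneg fun _ => Real.rpow_nonneg (abs_nonneg _) _) _

lemma integrable_abs_rpow {Ω : Type*} {m : MeasurableSpace Ω} {μ : Measure Ω} {q : ℝ} (hq : 0 < q)
    {u : Ω → ℝ} (hu : MemLp u (ENNReal.ofReal q) μ) : Integrable (fun x => |u x| ^ q) μ :=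
  (memLp_ofReal_iff hq hu.aestronglyMeasurable).1 hu

lemma LqNorm_eq {q : ℝ} (hq : 0 < q) {μ : Measure (PathSpace N d)}
    {B : Fin N → PathSpace N d → Fin d → ℝ}
    (hB : ∀ n i, MemLp (fun x => B n x i) (ENNReal.ofReal q) μ) :
    LqNorm q μ B = ENNReal.ofReal (lqDist q μ B) := by
  have hi : ∀ n i, Integrable (fun x => |B n x i| ^ q) μ := fun n i =>
    integrable_abs_rpow hq (hB n i)
  have h0 : ∀ n, 0 ≤ ∑ i, ∫ x, |B n x i| ^ q ∂μ := fun n => Finset.sum_nonneg fun _ _ =>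
    integral_nonneg fun _ => Real.rpow_nonneg (abs_nonneg _) _
  rw [LqNorm, lqDist, ← ENNReal.ofReal_rpow_of_nonneg (Finset.sum_nonneg fun n _ => h0 n)
    (by positivity), ENNReal.ofReal_sum_of_nonneg fun n _ => h0 n]
  congr 1
  refine Finset.sum_congr rfl fun n _ => ?_
  rw [← integral_finsetSum _ fun i _ => hi n i,
    ofReal_integral_eq_lintegral_ofReal (integrable_finsetSum _ fun i _ => hi n i)
      (ae_of_all _ fun x => Finset.sum_nonneg fun _ _ => Real.rpow_nonneg (abs_nonneg _) _)]
  simp only [lrNorm_rpow hq]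

lemma predictableLq.memLp {q : ℝ} (hq : 0 < q) {μ : Measure (PathSpace N d)}
    {h : Fin N → PathSpace N d → Fin d → ℝ} (hh : h ∈ predictableLq q μ) (n : Fin N) (i : Fin d) :
    MemLp (fun x => h n x i) (ENNReal.ofReal q) μ := by
  obtain ⟨hm, hfin⟩ := hh
  have hmn : Measurable (h n) := (hm n).mono (canonFiltration_le _) le_rfl
  have hmi : Measurable fun x => h n x i := (measurable_pi_apply i).comp hmn
  rw [memLp_ofReal_iff hq hmi.aestronglyMeasurable]
  refine ⟨(hmi.norm.pow_const q).aestronglyMeasurable, ?_⟩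
  rw [hasFiniteIntegral_iff_ofReal (ae_of_all _ fun x => Real.rpow_nonneg (norm_nonneg _) _)]
  rw [LqNorm, ENNReal.rpow_lt_top_iff_of_pos (by positivity), ENNReal.sum_lt_top] at hfin
  refine lt_of_le_of_lt (lintegral_mono fun x => ENNReal.ofReal_le_ofReal ?_)
    (hfin n (Finset.mem_univ n))
  rw [lrNorm_rpow hq]
  exact Finset.single_le_sum (f := fun i => |h n x i| ^ q) (fun i _ => by positivity)
    (Finset.mem_univ i)

lemma integrable_norm_rpow_of_mem {p : ℝ} (hp : 0 < p) {ν : Measure (PathSpace N d)}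
    (hν : ν ∈ martingaleMeasures N d p) : Integrable (fun x => ‖x‖ ^ p) ν := by
  refine ⟨(measurable_norm.pow_const p).aestronglyMeasurable, ?_⟩
  rw [hasFiniteIntegral_iff_ofReal (ae_of_all _ fun x => Real.rpow_nonneg (norm_nonneg _) _)]
  refine lt_of_le_of_lt (lintegral_mono fun x => ENNReal.ofReal_le_ofReal ?_) hν.2.1
  exact Real.rpow_le_rpow (norm_nonneg _) (norm_le_pathNorm hp x) hp.le

lemma memLp_id_of_integrable {p : ℝ} (hp : 0 < p) {ν : Measure (PathSpace N d)}
    (hν : Integrable (fun x => ‖x‖ ^ p) ν) :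
    MemLp (fun x : PathSpace N d => x) (ENNReal.ofReal p) ν :=
  (memLp_ofReal_iff hp measurable_id.aestronglyMeasurable).2 hν

lemma memLp_increment {p : ℝ} (hp : 0 < p) {ν : Measure (PathSpace N d)}
    (hν : Integrable (fun x => ‖x‖ ^ p) ν) (n : Fin N) (i : Fin d) :
    MemLp (fun x => increment x n i) (ENNReal.ofReal p) ν := by
  refine (memLp_id_of_integrable hp hν).of_le_mul (c := 2)
    ((measurable_pi_apply i).comp (measurable_increment n)).aestronglyMeasurable
    (ae_of_all _ fun x => ?_)
  exact abs_increment_le x n i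

lemma integrable_of_memLp {Ω : Type*} {m : MeasurableSpace Ω} {μ : Measure Ω} [IsFiniteMeasure μ]
    {E : Type*} [NormedAddCommGroup E] {p : ℝ}
    (hp : 1 ≤ p) {u : Ω → E} (hu : MemLp u (ENNReal.ofReal p) μ) : Integrable u μ :=
  hu.integrable (by simpa using hp)

lemma condExp_apply {Ω : Type*} {m m0 : MeasurableSpace Ω} {μ : Measure Ω} {u : Ω → Fin d → ℝ}
    (hu : Integrable u μ) (i : Fin d) :
    (fun x => (μ[u | m]) x i) =ᵐ[μ] μ[fun x => u x i | m] :=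
  ContinuousLinearMap.comp_condExp_comm hu (ContinuousLinearMap.proj (R := ℝ) (φ := fun _ => ℝ) i)

lemma condExp_increment {p : ℝ} {ν : Measure (PathSpace N d)}
    (hν : ν ∈ martingaleMeasures N d p) (n : Fin N) (i : Fin d) :
    ν[fun x => increment x n i | canonFiltration N d n.castSucc] =ᵐ[ν] 0 := by
  have hprob := hν.1
  have hmart := hν.2.2
  have hint := hmart.integrable
  have h1 : ν[fun x => increment x n | canonFiltration N d n.castSucc] =ᵐ[ν] 0 := by
    have h2 := condExp_sub (hint n.succ) (hint n.castSucc)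
      (canonFiltration N d n.castSucc : MeasurableSpace (PathSpace N d))
    have h3 := hmart.2 n.castSucc n.succ n.castSucc_lt_succ.le
    have h4 := hmart.2 n.castSucc n.castSucc le_rfl
    refine EventuallyEq.trans h2 ?_
    filter_upwards [h3, h4] with x hx3 hx4
    rw [Pi.sub_apply, hx3, hx4, sub_self, Pi.zero_apply]
  have hinc : Integrable (fun x : PathSpace N d => increment x n) ν :=
    (hint n.succ).sub (hint n.castSucc)
  refine (condExp_apply hinc i).symm.trans ?_
  filter_upwards [h1] with x hx
  rw [hx]
  rfl

section projections

variable {p q : ℝ} {f : PathSpace N d → ℝ} {μ : Measure (PathSpace N d)}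

lemma memLp_malliavin (hpq : p.HolderConjugate q) (hf : ContDiff ℝ 1 f)
    (hfgrowth : ∃ C : ℝ, ∀ x : PathSpace N d,
      pathNorm p (fun n => malliavin f n x) ≤ C * (1 + pathNorm p x ^ (p - 1)))
    [IsFiniteMeasure μ] (hμ : Integrable (fun x => ‖x‖ ^ p) μ) (n : Fin N) (i : Fin d) :
    MemLp (fun x => malliavin f n x i) (ENNReal.ofReal q) μ := by
  obtain ⟨C, hC0, hC⟩ := exists_abs_malliavin_le hpq.lt hfgrowth
  have hm : Measurable fun x => malliavin f n x i := (continuous_malliavin hf n i).measurable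
  rw [memLp_ofReal_iff hpq.symm.pos hm.aestronglyMeasurable]
  refine Integrable.mono' (g := fun x => C ^ q * (2 ^ q * (1 + ‖x‖ ^ p)))
    ((((integrable_const _).add hμ).const_mul _).const_mul _)
    (hm.norm.pow_const q).aestronglyMeasurable (ae_of_all _ fun x => ?_)
  rw [Real.norm_of_nonneg (by positivity), Real.norm_eq_abs]
  calc |malliavin f n x i| ^ q ≤ (C * (1 + ‖x‖ ^ (p - 1))) ^ q :=
        Real.rpow_le_rpow (abs_nonneg _) (hC x n i) hpq.symm.nonneg
    _ = C ^ q * (1 + ‖x‖ ^ (p - 1)) ^ q := Real.mul_rpow hC0 (by positivity)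
    _ ≤ C ^ q * (2 ^ q * (1 ^ q + (‖x‖ ^ (p - 1)) ^ q)) := by
        gcongr
        exact add_rpow_le hpq.symm.nonneg zero_le_one (by positivity)
    _ = _ := by rw [Real.one_rpow, ← Real.rpow_mul (norm_nonneg _), hpq.sub_one_mul_conj]

lemma optionalProj_apply [IsFiniteMeasure μ] {A : Fin N → PathSpace N d → Fin d → ℝ} {n : Fin N}
    (hA : ∀ i, Integrable (fun x => A n x i) μ) (i : Fin d) :
    (fun x => optionalProj μ A n x i) =ᵐ[μ] μ[fun x => A n x i | canonFiltration N d n.succ] :=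
  condExp_apply (Integrable.of_eval hA) i

lemma predictableProj_apply [IsFiniteMeasure μ] {A : Fin N → PathSpace N d → Fin d → ℝ} {n : Fin N}
    (hA : ∀ i, Integrable (fun x => A n x i) μ) (i : Fin d) :
    (fun x => predictableProj μ A n x i)
      =ᵐ[μ] μ[fun x => A n x i | canonFiltration N d n.castSucc] :=
  condExp_apply (Integrable.of_eval hA) i

lemma memLp_optionalProj (hq : 1 ≤ q) [IsFiniteMeasure μ] {A : Fin N → PathSpace N d → Fin d → ℝ}
    (hA : ∀ n i, MemLp (fun x => A n x i) (ENNReal.ofReal q) μ) (n : Fin N) (i : Fin d) :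
    MemLp (fun x => optionalProj μ A n x i) (ENNReal.ofReal q) μ :=
  ((hA n i).condExp (by simpa using hq)).ae_eq
    (optionalProj_apply (fun i => integrable_of_memLp hq (hA n i)) i).symm

lemma memLp_predictableProj (hq : 1 ≤ q) [IsFiniteMeasure μ]
    {A : Fin N → PathSpace N d → Fin d → ℝ}
    (hA : ∀ n i, MemLp (fun x => A n x i) (ENNReal.ofReal q) μ) (n : Fin N) (i : Fin d) :
    MemLp (fun x => predictableProj μ A n x i) (ENNReal.ofReal q) μ :=
  ((hA n i).condExp (by simpa using hq)).ae_eq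
    (predictableProj_apply (fun i => integrable_of_memLp hq (hA n i)) i).symm

lemma measurable_optionalProj (A : Fin N → PathSpace N d → Fin d → ℝ) (n : Fin N) (i : Fin d) :
    Measurable[canonFiltration N d n.succ] (fun x => optionalProj μ A n x i) :=
  (measurable_pi_apply i).comp stronglyMeasurable_condExp.measurable

lemma measurable_predictableProj (A : Fin N → PathSpace N d → Fin d → ℝ) (n : Fin N) :
    Measurable[canonFiltration N d n.castSucc] (predictableProj μ A n) :=
  stronglyMeasurable_condExp.measurable

lemma condExp_sub_optionalProj [IsFiniteMeasure μ] {A : Fin N → PathSpace N d → Fin d → ℝ}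
    {n : Fin N} (hA : ∀ i, Integrable (fun x => A n x i) μ) (i : Fin d) :
    μ[fun x => A n x i - optionalProj μ A n x i | canonFiltration N d n.succ] =ᵐ[μ] 0 := by
  have h1 := optionalProj_apply hA i
  have hint : Integrable (fun x => optionalProj μ A n x i) μ := integrable_condExp.congr h1.symm
  refine (condExp_sub (hA i) hint _).trans ?_
  have h2 := condExp_congr_ae (m := canonFiltration N d n.succ) h1
  have h3 : μ[μ[fun x => A n x i | canonFiltration N d n.succ] | canonFiltration N d n.succ]
      = μ[fun x => A n x i | canonFiltration N d n.succ] :=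
    condExp_of_stronglyMeasurable (canonFiltration_le _) stronglyMeasurable_condExp
      integrable_condExp
  rw [h3] at h2
  filter_upwards [h2] with x hx
  rw [Pi.sub_apply, hx, sub_self, Pi.zero_apply]

end projections

lemma integrable_objective {p : ℝ} (hp : 1 < p) {f : PathSpace N d → ℝ} (hf : ContDiff ℝ 1 f)
    {c : ℝ} (hc0 : 0 ≤ c) (hc : ∀ x, ‖fderiv ℝ f x‖ ≤ c * (1 + ‖x‖ ^ (p - 1)))
    {ν : Measure (PathSpace N d)} [IsFiniteMeasure ν] (hν : Integrable (fun x => ‖x‖ ^ p) ν) :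
    Integrable f ν := by
  obtain ⟨C, hC, hR⟩ := exists_taylor_remainder_le_rpow hp hf hc0 hc
  have hn : Integrable (fun x : PathSpace N d => ‖x‖) ν :=
    (integrable_of_memLp hp.le (memLp_id_of_integrable (by linarith) hν)).norm
  refine Integrable.mono' (g := fun x => |f 0| + ‖fderiv ℝ f 0‖ * ‖x‖
      + (C * (1 + ‖(0 : PathSpace N d)‖ ^ (p - 1)) * ‖x‖ + C * ‖x‖ ^ p))
    (((integrable_const _).add (hn.const_mul _)).add ((hn.const_mul _).add (hν.const_mul _)))
    hf.continuous.aestronglyMeasurable (ae_of_all _ fun x => ?_)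
  have h1 := hR 0 x
  rw [zero_add] at h1
  have h2 := (fderiv ℝ f 0).le_opNorm x
  rw [Real.norm_eq_abs] at h2 ⊢
  have h3 : f x = f 0 + fderiv ℝ f 0 x + (f x - f 0 - fderiv ℝ f 0 x) := by ring
  calc |f x| ≤ |f 0 + fderiv ℝ f 0 x| + |f x - f 0 - fderiv ℝ f 0 x| := by
        conv_lhs => rw [h3]
        exact abs_add_le _ _
    _ ≤ _ := add_le_add ((abs_add_le _ _).trans (by gcongr)) h1

lemma integrable_cost {p : ℝ} (hp : 1 < p) {π : Measure (PathSpace N d × PathSpace N d)}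
    (h1 : Integrable (fun x => ‖x‖ ^ p) π.fst) (h2 : Integrable (fun x => ‖x‖ ^ p) π.snd) :
    (∀ n i, MemLp (fun z : PathSpace N d × PathSpace N d => increment (z.2 - z.1) n i)
      (ENNReal.ofReal p) π) ∧ Integrable (fun z => cost p z.1 z.2) π := by
  have hp0 : 0 < p := by linarith
  have hfst : MeasurePreserving Prod.fst π π.fst := ⟨measurable_fst, rfl⟩
  have hsnd : MeasurePreserving Prod.snd π π.snd := ⟨measurable_snd, rfl⟩
  have hL : ∀ n i, MemLp (fun z : PathSpace N d × PathSpace N d => increment (z.2 - z.1) n i)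
      (ENNReal.ofReal p) π := by
    intro n i
    have := ((memLp_increment hp0 h2 n i).comp_measurePreserving hsnd).sub
      ((memLp_increment hp0 h1 n i).comp_measurePreserving hfst)
    refine this.congr_norm ?_ (ae_of_all _ fun z => ?_)
    · have h := (measurable_pi_apply i).comp ((measurable_increment (N := N) (d := d) n).comp
        (measurable_snd.sub (measurable_fst (α := PathSpace N d))))
      exact h.aestronglyMeasurable
    · simp only [increment_sub]
      rfl
  refine ⟨hL, ?_⟩
  simp only [cost_eq_sum hp0]
  exact integrable_finsetSum _ fun n _ => integrable_finsetSum _ fun i _ =>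
    integrable_abs_rpow hp0 (hL n i)

lemma sum_mul_le_pathNorm {p q : ℝ} (hpq : p.HolderConjugate q) (B : PathSpace N d)
    (x y : PathSpace N d) :
    ∑ n, ∑ i, B n i * increment (y - x) n i ≤ pathNorm q B * cost p x y ^ (1 / p) := by
  have h := Real.inner_le_Lp_mul_Lq (Finset.univ : Finset (Fin N × Fin d))
    (fun j => B j.1 j.2) (fun j => increment (y - x) j.1 j.2) hpq.symm
  simp only [← Finset.univ_product_univ, Finset.sum_product] at h
  rw [cost_eq_sum hpq.pos]
  refine h.trans (le_of_eq ?_)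
  rw [← pathNorm_rpow hpq.symm.pos, ← Real.rpow_mul (pathNorm_nonneg _ _),
    mul_one_div_cancel hpq.symm.ne_zero, Real.rpow_one]

/-- Hölder's inequality for processes. -/
lemma sum_integral_mul_increment_le {p q : ℝ} (hpq : p.HolderConjugate q)
    {π : Measure (PathSpace N d × PathSpace N d)}
    (h1 : Integrable (fun x => ‖x‖ ^ p) π.fst) (h2 : Integrable (fun x => ‖x‖ ^ p) π.snd)
    {B : Fin N → PathSpace N d → Fin d → ℝ} (hBm : ∀ n i, Measurable fun x => B n x i)
    (hB : ∀ n i, MemLp (fun x => B n x i) (ENNReal.ofReal q) π.fst) :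
    ∑ n, ∑ i, ∫ z, B n z.1 i * increment (z.2 - z.1) n i ∂π
      ≤ lqDist q π.fst B * (∫ z, cost p z.1 z.2 ∂π) ^ (1 / p) := by
  have hfst : MeasurePreserving Prod.fst π π.fst := ⟨measurable_fst, rfl⟩
  obtain ⟨hL, hcost⟩ := integrable_cost hpq.lt h1 h2
  have hint : ∀ n i, Integrable (fun z : PathSpace N d × PathSpace N d =>
      B n z.1 i * increment (z.2 - z.1) n i) π := fun n i =>
    integrable_mul_of_memLp hpq ((hB n i).comp_measurePreserving hfst) (hL n i)
  set H : PathSpace N d → ℝ := fun x => pathNorm q (fun n => B n x) with hH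
  have hHq : ∀ x, H x ^ q = ∑ n, ∑ i, |B n x i| ^ q := fun x => pathNorm_rpow hpq.symm.pos _
  have hBi : ∀ n i, Integrable (fun x => |B n x i| ^ q) π.fst := fun n i =>
    integrable_abs_rpow hpq.symm.pos (hB n i)
  have hHm : Measurable H := by
    have : H = fun x => (∑ n, ∑ i, |B n x i| ^ q) ^ (1 / q) := by
      funext x
      rw [← hHq, ← Real.rpow_mul (pathNorm_nonneg _ _), mul_one_div_cancel hpq.symm.ne_zero,
        Real.rpow_one]
    rw [this]
    exact (Finset.measurable_sum _ fun n _ => Finset.measurable_sum _ fun i _ =>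
      (hBm n i).norm.pow_const q).pow_const _
  have hHi : Integrable (fun x => H x ^ q) π.fst := by
    simp only [hHq]
    exact integrable_finsetSum _ fun n _ => integrable_finsetSum _ fun i _ => hBi n i
  have hHL : MemLp H (ENNReal.ofReal q) π.fst := by
    rw [memLp_ofReal_iff hpq.symm.pos hHm.aestronglyMeasurable]
    refine hHi.congr (ae_of_all _ fun x => ?_)
    simp only
    rw [Real.norm_of_nonneg (pathNorm_nonneg _ _)]
  have hHint : ∫ x, H x ^ q ∂π.fst = ∑ n, ∑ i, ∫ x, |B n x i| ^ q ∂π.fst := by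
    simp only [hHq]
    rw [integral_finsetSum _ fun n _ => integrable_finsetSum _ fun i _ => hBi n i]
    exact Finset.sum_congr rfl fun n _ => integral_finsetSum _ fun i _ => hBi n i
  have hcL := memLp_rpow_inv hpq.pos
    (u := fun z : PathSpace N d × PathSpace N d => cost p z.1 z.2)
    (fun z => cost_nonneg p z.1 z.2) hcost
  calc ∑ n, ∑ i, ∫ z, B n z.1 i * increment (z.2 - z.1) n i ∂π
      = ∫ z, ∑ n, ∑ i, B n z.1 i * increment (z.2 - z.1) n i ∂π := by
        rw [integral_finsetSum _ fun n _ => integrable_finsetSum _ fun i _ => hint n i]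
        exact Finset.sum_congr rfl fun n _ => (integral_finsetSum _ fun i _ => hint n i).symm
    _ ≤ ∫ z, H z.1 * cost p z.1 z.2 ^ (1 / p) ∂π := by
        refine integral_mono (integrable_finsetSum _ fun n _ => integrable_finsetSum _ fun i _ =>
          hint n i) (integrable_mul_of_memLp hpq (hHL.comp_measurePreserving hfst) hcL) fun z => ?_
        exact sum_mul_le_pathNorm hpq (fun n => B n z.1) z.1 z.2
    _ ≤ _ := by
        refine (integral_mul_cost_le hpq hcost (fun x => pathNorm_nonneg _ _) hHL).trans
          (le_of_eq ?_)
        rw [hHint, lqDist]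

end MartDRO

/-! ### Orthogonality under bicausal couplings and the upper bound -/

namespace MartDRO

variable {N d : ℕ}

section orthogonality

variable {p q : ℝ} {μ ν : Measure (PathSpace N d)}
  {π : Measure (PathSpace N d × PathSpace N d)}

lemma integral_mul_increment_eq_sub (hpq : p.HolderConjugate q)
    (hμ : Integrable (fun x => ‖x‖ ^ p) μ) (hν : Integrable (fun x => ‖x‖ ^ p) ν)
    (hfst : π.fst = μ) (hsnd : π.snd = ν) {D : PathSpace N d → ℝ}
    (hD : MemLp D (ENNReal.ofReal q) μ) (n : Fin N) (i : Fin d) :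
    Integrable (fun z : PathSpace N d × PathSpace N d => D z.1 * increment z.2 n i) π ∧
    ∫ z, D z.1 * increment (z.2 - z.1) n i ∂π
      = ∫ z, D z.1 * increment z.2 n i ∂π - ∫ x, D x * increment x n i ∂μ := by
  have h1 : MeasurePreserving Prod.fst π μ := ⟨measurable_fst, hfst⟩
  have h2 : MeasurePreserving Prod.snd π ν := ⟨measurable_snd, hsnd⟩
  have hx := memLp_increment hpq.pos hμ n i
  have hy := memLp_increment hpq.pos hν n i
  have hDπ := hD.comp_measurePreserving h1
  have i1 : Integrable (fun z : PathSpace N d × PathSpace N d => D z.1 * increment z.2 n i) π :=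
    integrable_mul_of_memLp hpq hDπ (hy.comp_measurePreserving h2)
  have i2 : Integrable (fun z : PathSpace N d × PathSpace N d => D z.1 * increment z.1 n i) π :=
    integrable_mul_of_memLp hpq hDπ (hx.comp_measurePreserving h1)
  refine ⟨i1, ?_⟩
  have h3 : ∫ x, D x * increment x n i ∂μ = ∫ z, D z.1 * increment z.1 n i ∂π := by
    rw [← hfst, Measure.fst, integral_map measurable_fst.aemeasurable]
    have h4 := (integrable_mul_of_memLp hpq hD hx).aestronglyMeasurable
    rw [← hfst] at h4
    exact h4
  rw [h3, ← integral_sub i1 i2]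
  refine integral_congr_ae (ae_of_all _ fun z => ?_)
  simp only [increment_sub, Pi.sub_apply]
  ring

/-- Both terms of the difference vanish: against Δxₙ because it is known at time n, against Δyₙ by
causality from μ to ν. This permits the passage to the optional projection. -/
lemma integral_mul_increment_eq_zero_of_condExp (hpq : p.HolderConjugate q)
    (hμ : μ ∈ martingaleMeasures N d p) (hν : ν ∈ martingaleMeasures N d p)
    (hπ : π ∈ bicausalCouplings μ ν) {D : PathSpace N d → ℝ}
    (hD : MemLp D (ENNReal.ofReal q) μ) {n : Fin N}
    (hD0 : μ[D | canonFiltration N d n.succ] =ᵐ[μ] 0) (i : Fin d) :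
    ∫ z, D z.1 * increment (z.2 - z.1) n i ∂π = 0 := by
  have hprobμ := hμ.1
  obtain ⟨hprob, hfst, hsnd, hc, -⟩ := hπ
  have hμi := integrable_norm_rpow_of_mem hpq.pos hμ
  have hνi := integrable_norm_rpow_of_mem hpq.pos hν
  obtain ⟨hint, h⟩ := integral_mul_increment_eq_sub hpq hμi hνi hfst hsnd hD n i
  have hDi : Integrable D μ := integrable_of_memLp hpq.symm.lt.le hD
  have hmeas : Measurable[canonFiltration N d n.succ]
      (fun x : PathSpace N d => increment x n i) :=
    (measurable_pi_apply i).comp (measurable_canonFiltration_increment n)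
  rw [h, integral_mul_eq_zero_of_condExp (canonFiltration_le n.succ) hDi hD0
    hmeas.stronglyMeasurable.aestronglyMeasurable
    (integrable_mul_of_memLp hpq hD (memLp_increment hpq.pos hμi n i)), sub_zero]
  exact hc.integral_mul_eq_zero (by rwa [hfst]) (by rwa [hfst]) hmeas hint

/-- Increments have zero conditional mean given the strict past. Against Δxₙ this suffices; against
Δyₙ it is combined with causality from ν to μ, applied to the swapped coupling. -/
lemma integral_mul_increment_eq_zero_of_measurable (hpq : p.HolderConjugate q)
    (hμ : μ ∈ martingaleMeasures N d p) (hν : ν ∈ martingaleMeasures N d p)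
    (hπ : π ∈ bicausalCouplings μ ν) {h : PathSpace N d → ℝ}
    (hh : MemLp h (ENNReal.ofReal q) μ) {n : Fin N}
    (hm : Measurable[canonFiltration N d n.castSucc] h) (i : Fin d) :
    ∫ z, h z.1 * increment (z.2 - z.1) n i ∂π = 0 := by
  have hprobμ := hμ.1
  have hprobν := hν.1
  obtain ⟨hprob, hfst, hsnd, -, hc⟩ := hπ
  have hμi := integrable_norm_rpow_of_mem hpq.pos hμ
  have hνi := integrable_norm_rpow_of_mem hpq.pos hν
  obtain ⟨hint, heq⟩ := integral_mul_increment_eq_sub hpq hμi hνi hfst hsnd hh n i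
  have hprob' : IsProbabilityMeasure (π.map Prod.swap) :=
    Measure.isProbabilityMeasure_map measurable_swap.aemeasurable
  have hfst' : (π.map Prod.swap).fst = ν := by
    rw [Measure.fst_map_swap, hsnd]
  have hx := memLp_increment hpq.pos hμi n i
  have hy := memLp_increment hpq.pos hνi n i
  have z1 : ∫ x, h x * increment x n i ∂μ = 0 := by
    simp only [mul_comm (h _)]
    refine integral_mul_eq_zero_of_condExp (canonFiltration_le n.castSucc)
      (integrable_of_memLp hpq.lt.le hx) (condExp_increment hμ n i)
      hm.stronglyMeasurable.aestronglyMeasurable ?_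
    simp only [mul_comm _ (h _)]
    exact integrable_mul_of_memLp hpq hh hx
  have z2 : ∫ z, h z.1 * increment z.2 n i ∂π = 0 := by
    have hint' : Integrable (fun z : PathSpace N d × PathSpace N d =>
        increment z.1 n i * h z.2) (π.map Prod.swap) := by
      rw [show (Prod.swap : PathSpace N d × PathSpace N d → _)
        = MeasurableEquiv.prodComm from rfl, MeasureTheory.integrable_map_equiv]
      exact hint.congr (ae_of_all _ fun z => mul_comm _ _)
    have := hc.integral_mul_eq_zero (D := fun y => increment y n i) (ψ := h)
      (by rw [hfst']; exact integrable_of_memLp hpq.lt.le hy)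
      (by rw [hfst']; exact condExp_increment hν n i) hm hint'
    rw [show (Prod.swap : PathSpace N d × PathSpace N d → _)
        = MeasurableEquiv.prodComm from rfl, MeasureTheory.integral_map_equiv] at this
    rw [← this]
    exact integral_congr_ae (ae_of_all _ fun z => mul_comm _ _)
  rw [heq, z1, z2, sub_zero]

end orthogonality

/-- The first order upper bound for the objective along bicausal couplings. -/
lemma exists_objective_sub_le {p q : ℝ} (hpq : p.HolderConjugate q) {f : PathSpace N d → ℝ}
    (hf : ContDiff ℝ 1 f)
    (hfgrowth : ∃ C : ℝ, ∀ x : PathSpace N d,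
      pathNorm p (fun n => malliavin f n x) ≤ C * (1 + pathNorm p x ^ (p - 1)))
    {μ : Measure (PathSpace N d)} (hμ : μ ∈ martingaleMeasures N d p)
    {h : Fin N → PathSpace N d → Fin d → ℝ} (hh : h ∈ predictableLq q μ)
    {ε : ℝ} (hε : 0 < ε) :
    ∃ C : ℝ, 0 ≤ C ∧ ∀ ν ∈ martingaleMeasures N d p, ∀ π ∈ bicausalCouplings μ ν,
      Integrable (fun z => cost p z.1 z.2) π ∧
      ∫ x, f x ∂ν - ∫ x, f x ∂μ
        ≤ (lqDist q μ (optionalProj μ (malliavin f) - h) + ε)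
            * (∫ z, cost p z.1 z.2 ∂π) ^ (1 / p) + C * ∫ z, cost p z.1 z.2 ∂π := by
  have hprobμ := hμ.1
  obtain ⟨c, hc0, hc⟩ := exists_norm_fderiv_le hpq.lt hfgrowth
  have hμi := integrable_norm_rpow_of_mem hpq.pos hμ
  obtain ⟨C, hC, hR⟩ := exists_integral_remainder_le hpq hf hc0 hc hμi hε
  refine ⟨C, hC, fun ν hν π hπ => ?_⟩
  have hprobν := hν.1
  have hνi := integrable_norm_rpow_of_mem hpq.pos hν
  have hπ' := hπ
  obtain ⟨hprob, hfst, hsnd, -, -⟩ := hπ'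
  have mp1 : MeasurePreserving Prod.fst π μ := ⟨measurable_fst, hfst⟩
  have mp2 : MeasurePreserving Prod.snd π ν := ⟨measurable_snd, hsnd⟩
  obtain ⟨hL, hcost⟩ := integrable_cost (π := π) hpq.lt (by rwa [hfst]) (by rwa [hsnd])
  refine ⟨hcost, ?_⟩
  have hD := memLp_malliavin hpq hf hfgrowth hμi
  have hDi : ∀ n i, Integrable (fun x => malliavin f n x i) μ := fun n i =>
    integrable_of_memLp hpq.symm.lt.le (hD n i)
  have hA := memLp_optionalProj (μ := μ) hpq.symm.lt.le hD
  have hhL := predictableLq.memLp hpq.symm.pos hh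
  have fμ := integrable_objective hpq.lt hf hc0 hc hμi
  have fν := integrable_objective hpq.lt hf hc0 hc hνi
  have fπ1 : Integrable (fun z : PathSpace N d × PathSpace N d => f z.1) π :=
    mp1.integrable_comp_of_integrable fμ
  have fπ2 : Integrable (fun z : PathSpace N d × PathSpace N d => f z.2) π :=
    mp2.integrable_comp_of_integrable fν
  have e1 : ∫ x, f x ∂μ = ∫ z, f z.1 ∂π := by
    rw [← hfst, Measure.fst, integral_map measurable_fst.aemeasurable
      hf.continuous.aestronglyMeasurable]
  have e2 : ∫ x, f x ∂ν = ∫ z, f z.2 ∂π := by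
    rw [← hsnd, Measure.snd, integral_map measurable_snd.aemeasurable
      hf.continuous.aestronglyMeasurable]
  have iD : ∀ n i, Integrable (fun z : PathSpace N d × PathSpace N d =>
      malliavin f n z.1 i * increment (z.2 - z.1) n i) π := fun n i =>
    integrable_mul_of_memLp hpq ((hD n i).comp_measurePreserving mp1) (hL n i)
  have iF : Integrable (fun z : PathSpace N d × PathSpace N d =>
      fderiv ℝ f z.1 (z.2 - z.1)) π := by
    simp only [fderiv_apply_eq_sum]
    exact integrable_finsetSum _ fun n _ => integrable_finsetSum _ fun i _ => iD n i
  have eF : ∫ z, fderiv ℝ f z.1 (z.2 - z.1) ∂π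
      = ∑ n, ∑ i, ∫ z, (optionalProj μ (malliavin f) - h) n z.1 i
          * increment (z.2 - z.1) n i ∂π := by
    simp only [fderiv_apply_eq_sum]
    rw [integral_finsetSum _ fun n _ => integrable_finsetSum _ fun i _ => iD n i]
    refine Finset.sum_congr rfl fun n _ => ?_
    rw [integral_finsetSum _ fun i _ => iD n i]
    refine Finset.sum_congr rfl fun i _ => ?_
    have z1 := integral_mul_increment_eq_zero_of_condExp hpq hμ hν hπ
      ((hD n i).sub (hA n i)) (condExp_sub_optionalProj (hDi n) i) i
    have z2 := integral_mul_increment_eq_zero_of_measurable hpq hμ hν hπ (hhL n i)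
      ((measurable_pi_apply i).comp (hh.1 n)) i
    have i1 : Integrable (fun z : PathSpace N d × PathSpace N d =>
        (malliavin f n z.1 i - optionalProj μ (malliavin f) n z.1 i)
          * increment (z.2 - z.1) n i) π := integrable_mul_of_memLp hpq
      (((hD n i).sub (hA n i)).comp_measurePreserving mp1) (hL n i)
    have i2 : Integrable (fun z : PathSpace N d × PathSpace N d =>
        h n z.1 i * increment (z.2 - z.1) n i) π :=
      integrable_mul_of_memLp hpq ((hhL n i).comp_measurePreserving mp1) (hL n i)
    have i3 : Integrable (fun z : PathSpace N d × PathSpace N d =>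
        (optionalProj μ (malliavin f) n z.1 i - h n z.1 i)
          * increment (z.2 - z.1) n i) π := integrable_mul_of_memLp hpq
      (((hA n i).sub (hhL n i)).comp_measurePreserving mp1) (hL n i)
    -- Split 𝔻f = (𝔻f - ᵒ𝔻f) + (ᵒ𝔻f - h) + h; the orthogonality relations kill the two outer terms.
    have hdecomp : ∀ z : PathSpace N d × PathSpace N d,
        malliavin f n z.1 i * increment (z.2 - z.1) n i
          = (malliavin f n z.1 i - optionalProj μ (malliavin f) n z.1 i)
              * increment (z.2 - z.1) n i
            + ((optionalProj μ (malliavin f) n z.1 i - h n z.1 i) * increment (z.2 - z.1) n i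
            + h n z.1 i * increment (z.2 - z.1) n i) := fun z => by ring
    simp only [Pi.sub_apply] at z1 ⊢
    have i23 : Integrable (fun z : PathSpace N d × PathSpace N d =>
        (optionalProj μ (malliavin f) n z.1 i - h n z.1 i) * increment (z.2 - z.1) n i
          + h n z.1 i * increment (z.2 - z.1) n i) π := i3.add i2
    rw [integral_congr_ae (ae_of_all _ hdecomp), integral_add i1 i23, integral_add i3 i2, z1, z2,
      zero_add, add_zero]
  have hB := sum_integral_mul_increment_le hpq (π := π) (by rwa [hfst]) (by rwa [hsnd])
    (B := optionalProj μ (malliavin f) - h)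
    (fun n i => ((measurable_optionalProj _ n i).mono (canonFiltration_le _) le_rfl).sub
      (((measurable_pi_apply i).comp (hh.1 n)).mono (canonFiltration_le _) le_rfl))
    (fun n i => by rw [hfst]; exact (hA n i).sub (hhL n i))
  rw [hfst, ← eF] at hB
  have hRπ := hR π hfst hcost
  have iR : Integrable (fun z : PathSpace N d × PathSpace N d =>
      f z.2 - f z.1 - fderiv ℝ f z.1 (z.2 - z.1)) π := (fπ2.sub fπ1).sub iF
  have hR1 : ∫ z, (f z.2 - f z.1 - fderiv ℝ f z.1 (z.2 - z.1)) ∂π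
      ≤ ∫ z, |f z.2 - f z.1 - fderiv ℝ f z.1 (z.2 - z.1)| ∂π :=
    integral_mono iR iR.abs fun z => le_abs_self _
  have hsplit : ∫ z, (f z.2 - f z.1 - fderiv ℝ f z.1 (z.2 - z.1)) ∂π
      = ∫ z, f z.2 ∂π - ∫ z, f z.1 ∂π - ∫ z, fderiv ℝ f z.1 (z.2 - z.1) ∂π := by
    have i21 : Integrable (fun z : PathSpace N d × PathSpace N d => f z.2 - f z.1) π :=
      fπ2.sub fπ1
    rw [integral_sub i21 iF, integral_sub fπ2 fπ1]
  rw [e1, e2]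
  linarith

end MartDRO

/-! ### Best predictable approximation in L^q -/

namespace MartDRO

variable {N d : ℕ}

/-- The odd power `sign(t) |t|^{q-1}`. -/
noncomputable def oddPow (q t : ℝ) : ℝ := (max t 0) ^ (q - 1) - (max (-t) 0) ^ (q - 1)

section oddPow

variable {p q : ℝ}

lemma oddPow_of_nonneg (hq : 1 < q) {t : ℝ} (ht : 0 ≤ t) : oddPow q t = t ^ (q - 1) := by
  rw [oddPow, max_eq_left ht, max_eq_right (by linarith), Real.zero_rpow (by linarith), sub_zero]

lemma oddPow_of_nonpos (hq : 1 < q) {t : ℝ} (ht : t ≤ 0) : oddPow q t = -(-t) ^ (q - 1) := by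
  rw [oddPow, max_eq_right ht, max_eq_left (by linarith), Real.zero_rpow (by linarith), zero_sub]

lemma oddPow_two (t : ℝ) : oddPow 2 t = t := by
  rcases le_total 0 t with h | h
  · rw [oddPow_of_nonneg one_lt_two h]; norm_num
  · rw [oddPow_of_nonpos one_lt_two h]; norm_num

lemma abs_oddPow (hq : 1 < q) (t : ℝ) : |oddPow q t| = |t| ^ (q - 1) := by
  rcases le_total 0 t with h | h
  · rw [oddPow_of_nonneg hq h, abs_of_nonneg h, abs_of_nonneg (by positivity)]
  · rw [oddPow_of_nonpos hq h, abs_of_nonpos h, abs_neg,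
      abs_of_nonneg (Real.rpow_nonneg (by linarith) _)]

lemma oddPow_mul_self (hq : 1 < q) (t : ℝ) : oddPow q t * t = |t| ^ q := by
  rcases le_total 0 t with h | h
  · rw [oddPow_of_nonneg hq h, abs_of_nonneg h, ← Real.rpow_add_one' h (by linarith)]
    congr 1; ring
  · rw [oddPow_of_nonpos hq h, abs_of_nonpos h, neg_mul, ← mul_neg,
      ← Real.rpow_add_one' (by linarith) (by linarith)]
    congr 1; ring

lemma continuous_oddPow (hq : 1 < q) : Continuous (oddPow q) :=
  ((continuous_id.max continuous_const).rpow_const fun _ => Or.inr (by linarith)).sub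
    ((continuous_neg.max continuous_const).rpow_const fun _ => Or.inr (by linarith))

lemma strictMono_oddPow (hq : 1 < q) : StrictMono (oddPow q) := by
  have hq' : 0 < q - 1 := by linarith
  intro s t hst
  have h1 : (max s 0) ^ (q - 1) ≤ (max t 0) ^ (q - 1) :=
    Real.rpow_le_rpow (le_max_right _ _) (max_le_max_right 0 hst.le) hq'.le
  have h2 : (max (-t) 0) ^ (q - 1) ≤ (max (-s) 0) ^ (q - 1) :=
    Real.rpow_le_rpow (le_max_right _ _) (max_le_max_right 0 (by linarith)) hq'.le
  rcases le_or_gt t 0 with ht | ht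
  · have : (max (-t) 0) ^ (q - 1) < (max (-s) 0) ^ (q - 1) := by
      rw [max_eq_left (by linarith), max_eq_left (by linarith)]
      exact Real.rpow_lt_rpow (by linarith) (by linarith) hq'
    unfold oddPow; linarith
  · have : (max s 0) ^ (q - 1) < (max t 0) ^ (q - 1) :=
      Real.rpow_lt_rpow (le_max_right _ _) (by
        rw [max_eq_left ht.le]
        exact max_lt hst ht) hq'
    unfold oddPow; linarith

lemma abs_oddPow_rpow (hpq : p.HolderConjugate q) (t : ℝ) : |oddPow q t| ^ p = |t| ^ q := by
  rw [abs_oddPow hpq.symm.lt, ← Real.rpow_mul (abs_nonneg _), hpq.symm.sub_one_mul_conj]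

/-- Young's inequality for `oddPow q s * t`, which is an equality at t = s. This is the convexity of
|·|^q in a form that avoids differentiation. -/
lemma abs_rpow_ge_tangent (hpq : p.HolderConjugate q) (s t : ℝ) :
    |s| ^ q + q * oddPow q s * (t - s) ≤ |t| ^ q := by
  have h1 := Real.young_inequality (oddPow q s) t hpq
  rw [abs_oddPow_rpow hpq] at h1
  have h2 := oddPow_mul_self hpq.symm.lt s
  have hq := hpq.symm.pos
  have h3 : |s| ^ q / p = |s| ^ q * (1 - 1 / q) := by
    have := hpq.inv_add_inv_eq_one
    rw [div_eq_mul_inv, one_div]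
    congr 1
    linarith
  rw [h3] at h1
  have h4 : q * (oddPow q s * t) ≤ q * (|s| ^ q * (1 - 1 / q) + |t| ^ q / q) :=
    mul_le_mul_of_nonneg_left h1 hq.le
  have h5 : q * (|s| ^ q * (1 - 1 / q) + |t| ^ q / q) = q * |s| ^ q - |s| ^ q + |t| ^ q := by
    field_simp
  have h6 : q * oddPow q s * (t - s) = q * (oddPow q s * t) - q * (oddPow q s * s) := by ring
  rw [h6, h2]
  linarith

lemma abs_oddPow_le (hq : 1 < q) (t : ℝ) : |oddPow q t| ≤ 1 + |t| ^ q := by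
  rw [abs_oddPow hq]
  rcases le_total |t| 1 with h | h
  · have := Real.rpow_le_one (abs_nonneg t) h (by linarith : 0 ≤ q - 1)
    have := Real.rpow_nonneg (abs_nonneg t) q
    linarith
  · have := Real.rpow_le_rpow_of_exponent_le h (by linarith : q - 1 ≤ q)
    linarith

lemma abs_sub_rpow_le (hq : 0 ≤ q) (s t : ℝ) : |s - t| ^ q ≤ 2 ^ q * (|s| ^ q + |t| ^ q) :=
  (Real.rpow_le_rpow (abs_nonneg _) (abs_sub _ _) hq).trans
    (add_rpow_le hq (abs_nonneg _) (abs_nonneg _))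

lemma memLp_oddPow (hpq : p.HolderConjugate q) {Ω : Type*} {m : MeasurableSpace Ω} {μ : Measure Ω}
    {u : Ω → ℝ} (hu : MemLp u (ENNReal.ofReal q) μ) :
    MemLp (fun x => oddPow q (u x)) (ENNReal.ofReal p) μ := by
  rw [memLp_ofReal_iff hpq.pos
    ((continuous_oddPow hpq.symm.lt).comp_aestronglyMeasurable hu.aestronglyMeasurable)]
  simp only [Real.norm_eq_abs, abs_oddPow_rpow hpq]
  exact integrable_abs_rpow hpq.symm.pos hu

end oddPow

section center

variable {p q : ℝ} {ν : Measure ℝ} [IsProbabilityMeasure ν]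

lemma integrable_abs_sub_rpow (hq : 0 ≤ q) (hν : Integrable (fun t => |t| ^ q) ν) (c : ℝ) :
    Integrable (fun t => |t - c| ^ q) ν := by
  refine Integrable.mono' (g := fun t => 2 ^ q * (|t| ^ q + |c| ^ q))
    ((hν.add (integrable_const _)).const_mul _)
    (((measurable_id.sub_const c).norm.pow_const q).aestronglyMeasurable)
    (ae_of_all _ fun t => ?_)
  rw [Real.norm_of_nonneg (by positivity)]
  exact abs_sub_rpow_le hq t c

lemma integrable_oddPow_sub (hq : 1 < q) (hν : Integrable (fun t => |t| ^ q) ν) (c : ℝ) :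
    Integrable (fun t => oddPow q (t - c)) ν :=
  Integrable.mono' ((integrable_const (1 : ℝ)).add (integrable_abs_sub_rpow (by linarith) hν c))
    ((continuous_oddPow hq).comp (continuous_id.sub continuous_const)).aestronglyMeasurable
    (ae_of_all _ fun t => abs_oddPow_le hq (t - c))

lemma continuous_integral_oddPow_sub (hq : 1 < q) (hν : Integrable (fun t => |t| ^ q) ν) :
    Continuous fun c => ∫ t, oddPow q (t - c) ∂ν := by
  rw [continuous_iff_continuousAt]
  intro c₀
  refine continuousAt_of_dominated (bound := fun t => 1 + 2 ^ q * (|t| ^ q + (|c₀| + 1) ^ q))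
    ?_ ?_ ?_ ?_
  · exact Eventually.of_forall fun c => (integrable_oddPow_sub hq hν c).aestronglyMeasurable
  · filter_upwards [Metric.ball_mem_nhds c₀ one_pos] with c hc
    refine ae_of_all _ fun t => (abs_oddPow_le hq _).trans ?_
    have hc' : |c| ≤ |c₀| + 1 := by
      rw [Metric.mem_ball, Real.dist_eq] at hc
      have := abs_sub_abs_le_abs_sub c c₀
      linarith
    have h1 : |c| ^ q ≤ (|c₀| + 1) ^ q := Real.rpow_le_rpow (abs_nonneg _) hc' (by linarith)
    have h2 := abs_sub_rpow_le (by linarith : 0 ≤ q) t c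
    have h3 : 2 ^ q * (|t| ^ q + |c| ^ q) ≤ 2 ^ q * (|t| ^ q + (|c₀| + 1) ^ q) := by gcongr
    linarith
  · exact (integrable_const _).add ((hν.add (integrable_const _)).const_mul _)
  · exact ae_of_all _ fun t =>
      ((continuous_oddPow hq).comp (continuous_const.sub continuous_id)).continuousAt

/-- Strictness makes the barycentre unique and lets its position relative to any r be read off from
the sign of one integral. -/
lemma strictAnti_integral_oddPow_sub (hq : 1 < q) (hν : Integrable (fun t => |t| ^ q) ν) :
    StrictAnti fun c => ∫ t, oddPow q (t - c) ∂ν := by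
  intro a b hab
  simp only
  have hlt : ∀ t, oddPow q (t - b) < oddPow q (t - a) := fun t =>
    strictMono_oddPow hq (by linarith)
  have ia := integrable_oddPow_sub hq hν a
  have ib := integrable_oddPow_sub hq hν b
  rw [← sub_pos, ← integral_sub ia ib, integral_pos_iff_support_of_nonneg
    (fun t => (sub_pos.2 (hlt t)).le) (ia.sub ib)]
  have : Function.support (fun t => oddPow q (t - a) - oddPow q (t - b)) = Set.univ :=
    Set.eq_univ_of_forall fun t => (sub_pos.2 (hlt t)).ne'
  rw [this, measure_univ]
  exact one_pos

/-- Integrate the tangent inequality from t - c to t: the hypothesis makes the linear term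
nonnegative, so ∫|t - c|^q ≤ ∫|t|^q, and c is bounded through c = t - (t - c). It serves twice, to
bracket the zero and to bound conditional barycentres in L^q. -/
lemma abs_rpow_le_of_mul_integral_nonneg (hpq : p.HolderConjugate q)
    (hν : Integrable (fun t => |t| ^ q) ν) {c : ℝ} (hc : 0 ≤ c * ∫ t, oddPow q (t - c) ∂ν) :
    |c| ^ q ≤ 2 ^ q * (2 * ∫ t, |t| ^ q ∂ν) := by
  have hq := hpq.symm.lt
  have i1 := integrable_abs_sub_rpow hpq.symm.nonneg hν c
  have i2 := integrable_oddPow_sub hq hν c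
  have h1 : ∫ t, |t - c| ^ q ∂ν + q * (c * ∫ t, oddPow q (t - c) ∂ν) ≤ ∫ t, |t| ^ q ∂ν := by
    rw [← integral_const_mul, ← integral_const_mul,
      ← integral_add i1 ((i2.const_mul c).const_mul q)]
    refine integral_mono (i1.add ((i2.const_mul c).const_mul q)) hν fun t => ?_
    have := abs_rpow_ge_tangent hpq (t - c) t
    simp only
    calc _ = |t - c| ^ q + q * oddPow q (t - c) * (t - (t - c)) := by ring
      _ ≤ _ := this
  have h2 : 0 ≤ q * (c * ∫ t, oddPow q (t - c) ∂ν) := mul_nonneg hpq.symm.nonneg hc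
  have h3 : |c| ^ q ≤ ∫ t, 2 ^ q * (|t| ^ q + |t - c| ^ q) ∂ν := by
    have : |c| ^ q = ∫ _t, |c| ^ q ∂ν := by simp
    rw [this]
    refine integral_mono (integrable_const _) ((hν.add i1).const_mul _) fun t => ?_
    have := abs_sub_rpow_le hpq.symm.nonneg t (t - c)
    simpa using this
  rw [integral_const_mul, integral_add hν i1] at h3
  refine h3.trans ?_
  gcongr
  linarith

lemma exists_integral_oddPow_sub_eq_zero (hpq : p.HolderConjugate q)
    (hν : Integrable (fun t => |t| ^ q) ν) : ∃ c, ∫ t, oddPow q (t - c) ∂ν = 0 := by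
  have hq := hpq.symm.pos
  have hm : 0 ≤ ∫ t, |t| ^ q ∂ν := integral_nonneg fun t => by positivity
  -- b^q exceeds the bound of `abs_rpow_le_of_mul_integral_nonneg` by one, so at c = ±b the integral
  -- has the sign opposite to c.
  set b := (2 ^ q * (2 * ∫ t, |t| ^ q ∂ν) + 1) ^ (1 / q) with hb
  have hb0 : 0 < b := by positivity
  have hbq : b ^ q = 2 ^ q * (2 * ∫ t, |t| ^ q ∂ν) + 1 := by
    rw [hb, ← Real.rpow_mul (by positivity), one_div_mul_cancel hq.ne', Real.rpow_one]
  have key : ∀ c, |c| = b → c * ∫ t, oddPow q (t - c) ∂ν < 0 := by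
    intro c hc
    by_contra h
    have := abs_rpow_le_of_mul_integral_nonneg hpq hν (not_lt.1 h)
    rw [hc, hbq] at this
    linarith
  have h1 : ∫ t, oddPow q (t - b) ∂ν ≤ 0 := by
    have := key b (abs_of_pos hb0)
    by_contra h
    push Not at h
    nlinarith
  have h2 : 0 ≤ ∫ t, oddPow q (t - -b) ∂ν := by
    have := key (-b) (by rw [abs_neg, abs_of_pos hb0])
    by_contra h
    push Not at h
    nlinarith
  obtain ⟨c, -, hc⟩ := intermediate_value_Icc' (by linarith : -b ≤ b)
    (continuous_integral_oddPow_sub hpq.symm.lt hν).continuousOn ⟨h1, h2⟩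
  exact ⟨c, hc⟩

end center

open Classical in
/-- The `L^q`-barycentre of a measure on the real line. -/
noncomputable def lqCenter (q : ℝ) (ν : Measure ℝ) : ℝ :=
  if h : Integrable (fun t => |t| ^ q) ν ∧ ∃ c, ∫ t, oddPow q (t - c) ∂ν = 0
    then h.2.choose else 0

lemma integral_oddPow_sub_lqCenter {p q : ℝ} (hpq : p.HolderConjugate q) {ν : Measure ℝ}
    [IsProbabilityMeasure ν] (hν : Integrable (fun t => |t| ^ q) ν) :
    ∫ t, oddPow q (t - lqCenter q ν) ∂ν = 0 := by
  have h : Integrable (fun t => |t| ^ q) ν ∧ ∃ c, ∫ t, oddPow q (t - c) ∂ν = 0 :=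
    ⟨hν, exists_integral_oddPow_sub_eq_zero hpq hν⟩
  rw [lqCenter, dif_pos h]
  exact h.2.choose_spec

/-- By strict monotonicity the barycentre is at most r exactly when the integral centred at r is
nonpositive, and that integral is measurable in the parameter. Parameters without q-th moment carry
the default value 0 and form the second piece. -/
lemma measurable_lqCenter {p q : ℝ} (hpq : p.HolderConjugate q) {β : Type*} [MeasurableSpace β]
    (κ : Kernel β ℝ) [IsMarkovKernel κ] : Measurable fun b => lqCenter q (κ b) := by
  have hmq : Measurable fun t : ℝ => |t| ^ q := measurable_norm.pow_const q
  have hgood : MeasurableSet {b | Integrable (fun t => |t| ^ q) (κ b)} := by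
    have : {b | Integrable (fun t => |t| ^ q) (κ b)}
        = {b | ∫⁻ t, ENNReal.ofReal (|t| ^ q) ∂κ b < ⊤} := by
      ext b
      change Integrable _ _ ↔ _ < (⊤ : ℝ≥0∞)
      rw [← hasFiniteIntegral_iff_ofReal (ae_of_all _ fun t => by positivity)]
      exact ⟨fun h => h.2, fun h => ⟨hmq.aestronglyMeasurable, h⟩⟩
    rw [this]
    exact measurableSet_lt hmq.ennreal_ofReal.lintegral_kernel
      (measurable_const (a := (⊤ : ℝ≥0∞)))
  refine measurable_of_Iic fun r => ?_
  have hψ : Measurable fun b => ∫ t, oddPow q (t - r) ∂κ b :=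
    (StronglyMeasurable.integral_kernel ((continuous_oddPow hpq.symm.lt).comp
      (continuous_id.sub continuous_const)).stronglyMeasurable).measurable
  have hset : (fun b => lqCenter q (κ b)) ⁻¹' Set.Iic r
      = ({b | Integrable (fun t => |t| ^ q) (κ b)} ∩ {b | ∫ t, oddPow q (t - r) ∂κ b ≤ 0})
        ∪ ({b | Integrable (fun t => |t| ^ q) (κ b)}ᶜ ∩ {_b | 0 ≤ r}) := by
    ext b
    by_cases hb : Integrable (fun t => |t| ^ q) (κ b)
    · have h0 := integral_oddPow_sub_lqCenter hpq hb
      have := (strictAnti_integral_oddPow_sub hpq.symm.lt hb).le_iff_ge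
        (a := r) (b := lqCenter q (κ b))
      simp only [h0] at this
      simp [hb, this]
    · have : lqCenter q (κ b) = 0 := dif_neg fun h => hb h.1
      simp [hb, this]
  rw [hset]
  exact (hgood.inter (measurableSet_le hψ measurable_const)).union
    (hgood.compl.inter (MeasurableSet.const _))

/-- Take the barycentre of the regular conditional distribution of `Y` given `X`. Working fibre by
fibre yields a function of `X` and the first-order condition at once, without a compactness argument
in L^q. -/
lemma exists_conditional_center {p q : ℝ} (hpq : p.HolderConjugate q) {Ω β : Type*}
    [MeasurableSpace Ω] [mβ : MeasurableSpace β] {μ : Measure Ω} [IsProbabilityMeasure μ]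
    {X : Ω → β} (hX : Measurable X) {Y : Ω → ℝ} (hY : MemLp Y (ENNReal.ofReal q) μ) :
    ∃ h : β → ℝ, Measurable h ∧ MemLp (fun x => h (X x)) (ENNReal.ofReal q) μ ∧
      μ[fun x => oddPow q (Y x - h (X x)) | mβ.comap X] =ᵐ[μ] 0 := by
  have hq := hpq.symm.lt
  set κ := condDistrib Y X μ with hκ
  have hYm : AEMeasurable Y μ := hY.aestronglyMeasurable.aemeasurable
  have hYq := integrable_abs_rpow hpq.symm.pos hY
  have hsm : StronglyMeasurable fun t : ℝ => |t| ^ q :=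
    (measurable_norm.pow_const q).stronglyMeasurable
  have hgood : ∀ᵐ x ∂μ, Integrable (fun t => |t| ^ q) (κ (X x)) := by
    have h1 : Integrable (fun z : β × ℝ => |z.2| ^ q) (μ.map fun x => (X x, Y x)) :=
      (integrable_map_measure (hsm.comp_measurable measurable_snd).aestronglyMeasurable
        (hX.aemeasurable.prodMk hYm)).2 hYq
    exact h1.condDistrib_ae hX.aemeasurable hYm
  have hm := measurable_lqCenter hpq κ
  have hhm : AEStronglyMeasurable (fun x => lqCenter q (κ (X x))) μ :=
    (hm.comp hX).aestronglyMeasurable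
  have hL : MemLp (fun x => lqCenter q (κ (X x))) (ENNReal.ofReal q) μ := by
    rw [memLp_ofReal_iff hpq.symm.pos hhm]
    have h1 : Integrable (fun x => ∫ t, |t| ^ q ∂κ (X x)) μ :=
      integrable_condExp.congr (condExp_ae_eq_integral_condDistrib hX hYm hsm hYq)
    refine Integrable.mono' ((h1.const_mul 2).const_mul (2 ^ q))
      ((hm.comp hX).norm.pow_const q).aestronglyMeasurable ?_
    filter_upwards [hgood] with x hx
    rw [Real.norm_of_nonneg (by positivity)]
    refine abs_rpow_le_of_mul_integral_nonneg hpq hx ?_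
    rw [integral_oddPow_sub_lqCenter hpq hx, mul_zero]
  refine ⟨fun b => lqCenter q (κ b), hm, hL, ?_⟩
  have hint : Integrable (fun x => oddPow q (Y x - lqCenter q (κ (X x)))) μ :=
    integrable_of_memLp hpq.lt.le (memLp_oddPow hpq (hY.sub hL))
  have hfm : StronglyMeasurable fun z : β × ℝ => oddPow q (z.2 - lqCenter q (κ z.1)) :=
    ((continuous_oddPow hq).measurable.comp
      (measurable_snd.sub (hm.comp measurable_fst))).stronglyMeasurable
  refine (condExp_prod_ae_eq_integral_condDistrib hX hYm hfm hint).trans ?_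
  filter_upwards [hgood] with x hx
  exact integral_oddPow_sub_lqCenter hpq hx

/-- The first order condition characterizing the best approximation of `A` by predictable
processes in `L^q`. -/
def IsBestPredictable (q : ℝ) (μ : Measure (PathSpace N d))
    (A h : Fin N → PathSpace N d → Fin d → ℝ) : Prop :=
  h ∈ predictableLq q μ ∧ ∀ n i,
    μ[fun x => oddPow q (A n x i - h n x i) | canonFiltration N d n.castSucc] =ᵐ[μ] 0

section bestPredictable

variable {p q : ℝ} {μ : Measure (PathSpace N d)} {A h : Fin N → PathSpace N d → Fin d → ℝ}

lemma mem_predictableLq (hq : 0 < q)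
    (hm : ∀ n : Fin N, Measurable[canonFiltration N d n.castSucc] (h n))
    (hL : ∀ n i, MemLp (fun x => h n x i) (ENNReal.ofReal q) μ) : h ∈ predictableLq q μ :=
  ⟨hm, by rw [LqNorm_eq hq hL]; exact ENNReal.ofReal_lt_top⟩

/-- The q-th power of the norm is a sum over times and coordinates, so each scalar coordinate is
treated separately, conditionally on the path frozen at the preceding time. -/
lemma exists_isBestPredictable (hpq : p.HolderConjugate q) [IsProbabilityMeasure μ]
    (hA : ∀ n i, MemLp (fun x => A n x i) (ENNReal.ofReal q) μ) :
    ∃ h, IsBestPredictable q μ A h := by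
  choose g hgm hgL hg0 using fun (n : Fin N) (i : Fin d) =>
    exists_conditional_center hpq (measurable_freeze n.castSucc) (hA n i)
  refine ⟨fun n x i => g n i (freeze n.castSucc x),
    mem_predictableLq hpq.symm.pos (fun n => ?_) hgL, fun n i => ?_⟩
  · exact @measurable_pi_lambda _ _ _ (_) _ _ fun i =>
      (hgm n i).comp (measurable_canonFiltration_freeze n.castSucc)
  · have := hg0 n i
    rw [← canonFiltration_eq_comap] at this
    exact this

lemma IsBestPredictable.integral_mul_eq_zero (hpq : p.HolderConjugate q) [IsProbabilityMeasure μ]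
    (hA : ∀ n i, MemLp (fun x => A n x i) (ENNReal.ofReal q) μ) (hh : IsBestPredictable q μ A h)
    {n : Fin N} {k : PathSpace N d → ℝ} (hk : MemLp k (ENNReal.ofReal q) μ)
    (hkm : Measurable[canonFiltration N d n.castSucc] k) (i : Fin d) :
    ∫ x, oddPow q (A n x i - h n x i) * k x ∂μ = 0 := by
  have h1 := memLp_oddPow hpq ((hA n i).sub (predictableLq.memLp hpq.symm.pos hh.1 n i))
  exact integral_mul_eq_zero_of_condExp (canonFiltration_le n.castSucc)
    (integrable_of_memLp hpq.lt.le h1) (hh.2 n i) hkm.stronglyMeasurable.aestronglyMeasurable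
    (integrable_mul_of_memLp hpq.symm h1 hk)

/-- Integrate the tangent inequality from A - h to A - k. Its linear term pairs the odd power of A -
h with the predictable process h - k and vanishes by the first-order condition. -/
lemma IsBestPredictable.lqDist_le (hpq : p.HolderConjugate q) [IsProbabilityMeasure μ]
    (hA : ∀ n i, MemLp (fun x => A n x i) (ENNReal.ofReal q) μ) (hh : IsBestPredictable q μ A h)
    {k : Fin N → PathSpace N d → Fin d → ℝ} (hk : k ∈ predictableLq q μ) :
    lqDist q μ (A - h) ≤ lqDist q μ (A - k) := by
  have hq := hpq.symm.pos
  refine Real.rpow_le_rpow (Finset.sum_nonneg fun _ _ => Finset.sum_nonneg fun _ _ =>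
    integral_nonneg fun _ => Real.rpow_nonneg (abs_nonneg _) _)
    (Finset.sum_le_sum fun n _ => Finset.sum_le_sum fun i _ => ?_) (by positivity)
  simp only [Pi.sub_apply]
  have hhL := predictableLq.memLp hq hh.1 n i
  have hkL := predictableLq.memLp hq hk n i
  have hAh := (hA n i).sub hhL
  have i1 : Integrable (fun x => |A n x i - h n x i| ^ q) μ := integrable_abs_rpow hq hAh
  have i2 := integrable_abs_rpow hq ((hA n i).sub hkL)
  have hm : Measurable[canonFiltration N d n.castSucc] fun x => h n x i - k n x i :=
    ((measurable_pi_apply i).comp (hh.1.1 n)).sub ((measurable_pi_apply i).comp (hk.1 n))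
  have hz := hh.integral_mul_eq_zero hpq hA (hhL.sub hkL) hm i
  have i3 : Integrable (fun x => oddPow q (A n x i - h n x i) * (h n x i - k n x i)) μ :=
    integrable_mul_of_memLp hpq.symm (memLp_oddPow hpq hAh) (hhL.sub hkL)
  calc ∫ x, |A n x i - h n x i| ^ q ∂μ
      = ∫ x, (|A n x i - h n x i| ^ q
          + q * (oddPow q (A n x i - h n x i) * (h n x i - k n x i))) ∂μ := by
        rw [integral_add i1 (i3.const_mul q), integral_const_mul]
        simp only [Pi.sub_apply] at hz
        rw [hz, mul_zero, add_zero]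
    _ ≤ ∫ x, |A n x i - k n x i| ^ q ∂μ := by
        refine integral_mono (i1.add (i3.const_mul q)) i2 fun x => ?_
        have := abs_rpow_ge_tangent hpq (A n x i - h n x i) (A n x i - k n x i)
        calc _ = |A n x i - h n x i| ^ q + q * oddPow q (A n x i - h n x i)
              * (A n x i - k n x i - (A n x i - h n x i)) := by ring
          _ ≤ _ := this

lemma IsBestPredictable.iInf_eq (hpq : p.HolderConjugate q) [IsProbabilityMeasure μ]
    (hA : ∀ n i, MemLp (fun x => A n x i) (ENNReal.ofReal q) μ) (hh : IsBestPredictable q μ A h) :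
    ⨅ k ∈ predictableLq q μ, LqNorm q μ (A - k) = ENNReal.ofReal (lqDist q μ (A - h)) := by
  have hnorm : ∀ k ∈ predictableLq q μ,
      LqNorm q μ (A - k) = ENNReal.ofReal (lqDist q μ (A - k)) := fun k hk =>
    LqNorm_eq hpq.symm.pos fun n i => (hA n i).sub (predictableLq.memLp hpq.symm.pos hk n i)
  refine le_antisymm ((iInf₂_le h hh.1).trans (hnorm h hh.1).le) (le_iInf₂ fun k hk => ?_)
  rw [hnorm k hk]
  exact ENNReal.ofReal_le_ofReal (hh.lqDist_le hpq hA hk)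

/-- For `q = 2` the best predictable approximation is the predictable projection. -/
lemma isBestPredictable_predictableProj [IsProbabilityMeasure μ]
    (hA : ∀ n i, MemLp (fun x => A n x i) (ENNReal.ofReal 2) μ) :
    IsBestPredictable 2 μ (optionalProj μ A) (predictableProj μ A) := by
  have hAi : ∀ n i, Integrable (fun x => A n x i) μ := fun n i =>
    integrable_of_memLp one_le_two (hA n i)
  refine ⟨mem_predictableLq two_pos (measurable_predictableProj A)
    (memLp_predictableProj one_le_two hA), fun n i => ?_⟩
  simp only [oddPow_two]
  have h1 := optionalProj_apply (hAi n) i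
  have h2 := predictableProj_apply (hAi n) i
  have i1 := integrable_of_memLp one_le_two (memLp_optionalProj one_le_two hA n i)
  have i2 := integrable_of_memLp one_le_two (memLp_predictableProj one_le_two hA n i)
  have h3 := condExp_congr_ae (m := canonFiltration N d n.castSucc) h1
  -- Tower property: `A` and its optional projection have the same predictable projection.
  have h4 := condExp_condExp_of_le (f := fun x => A n x i) (μ := μ)
    ((canonFiltration N d).mono n.castSucc_lt_succ.le) (canonFiltration_le n.succ)
  have h5 : μ[fun x => predictableProj μ A n x i | canonFiltration N d n.castSucc]
      = fun x => predictableProj μ A n x i :=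
    condExp_of_stronglyMeasurable (canonFiltration_le _)
      ((measurable_pi_apply i).comp (measurable_predictableProj A n)).stronglyMeasurable i2
  refine (condExp_sub i1 i2 _).trans ?_
  rw [h5]
  filter_upwards [h2, h3, h4] with x hx2 hx3 hx4
  rw [Pi.sub_apply, hx3, hx4, hx2, sub_self, Pi.zero_apply]

end bestPredictable

end MartDRO

/-! ### Perturbing the increments: invertibility and the martingale property -/

namespace MartDRO

variable {N d : ℕ}

/-- The path whose increments are those of `x`, shifted by `t W`. -/
def perturb (t : ℝ) (W : Fin N → PathSpace N d → Fin d → ℝ) (x : PathSpace N d) : PathSpace N d :=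
  fun k => x k + ∑ j : Fin N, if j ≤ k then t • W j x else 0

section perturb

variable {t : ℝ} {W : Fin N → PathSpace N d → Fin d → ℝ}

lemma pathAt_perturb (n : Fin (N + 1)) (x : PathSpace N d) :
    pathAt n (perturb t W x)
      = pathAt n x + ∑ j : Fin N, if j.castSucc < n then t • W j x else 0 := by
  induction n using Fin.cases with
  | zero => simp
  | succ k =>
    simp only [pathAt_succ, perturb, Fin.castSucc_lt_succ_iff]

lemma increment_perturb_sub (n : Fin N) (x : PathSpace N d) :
    increment (perturb t W x - x) n = t • W n x := by
  have h : ∀ j : Fin N, (if j.castSucc < n.succ then t • W j x else 0)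
      = (if j.castSucc < n.castSucc then t • W j x else 0) + if j = n then t • W j x else 0 := by
    intro j
    rcases lt_trichotomy j n with h | h | h
    · have h1 : j.castSucc < n.castSucc := h
      simp [h1, h.ne, h1.trans n.castSucc_lt_succ]
    · subst h; simp
    · have h1 : ¬ j.castSucc < n.castSucc := not_lt.2 (le_of_lt h)
      have h2 : ¬ j.castSucc < n.succ := by
        rw [Fin.lt_def] at h ⊢; simp; omega
      simp [h1, h2, h.ne']
  rw [increment_sub, increment, increment, pathAt_perturb, pathAt_perturb]
  simp only [h, Finset.sum_add_distrib]
  simp only [Finset.sum_ite_eq', Finset.mem_univ, if_true]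
  abel

lemma measurable_perturb (hW : ∀ n, Measurable (W n)) : Measurable (perturb t W) := by
  refine measurable_pi_lambda _ fun k => (measurable_pi_apply k).add
    (Finset.measurable_sum _ fun j _ => ?_)
  split_ifs
  · exact (hW j).const_smul t
  · exact measurable_const

lemma freeze_perturb_freeze (hW : ∀ n : Fin N, Measurable[canonFiltration N d n.succ] (W n))
    (n : Fin (N + 1)) (x : PathSpace N d) :
    freeze n (perturb t W (freeze n x)) = freeze n (perturb t W x) := by
  refine freeze_eq_freeze_iff.2 fun k hk => ?_
  simp only [perturb, freeze_apply_of_le hk]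
  congr 1
  refine Finset.sum_congr rfl fun j _ => ?_
  split_ifs with hj
  · rw [eq_of_freeze_eq (hW j) (freeze_eq_of_le ((Fin.succ_le_succ_iff.2 hj).trans hk)
      (freeze_freeze_self n x))]
  · rfl

/-- The old path is recovered one time at a time. Once the earlier positions agree, the earlier
shifts and the predictable `c k` cancel, and what remains is the identity in x k plus t times a
K-Lipschitz map, injective since |t| K < 1. The predictable part needs no regularity, being a
function of what is already recovered. -/
lemma freeze_eq_of_freeze_perturb_eq {G c : Fin N → PathSpace N d → Fin d → ℝ} {K : ℝ≥0}
    (hG : ∀ n : Fin N, Measurable[canonFiltration N d n.succ] (G n))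
    (hGK : ∀ n, LipschitzWith K (G n))
    (hc : ∀ n : Fin N, Measurable[canonFiltration N d n.castSucc] (c n))
    (htK : |t| * K < 1) (n : Fin (N + 1)) (x y : PathSpace N d)
    (hxy : freeze n (perturb t (G - c) x) = freeze n (perturb t (G - c) y)) :
    freeze n x = freeze n y := by
  rw [freeze_eq_freeze_iff] at hxy ⊢
  intro k
  induction k using WellFoundedLT.induction with
  | ind k ih =>
    intro hk
    have hlt : ∀ j < k, x j = y j := fun j hj =>
      ih j hj ((Fin.succ_le_succ_iff.2 hj.le).trans hk)
    have hpast : freeze k.castSucc x = freeze k.castSucc y :=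
      freeze_eq_freeze_iff.2 fun j hj => hlt j (Fin.succ_le_castSucc_iff.1 hj)
    have h := hxy k hk
    have hWj : ∀ j < k, (G - c) j x = (G - c) j y := by
      intro j hj
      have h1 : freeze j.succ x = freeze j.succ y :=
        freeze_eq_of_le (Fin.succ_le_castSucc_iff.2 hj) hpast
      simp only [Pi.sub_apply]
      rw [eq_of_freeze_eq (hG j) h1,
        eq_of_freeze_eq (hc j) (freeze_eq_of_le j.castSucc_lt_succ.le h1)]
    have hsum : ∀ z : PathSpace N d, perturb t (G - c) z k
        = z k + ((∑ j : Fin N, if j < k then t • (G - c) j z else 0) + t • (G - c) k z) := by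
      intro z
      simp only [perturb]
      congr 1
      have : ∀ j : Fin N, (if j ≤ k then t • (G - c) j z else 0)
          = (if j < k then t • (G - c) j z else 0) + if j = k then t • (G - c) j z else 0 := by
        intro j
        rcases lt_trichotomy j k with h | h | h
        · simp [h, h.le, h.ne]
        · subst h; simp
        · simp [h.not_ge, h.not_gt, h.ne']
      simp only [this, Finset.sum_add_distrib, Finset.sum_ite_eq', Finset.mem_univ, if_true]
    rw [hsum x, hsum y] at h
    have hsum2 : (∑ j : Fin N, if j < k then t • (G - c) j x else 0)
        = ∑ j : Fin N, if j < k then t • (G - c) j y else 0 := by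
      refine Finset.sum_congr rfl fun j _ => ?_
      split_ifs with hj
      · rw [hWj j hj]
      · rfl
    rw [hsum2] at h
    have hck : c k x = c k y := eq_of_freeze_eq (hc k) hpast
    simp only [Pi.sub_apply, hck] at h
    have h2 : x k - y k = -(t • (G k x - G k y)) := by
      rw [smul_sub] at h ⊢
      rw [smul_sub] at h
      have := sub_eq_zero.2 h
      rw [← sub_eq_zero]
      rw [← this]
      abel
    have hGx : ∀ z, G k z = G k (freeze k.succ z) := fun z =>
      eq_of_freeze_eq (hG k) (freeze_freeze_self _ _).symm
    -- The frozen paths can differ in coordinate `k` only.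
    have hdist : ‖freeze k.succ x - freeze k.succ y‖ ≤ ‖x k - y k‖ := by
      refine (pi_norm_le_iff_of_nonneg (norm_nonneg _)).2 fun j => ?_
      rcases lt_trichotomy j k with h | h | h
      · rw [Pi.sub_apply, freeze_apply_of_le (Fin.succ_le_succ_iff.2 h.le),
          freeze_apply_of_le (Fin.succ_le_succ_iff.2 h.le), hlt j h, sub_self, norm_zero]
        exact norm_nonneg _
      · subst h
        rw [Pi.sub_apply, freeze_apply_of_le le_rfl, freeze_apply_of_le le_rfl]
      · have : ¬ j.succ ≤ k.succ := by
          rw [Fin.succ_le_succ_iff]; exact h.not_ge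
        simp [freeze, this]
    have h3 : ‖G k x - G k y‖ ≤ K * ‖x k - y k‖ := by
      rw [hGx x, hGx y]
      have h4 := (hGK k).dist_le_mul (freeze k.succ x) (freeze k.succ y)
      rw [dist_eq_norm, dist_eq_norm] at h4
      exact h4.trans (mul_le_mul_of_nonneg_left hdist K.coe_nonneg)
    have h5 : ‖x k - y k‖ ≤ |t| * K * ‖x k - y k‖ := by
      conv_lhs => rw [h2, norm_neg, norm_smul, Real.norm_eq_abs]
      rw [mul_assoc]
      exact mul_le_mul_of_nonneg_left h3 (abs_nonneg t)
    have h6 : ‖x k - y k‖ = 0 := by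
      have := norm_nonneg (x k - y k)
      nlinarith
    exact sub_eq_zero.1 (norm_eq_zero.1 h6)

variable {p : ℝ} {μ : Measure (PathSpace N d)}

/-- The process moves once, by `t • W n` at time `n.succ`. The sum over `n` of these processes is
what the perturbation adds to X. -/
lemma martingale_step [IsProbabilityMeasure μ] {n : Fin N}
    (hWm : Measurable[canonFiltration N d n.succ] (W n)) (hWi : Integrable (W n) μ)
    (hW0 : μ[W n | canonFiltration N d n.castSucc] =ᵐ[μ] 0) :
    Martingale (fun (m : Fin (N + 1)) x => if n.castSucc < m then t • W n x else 0)
      (canonFiltration N d) μ := by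
  constructor
  · intro m
    by_cases h : n.castSucc < m
    · simp only [h, if_true]
      have h1 := hWm.mono ((canonFiltration N d).mono (Fin.castSucc_lt_iff_succ_le.1 h)) le_rfl
      exact (h1.const_smul t).stronglyMeasurable
    · simp only [h, if_false]
      exact stronglyMeasurable_const
  · intro i j hij
    by_cases hi : n.castSucc < i
    · have hj := hi.trans_le hij
      simp only [hi, hj, if_true]
      have h1 := hWm.mono ((canonFiltration N d).mono (Fin.castSucc_lt_iff_succ_le.1 hi)) le_rfl
      exact (condExp_of_stronglyMeasurable (canonFiltration_le i)
        (f := fun x => t • W n x) (h1.const_smul t).stronglyMeasurable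
        (hWi.smul t)).eventuallyEq
    · simp only [hi, if_false]
      by_cases hj : n.castSucc < j
      · simp only [hj, if_true]
        refine (condExp_smul t (W n) _).trans ?_
        have h2 := condExp_condExp_of_le (f := W n) (μ := μ)
          ((canonFiltration N d).mono (not_lt.1 hi)) (canonFiltration_le n.castSucc)
        have h3 := condExp_congr_ae (m := canonFiltration N d i) hW0
        rw [condExp_zero] at h3
        filter_upwards [h2, h3] with x hx2 hx3
        rw [Pi.smul_apply, ← hx2, hx3, Pi.zero_apply, smul_zero]
      · simp only [hj, if_false]
        exact (condExp_zero (μ := μ)).eventuallyEq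

lemma martingale_pathAt_perturb [IsProbabilityMeasure μ]
    (hμ : Martingale (fun n => pathAt (N := N) (d := d) n) (canonFiltration N d) μ)
    (hWm : ∀ n : Fin N, Measurable[canonFiltration N d n.succ] (W n))
    (hWi : ∀ n, Integrable (W n) μ)
    (hW0 : ∀ n : Fin N, μ[W n | canonFiltration N d n.castSucc] =ᵐ[μ] 0) :
    Martingale (fun n x => pathAt n (perturb t W x)) (canonFiltration N d) μ := by
  have h1 : ∀ s : Finset (Fin N), Martingale (∑ j ∈ s, fun (m : Fin (N + 1)) x =>
      if j.castSucc < m then t • W j x else 0) (canonFiltration N d) μ := by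
    intro s
    induction s using Finset.induction_on with
    | empty => simpa using martingale_zero _ _ _
    | insert a s ha ih =>
      rw [Finset.sum_insert ha]
      exact (martingale_step (hWm a) (hWi a) (hW0 a)).add ih
  have h2 := hμ.add (h1 Finset.univ)
  convert h2 using 1
  funext n x
  rw [pathAt_perturb]
  simp [Finset.sum_apply]

lemma memLp_perturb (hp : 1 < p) (hμ : Integrable (fun x => ‖x‖ ^ p) μ)
    (hWL : ∀ n, MemLp (W n) (ENNReal.ofReal p) μ) :
    MemLp (perturb t W) (ENNReal.ofReal p) μ := by
  have h0 := memLp_id_of_integrable (by linarith) hμ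
  refine MemLp.of_eval fun k => ?_
  refine MemLp.add (h0.eval k) ?_
  refine memLp_finsetSum _ fun j _ => ?_
  by_cases h : j ≤ k
  · simp only [h, if_true]
    exact (hWL j).const_smul t
  · simp only [h, if_false]
    exact MemLp.zero

/-- The perturbed process is a martingale for the filtration of X. Since the perturbation is
adapted, preimages of F_i-sets are F_i-sets, so testing on them gives the martingale property for
the possibly smaller filtration generated by the new path. -/
lemma map_perturb_mem_martingaleMeasures (hp : 1 < p) (hμ : μ ∈ martingaleMeasures N d p)
    (hWm : ∀ n : Fin N, Measurable[canonFiltration N d n.succ] (W n))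
    (hWL : ∀ n, MemLp (W n) (ENNReal.ofReal p) μ)
    (hW0 : ∀ n : Fin N, μ[W n | canonFiltration N d n.castSucc] =ᵐ[μ] 0) :
    μ.map (perturb t W) ∈ martingaleMeasures N d p := by
  have hprob := hμ.1
  have hp0 : 0 < p := by linarith
  have hT : Measurable (perturb t W) :=
    measurable_perturb fun n => (hWm n).mono (canonFiltration_le _) le_rfl
  have hprob' : IsProbabilityMeasure (μ.map (perturb t W)) :=
    Measure.isProbabilityMeasure_map hT.aemeasurable
  have hWi : ∀ n, Integrable (W n) μ := fun n => integrable_of_memLp hp.le (hWL n)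
  have hM := martingale_pathAt_perturb (t := t) hμ.2.2 hWm hWi hW0
  have hL := memLp_perturb (t := t) hp (integrable_norm_rpow_of_mem hp0 hμ) hWL
  refine ⟨hprob', ?_, ?_⟩
  · have h1 := (memLp_ofReal_iff hp0 hL.aestronglyMeasurable).1 hL
    have h2 : Measurable fun x : PathSpace N d => ENNReal.ofReal (N * d * ‖x‖ ^ p) :=
      ((measurable_norm.pow_const p).const_mul _).ennreal_ofReal
    refine lt_of_le_of_lt (lintegral_mono fun x => ENNReal.ofReal_le_ofReal
      (pathNorm_rpow_le hp0 x)) ?_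
    rw [lintegral_map h2 hT, ← hasFiniteIntegral_iff_ofReal
      (ae_of_all _ fun x => by positivity)]
    exact (h1.const_mul _).2
  · refine ⟨Filtration.stronglyAdapted_natural _, fun i j hij => ?_⟩
    have hpi : ∀ n : Fin (N + 1), Integrable (pathAt (N := N) (d := d) n) (μ.map (perturb t W)) :=
      fun n => (integrable_map_measure (stronglyMeasurable_pathAt n).aestronglyMeasurable
        hT.aemeasurable).2 (hM.integrable n)
    symm
    refine ae_eq_condExp_of_forall_setIntegral_eq (canonFiltration_le i) (hpi j)
      (fun s _ _ => (hpi i).integrableOn) (fun s hs _ => ?_)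
      (Filtration.stronglyAdapted_natural stronglyMeasurable_pathAt i).aestronglyMeasurable
    have hs' := canonFiltration_le i _ hs
    rw [setIntegral_map hs' (stronglyMeasurable_pathAt i).aestronglyMeasurable hT.aemeasurable,
      setIntegral_map hs' (stronglyMeasurable_pathAt j).aestronglyMeasurable hT.aemeasurable]
    refine hM.setIntegral_eq hij ?_
    rw [canonFiltration_eq_comap] at hs
    obtain ⟨U, hU, rfl⟩ := hs
    exact measurable_canonFiltration_of_freeze ((measurable_freeze i).comp hT)
      (freeze_perturb_freeze hWm i) hU

end perturb

end MartDRO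

/-! ### Approximation by adapted Lipschitz processes -/

namespace MartDRO

variable {N d : ℕ}

/-- Smooth `g` at a scale given by its uniform continuity. The smoothing is C¹ with compact support,
hence Lipschitz. -/
lemma exists_lipschitz_dist_lt {g : PathSpace N d → ℝ} (hg : Continuous g)
    (hgs : HasCompactSupport g) {η : ℝ} (hη : 0 < η) :
    ∃ (h : PathSpace N d → ℝ) (K : ℝ≥0), LipschitzWith K h ∧ ∀ x, |g x - h x| ≤ η := by
  obtain ⟨δ, hδ, hgδ⟩ := Metric.uniformContinuous_iff.1
    (hg.uniformContinuous_of_tendsto_cocompact hgs.is_zero_at_infty) η hη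
  obtain ⟨h, hh, hhg⟩ := hg.exists_contDiff_dist_le_of_forall_mem_ball_dist_le
    (lt_min hδ one_pos)
  have hsupp : HasCompactSupport h := by
    refine HasCompactSupport.intro (K := Metric.cthickening 1 (tsupport g))
      hgs.isCompact.cthickening fun x hx => ?_
    have hz : ∀ y ∈ Metric.ball x (min δ 1), g y = 0 := by
      intro y hy
      by_contra hy0
      refine hx (Metric.mem_cthickening_of_dist_le x y 1 _ (subset_tsupport g hy0) ?_)
      rw [dist_comm]
      exact ((Metric.mem_ball.1 hy).trans_le (min_le_right _ _)).le
    have hx0 : g x = 0 := hz x (Metric.mem_ball_self (lt_min hδ one_pos))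
    -- With tolerance 0: the smoothing vanishes at a point around which `g` vanishes.
    have := hhg x 0 fun y hy => by rw [hz y hy, hx0, dist_self]
    rw [hx0, dist_zero_right] at this
    exact norm_le_zero_iff.1 this
  obtain ⟨K, hK⟩ := ContDiff.lipschitzWith_of_hasCompactSupport hsupp hh (by simp)
  refine ⟨h, K, hK, fun x => ?_⟩
  have := hhg x η fun y hy => (hgδ ((Metric.mem_ball.1 hy).trans_le (min_le_left _ _))).le
  rw [dist_comm, Real.dist_eq] at this
  exact this

/-- Lipschitz functions are dense in `L^p`. -/
lemma exists_lipschitz_eLpNorm_sub_le {p : ℝ} (hp : 1 < p) {μ : Measure (PathSpace N d)}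
    [IsProbabilityMeasure μ] {u : PathSpace N d → ℝ} (hu : MemLp u (ENNReal.ofReal p) μ) {η : ℝ}
    (hη : 0 < η) : ∃ (g : PathSpace N d → ℝ) (K : ℝ≥0), LipschitzWith K g ∧
      eLpNorm (u - g) (ENNReal.ofReal p) μ ≤ ENNReal.ofReal η := by
  obtain ⟨g, hgs, hug, hg, -⟩ := hu.exists_hasCompactSupport_eLpNorm_sub_le ENNReal.ofReal_ne_top
    (ε := ENNReal.ofReal (η / 2)) (by simpa using hη)
  obtain ⟨h, K, hK, hgh⟩ := exists_lipschitz_dist_lt hg hgs (half_pos hη)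
  refine ⟨h, K, hK, ?_⟩
  have h1 : eLpNorm (g - h) (ENNReal.ofReal p) μ ≤ ENNReal.ofReal (η / 2) := by
    refine (eLpNorm_le_of_ae_bound (ae_of_all _ hgh)).trans (le_of_eq ?_)
    rw [measure_univ, ENNReal.one_rpow, one_mul]
  calc eLpNorm (u - h) (ENNReal.ofReal p) μ
      = eLpNorm ((u - g) + (g - h)) (ENNReal.ofReal p) μ := by rw [sub_add_sub_cancel]
    _ ≤ eLpNorm (u - g) (ENNReal.ofReal p) μ + eLpNorm (g - h) (ENNReal.ofReal p) μ :=
        eLpNorm_add_le (hu.aestronglyMeasurable.sub hg.aestronglyMeasurable)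
          (hg.aestronglyMeasurable.sub hK.continuous.aestronglyMeasurable)
          (by simpa using hp.le)
    _ ≤ ENNReal.ofReal (η / 2) + ENNReal.ofReal (η / 2) := add_le_add hug h1
    _ = ENNReal.ofReal η := by
        rw [← ENNReal.ofReal_add (by positivity) (by positivity), add_halves]

lemma lipschitzWith_freeze (n : Fin (N + 1)) : LipschitzWith 1 (freeze (N := N) (d := d) n) := by
  refine LipschitzWith.of_dist_le_mul fun x y => ?_
  rw [NNReal.coe_one, one_mul]
  refine (dist_pi_le_iff dist_nonneg).2 fun k => ?_
  by_cases h : k.succ ≤ n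
  · rw [freeze_apply_of_le h, freeze_apply_of_le h]
    exact dist_le_pi_dist x y k
  · simp [freeze, h]

/-- Approximation of adapted functions by adapted Lipschitz functions. -/
lemma exists_adapted_lipschitz {p : ℝ} (hp : 1 < p) {μ : Measure (PathSpace N d)}
    [IsProbabilityMeasure μ] {n : Fin (N + 1)} {u : PathSpace N d → ℝ}
    (hum : Measurable[canonFiltration N d n] u) (hu : MemLp u (ENNReal.ofReal p) μ) {η : ℝ}
    (hη : 0 < η) : ∃ (g : PathSpace N d → ℝ) (K : ℝ≥0), Measurable[canonFiltration N d n] g ∧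
      LipschitzWith K g ∧ eLpNorm (u - g) (ENNReal.ofReal p) μ ≤ ENNReal.ofReal η := by
  have hus : u = u ∘ freeze n := funext fun x => eq_of_freeze_eq hum (freeze_freeze_self n x).symm
  have hum' : Measurable u := hum.mono (canonFiltration_le n) le_rfl
  have hst := measurable_freeze (N := N) (d := d) n
  -- Approximate under the law of the frozen path, then precompose with the 1-Lipschitz map `freeze
  -- n`: the approximant becomes adapted and the error is unchanged.
  have : IsProbabilityMeasure (μ.map (freeze n)) :=
    Measure.isProbabilityMeasure_map hst.aemeasurable
  have hu' : MemLp u (ENNReal.ofReal p) (μ.map (freeze n)) :=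
    (memLp_map_measure_iff hum'.aestronglyMeasurable hst.aemeasurable).2 (by rwa [← hus])
  obtain ⟨g, K, hK, hug⟩ := exists_lipschitz_eLpNorm_sub_le hp hu' hη
  refine ⟨g ∘ freeze n, K * 1,
    hK.continuous.measurable.comp (measurable_canonFiltration_freeze n),
    hK.comp (lipschitzWith_freeze n), ?_⟩
  rw [eLpNorm_map_measure (hum'.sub hK.continuous.measurable).aestronglyMeasurable
    hst.aemeasurable] at hug
  have heq : u - g ∘ freeze n = (u - g) ∘ freeze n := by
    conv_lhs => rw [hus]
    rfl
  rw [heq]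
  exact hug

/-- Subtracting the predictable projection restores the zero conditional mean that approximation
destroys. As `Z` projects to zero, the projection of `G` is that of `G - Z`, and contractivity of
conditional expectation costs a second `η`. The projection itself need not be Lipschitz. -/
lemma exists_adapted_lipschitz_process {p : ℝ} (hp : 1 < p) {μ : Measure (PathSpace N d)}
    [IsProbabilityMeasure μ] {Z : Fin N → PathSpace N d → Fin d → ℝ}
    (hZm : ∀ (n : Fin N) i, Measurable[canonFiltration N d n.succ] fun x => Z n x i)
    (hZL : ∀ n i, MemLp (fun x => Z n x i) (ENNReal.ofReal p) μ)
    (hZ0 : ∀ (n : Fin N) i,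
      μ[fun x => Z n x i | canonFiltration N d n.castSucc] =ᵐ[μ] 0) {η : ℝ} (hη : 0 < η) :
    ∃ (G : Fin N → PathSpace N d → Fin d → ℝ) (K : ℝ≥0),
      (∀ n : Fin N, Measurable[canonFiltration N d n.succ] (G n)) ∧
      (∀ n, LipschitzWith K (G n)) ∧ (∀ n, MemLp (G n) (ENNReal.ofReal p) μ) ∧
      ∀ n i, eLpNorm (fun x => (G - predictableProj μ G) n x i - Z n x i) (ENNReal.ofReal p) μ
        ≤ ENNReal.ofReal (2 * η) := by
  choose g K hgm hgK hgu using fun (n : Fin N) (i : Fin d) =>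
    exists_adapted_lipschitz hp (hZm n i) (hZL n i) hη
  have hgm' : ∀ n i, Measurable (g n i) := fun n i => (hgm n i).mono (canonFiltration_le _) le_rfl
  have hp1 : 1 ≤ ENNReal.ofReal p := by simpa using hp.le
  have hdL : ∀ n i, MemLp ((fun x => Z n x i) - g n i) (ENNReal.ofReal p) μ := fun n i =>
    ⟨(hZL n i).aestronglyMeasurable.sub (hgm' n i).aestronglyMeasurable,
      (hgu n i).trans_lt ENNReal.ofReal_lt_top⟩
  have hgL : ∀ n i, MemLp (g n i) (ENNReal.ofReal p) μ := fun n i => by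
    have := (hZL n i).sub (hdL n i)
    rwa [sub_sub_cancel] at this
  refine ⟨fun n x i => g n i x, ∑ n, ∑ i, K n i, fun n => ?_, fun n => ?_, fun n =>
    MemLp.of_eval fun i => hgL n i, fun n i => ?_⟩
  · exact @measurable_pi_lambda _ _ _ (_) _ _ fun i => hgm n i
  · refine LipschitzWith.of_dist_le_mul fun x y => ?_
    refine (dist_pi_le_iff (by positivity)).2 fun i => ?_
    have hle : K n i ≤ ∑ n, ∑ i, K n i :=
      (Finset.single_le_sum (f := fun i => K n i) (fun _ _ => zero_le) (Finset.mem_univ i)).trans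
        (Finset.single_le_sum (f := fun n => ∑ i, K n i) (fun _ _ => zero_le)
          (Finset.mem_univ n))
    exact ((hgK n i).weaken hle).dist_le_mul x y
  · have hgi : Integrable (g n i) μ := integrable_of_memLp hp.le (hgL n i)
    have hZi : Integrable (fun x => Z n x i) μ := integrable_of_memLp hp.le (hZL n i)
    have h1 := predictableProj_apply (μ := μ) (A := fun n x i => g n i x) (n := n)
      (fun i => integrable_of_memLp hp.le (hgL n i)) i
    have h2 := condExp_sub (μ := μ) hZi hgi (canonFiltration N d n.castSucc)
    have h3 : (fun x => ((fun n x i => g n i x) - predictableProj μ fun n x i => g n i x) n x i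
        - Z n x i) =ᵐ[μ] -((fun x => Z n x i) - g n i)
          + μ[(fun x => Z n x i) - g n i | canonFiltration N d n.castSucc] := by
      filter_upwards [h1, h2, hZ0 n i] with x hx1 hx2 hx3
      simp only [Pi.sub_apply, Pi.add_apply, Pi.neg_apply, hx2, hx3, hx1, Pi.zero_apply]
      change _ = -(Z n x i - g n i x) + (0 - (μ[g n i | canonFiltration N d n.castSucc]) x)
      ring
    rw [eLpNorm_congr_ae h3]
    calc _ ≤ eLpNorm (-((fun x => Z n x i) - g n i)) (ENNReal.ofReal p) μ
          + eLpNorm (μ[(fun x => Z n x i) - g n i | canonFiltration N d n.castSucc])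
              (ENNReal.ofReal p) μ :=
          eLpNorm_add_le (hdL n i).neg.aestronglyMeasurable
            ((hdL n i).condExp hp1).aestronglyMeasurable hp1
      _ ≤ ENNReal.ofReal η + ENNReal.ofReal η := by
          rw [eLpNorm_neg]
          exact add_le_add (hgu n i) ((eLpNorm_condExp_le_eLpNorm _ hp1).trans (hgu n i))
      _ = ENNReal.ofReal (2 * η) := by
          rw [← ENNReal.ofReal_add hη.le hη.le, two_mul]

lemma rpow_integral_le_of_eLpNorm_le {Ω : Type*} {m : MeasurableSpace Ω} {μ : Measure Ω} {p : ℝ}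
    (hp : 1 < p) {u : Ω → ℝ} (hu : MemLp u (ENNReal.ofReal p) μ) {η : ℝ} (hη : 0 ≤ η)
    (h : eLpNorm u (ENNReal.ofReal p) μ ≤ ENNReal.ofReal η) :
    (∫ x, |u x| ^ p ∂μ) ^ (1 / p) ≤ η := by
  rw [hu.eLpNorm_eq_integral_rpow_norm (by simpa using (by linarith : 0 < p))
    ENNReal.ofReal_ne_top, ENNReal.toReal_ofReal (by linarith),
    ENNReal.ofReal_le_ofReal_iff hη] at h
  rw [one_div]
  exact h

lemma rpow_integral_le_add {Ω : Type*} {m : MeasurableSpace Ω} {μ : Measure Ω} {p : ℝ}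
    (hp : 1 < p) {u v : Ω → ℝ} (hu : MemLp u (ENNReal.ofReal p) μ)
    (hv : MemLp v (ENNReal.ofReal p) μ) {η : ℝ} (hη : 0 ≤ η)
    (h : eLpNorm (fun x => u x - v x) (ENNReal.ofReal p) μ ≤ ENNReal.ofReal η) :
    ∫ x, |u x| ^ p ∂μ ≤ ((∫ x, |v x| ^ p ∂μ) ^ (1 / p) + η) ^ p := by
  have hp0 : 0 < p := by linarith
  have hv0 : 0 ≤ ∫ x, |v x| ^ p ∂μ := integral_nonneg fun x => by positivity
  have hu0 : 0 ≤ ∫ x, |u x| ^ p ∂μ := integral_nonneg fun x => by positivity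
  have h1 : eLpNorm u (ENNReal.ofReal p) μ
      ≤ ENNReal.ofReal ((∫ x, |v x| ^ p ∂μ) ^ (1 / p) + η) := by
    have h2 : u = v + fun x => u x - v x := by
      funext x; simp
    have h3 : eLpNorm v (ENNReal.ofReal p) μ = ENNReal.ofReal ((∫ x, |v x| ^ p ∂μ) ^ (1 / p)) := by
      rw [hv.eLpNorm_eq_integral_rpow_norm (by simpa using hp0)
        ENNReal.ofReal_ne_top, ENNReal.toReal_ofReal hp0.le, one_div]
      rfl
    rw [ENNReal.ofReal_add (by positivity) hη, ← h3]
    conv_lhs => rw [h2]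
    exact (eLpNorm_add_le hv.aestronglyMeasurable (hu.sub hv).aestronglyMeasurable
      (by simpa using hp.le)).trans (add_le_add le_rfl h)
  have h4 := rpow_integral_le_of_eLpNorm_le hp hu (by positivity) h1
  calc ∫ x, |u x| ^ p ∂μ = ((∫ x, |u x| ^ p ∂μ) ^ (1 / p)) ^ p := by
        rw [← Real.rpow_mul hu0, one_div_mul_cancel hp0.ne', Real.rpow_one]
    _ ≤ _ := Real.rpow_le_rpow (by positivity) h4 hp0.le

lemma abs_integral_mul_le {Ω : Type*} {m : MeasurableSpace Ω} {μ : Measure Ω} {p q : ℝ}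
    (hpq : p.HolderConjugate q) {u v : Ω → ℝ} (hu : MemLp u (ENNReal.ofReal q) μ)
    (hv : MemLp v (ENNReal.ofReal p) μ) {η : ℝ} (hη : 0 ≤ η)
    (h : eLpNorm v (ENNReal.ofReal p) μ ≤ ENNReal.ofReal η) :
    |∫ x, u x * v x ∂μ| ≤ (∫ x, |u x| ^ q ∂μ) ^ (1 / q) * η := by
  have h1 := integral_mul_le_Lp_mul_Lq_of_nonneg hpq.symm (f := fun x => |u x|)
    (g := fun x => |v x|) (μ := μ) (ae_of_all _ fun x => abs_nonneg _)
    (ae_of_all _ fun x => abs_nonneg _) hu.abs hv.abs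
  have h2 := rpow_integral_le_of_eLpNorm_le hpq.lt hv hη h
  calc |∫ x, u x * v x ∂μ| ≤ ∫ x, |u x * v x| ∂μ := abs_integral_le_integral_abs
    _ = ∫ x, |u x| * |v x| ∂μ := by simp only [abs_mul]
    _ ≤ _ := h1
    _ ≤ _ := by
        gcongr

end MartDRO

/-! ### Almost optimal directions and the lower bound -/

namespace MartDRO

variable {N d : ℕ}

section lower

variable {p q : ℝ} {μ : Measure (PathSpace N d)} {D h : Fin N → PathSpace N d → Fin d → ℝ}

/-- The dual optimizer of the best approximation problem. -/
lemma IsBestPredictable.exists_dual (hpq : p.HolderConjugate q) [IsProbabilityMeasure μ]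
    (hD : ∀ n i, MemLp (fun x => D n x i) (ENNReal.ofReal q) μ)
    (hh : IsBestPredictable q μ (optionalProj μ D) h) {γ : ℝ} (hγ : 0 < γ)
    (ha : 0 < lqDist q μ (optionalProj μ D - h)) :
    ∃ Z : Fin N → PathSpace N d → Fin d → ℝ,
      (∀ (n : Fin N) i, Measurable[canonFiltration N d n.succ] fun x => Z n x i) ∧
      (∀ n i, MemLp (fun x => Z n x i) (ENNReal.ofReal p) μ) ∧
      (∀ (n : Fin N) i, μ[fun x => Z n x i | canonFiltration N d n.castSucc] =ᵐ[μ] 0) ∧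
      ∑ n, ∑ i, ∫ x, |Z n x i| ^ p ∂μ = γ ^ p ∧
      ∑ n, ∑ i, ∫ x, D n x i * Z n x i ∂μ = γ * lqDist q μ (optionalProj μ D - h) := by
  set A := optionalProj μ D with hAdef
  set a := lqDist q μ (A - h) with hadef
  have hq := hpq.symm.pos
  have hp := hpq.pos
  have hA : ∀ n i, MemLp (fun x => A n x i) (ENNReal.ofReal q) μ :=
    memLp_optionalProj hpq.symm.lt.le hD
  have hhL := predictableLq.memLp hq hh.1
  have hAh : ∀ n i, MemLp (fun x => A n x i - h n x i) (ENNReal.ofReal q) μ := fun n i =>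
    (hA n i).sub (hhL n i)
  have hφL : ∀ n i, MemLp (fun x => oddPow q (A n x i - h n x i)) (ENNReal.ofReal p) μ :=
    fun n i => memLp_oddPow hpq (hAh n i)
  have hhm : ∀ (n : Fin N) i, Measurable[canonFiltration N d n.castSucc] fun x => h n x i :=
    fun n i => (measurable_pi_apply i).comp (hh.1.1 n)
  have hφm : ∀ (n : Fin N) i, Measurable[canonFiltration N d n.succ]
      fun x => oddPow q (A n x i - h n x i) := fun n i =>
    (continuous_oddPow hpq.symm.lt).measurable.comp ((measurable_optionalProj D n i).sub
      ((hhm n i).mono ((canonFiltration N d).mono n.castSucc_lt_succ.le) le_rfl))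
  have hsum : ∑ n, ∑ i, ∫ x, |A n x i - h n x i| ^ q ∂μ = a ^ q := by
    rw [hadef, lqDist, ← Real.rpow_mul (Finset.sum_nonneg fun _ _ => Finset.sum_nonneg fun _ _ =>
      integral_nonneg fun _ => Real.rpow_nonneg (abs_nonneg _) _), one_div_mul_cancel hq.ne',
      Real.rpow_one]
    rfl
  -- Normalization: as (q - 1)p = q, the odd power of A - h has L^p norm a^(q-1), so scaling by `s`
  -- gives norm γ.
  set s := γ * a ^ (-(q - 1)) with hs
  have hs0 : 0 < s := by positivity
  refine ⟨fun n x i => s * oddPow q (A n x i - h n x i), fun n i => (hφm n i).const_mul s,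
    fun n i => (hφL n i).const_mul s, fun n i => ?_, ?_, ?_⟩
  · refine (condExp_smul s (fun x => oddPow q (A n x i - h n x i)) _).trans ?_
    filter_upwards [hh.2 n i] with x hx
    rw [Pi.smul_apply, hx, Pi.zero_apply, smul_zero]
  · simp only [abs_mul, Real.mul_rpow (abs_nonneg _) (abs_nonneg _), abs_oddPow_rpow hpq,
      integral_const_mul, ← Finset.mul_sum, hsum]
    rw [abs_of_pos hs0, hs, Real.mul_rpow hγ.le (by positivity), ← Real.rpow_mul ha.le, mul_assoc,
      ← Real.rpow_add ha, neg_mul, hpq.symm.sub_one_mul_conj]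
    simp
  · have hterm : ∀ n i, ∫ x, D n x i * (s * oddPow q (A n x i - h n x i)) ∂μ
        = s * ∫ x, |A n x i - h n x i| ^ q ∂μ := by
      intro n i
      have hDi : ∀ i, Integrable (fun x => D n x i) μ := fun i =>
        integrable_of_memLp hpq.symm.lt.le (hD n i)
      have hDA : MemLp (fun x => D n x i - A n x i) (ENNReal.ofReal q) μ := (hD n i).sub (hA n i)
      have z1 : ∫ x, (D n x i - A n x i) * oddPow q (A n x i - h n x i) ∂μ = 0 :=
        integral_mul_eq_zero_of_condExp (canonFiltration_le n.succ)
          (integrable_of_memLp hpq.symm.lt.le hDA) (condExp_sub_optionalProj hDi i)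
          (hφm n i).stronglyMeasurable.aestronglyMeasurable
          (integrable_mul_of_memLp hpq hDA (hφL n i))
      have z2 := hh.integral_mul_eq_zero hpq hA (hhL n i) (hhm n i) i
      have i1 := integrable_mul_of_memLp hpq hDA (hφL n i)
      have i2 := integrable_mul_of_memLp hpq.symm (hφL n i) (hhL n i)
      have i3 := integrable_abs_rpow hq (hAh n i)
      have hdecomp : ∀ x, D n x i * (s * oddPow q (A n x i - h n x i))
          = s * ((D n x i - A n x i) * oddPow q (A n x i - h n x i)
            + (oddPow q (A n x i - h n x i) * h n x i + |A n x i - h n x i| ^ q)) := fun x => by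
        rw [← oddPow_mul_self hpq.symm.lt]
        ring
      have i23 : Integrable (fun x => oddPow q (A n x i - h n x i) * h n x i
        + |A n x i - h n x i| ^ q) μ := i2.add i3
      rw [integral_congr_ae (ae_of_all _ hdecomp), integral_const_mul, integral_add i1 i23,
        integral_add i2 i3, z1, z2, zero_add, zero_add]
    simp only [hterm, ← Finset.mul_sum, hsum]
    rw [hs, mul_assoc, ← Real.rpow_add ha]
    simp

/-- Almost optimal directions which are Lipschitz up to a predictable process. -/
lemma IsBestPredictable.exists_direction (hpq : p.HolderConjugate q) [IsProbabilityMeasure μ]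
    (hD : ∀ n i, MemLp (fun x => D n x i) (ENNReal.ofReal q) μ)
    (hh : IsBestPredictable q μ (optionalProj μ D) h) {ε : ℝ} (hε : 0 < ε) :
    ∃ (G : Fin N → PathSpace N d → Fin d → ℝ) (K : ℝ≥0),
      (∀ n : Fin N, Measurable[canonFiltration N d n.succ] (G n)) ∧
      (∀ n, LipschitzWith K (G n)) ∧ (∀ n, MemLp (G n) (ENNReal.ofReal p) μ) ∧
      ∑ n, ∑ i, ∫ x, |(G - predictableProj μ G) n x i| ^ p ∂μ ≤ 1 ∧
      lqDist q μ (optionalProj μ D - h) - ε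
        ≤ ∑ n, ∑ i, ∫ x, D n x i * (G - predictableProj μ G) n x i ∂μ := by
  set a := lqDist q μ (optionalProj μ D - h) with ha
  have hp := hpq.pos
  rcases le_or_gt a ε with hle | hlt
  · have h0 : predictableProj μ (0 : Fin N → PathSpace N d → Fin d → ℝ) = 0 := by
      funext n
      exact condExp_zero
    refine ⟨0, 0, fun n => @measurable_const _ _ _ (_) _, fun n => LipschitzWith.const 0,
      fun n => MemLp.zero, ?_, ?_⟩
    · rw [h0]
      simp [Real.zero_rpow hp.ne']
    · rw [h0]
      simpa using hle
  -- The slack γ < 1 keeps the Lipschitz approximation in the unit ball of L^p. Half of `ε` is spent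
  -- in γ a = a - ε/2, the other half on the pairing error.
  · set γ := 1 - ε / (2 * a) with hγ
    have ha0 : 0 < a := hε.trans hlt
    have hε2 : ε / (2 * a) < 1 := by
      rw [div_lt_one (by positivity)]
      linarith
    have hε3 : 0 < ε / (2 * a) := by positivity
    have hγ0 : 0 < γ := by linarith
    have hγ1 : γ < 1 := by linarith
    obtain ⟨Z, hZm, hZL, hZ0, hZp, hZD⟩ := hh.exists_dual hpq hD hγ0 ha0
    rw [← ha] at hZD
    set z : Fin N → Fin d → ℝ := fun n i => (∫ x, |Z n x i| ^ p ∂μ) ^ (1 / p) with hz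
    set b : Fin N → Fin d → ℝ := fun n i => (∫ x, |D n x i| ^ q ∂μ) ^ (1 / q) with hb
    have hzp : ∀ n i, z n i ^ p = ∫ x, |Z n x i| ^ p ∂μ := fun n i => by
      rw [hz, ← Real.rpow_mul (integral_nonneg fun x => by positivity),
        one_div_mul_cancel hp.ne', Real.rpow_one]
    have hc1 : Continuous fun η : ℝ => ∑ n, ∑ i, (z n i + 2 * η) ^ p :=
      continuous_finsetSum _ fun n _ => continuous_finsetSum _ fun i _ =>
        (by fun_prop : Continuous fun η : ℝ => z n i + 2 * η).rpow_const fun _ => Or.inr hp.le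
    have hc2 : Continuous fun η : ℝ => ∑ n, ∑ i, b n i * (2 * η) := by fun_prop
    have e1 : ∀ᶠ η in 𝓝 (0 : ℝ), ∑ n, ∑ i, (z n i + 2 * η) ^ p < 1 := by
      refine hc1.continuousAt.eventually (gt_mem_nhds ?_)
      simp only [mul_zero, add_zero, hzp, hZp]
      exact Real.rpow_lt_one hγ0.le hγ1 hp
    have e2 : ∀ᶠ η in 𝓝 (0 : ℝ), ∑ n, ∑ i, b n i * (2 * η) < ε / 2 := by
      refine hc2.continuousAt.eventually (gt_mem_nhds ?_)
      simpa using hε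
    obtain ⟨η, ⟨hη1, hη2⟩, hη⟩ := (((e1.and e2).filter_mono nhdsWithin_le_nhds).and
      (self_mem_nhdsWithin (s := Set.Ioi (0 : ℝ)))).exists
    have hη0 : 0 < η := hη
    obtain ⟨G, K, hGm, hGK, hGL, hGZ⟩ :=
      exists_adapted_lipschitz_process hpq.lt hZm hZL hZ0 hη0
    have hGLi : ∀ n i, MemLp (fun x => G n x i) (ENNReal.ofReal p) μ := fun n i => (hGL n).eval i
    have hWL : ∀ n i, MemLp (fun x => (G - predictableProj μ G) n x i) (ENNReal.ofReal p) μ :=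
      fun n i => (hGLi n i).sub (memLp_predictableProj hpq.lt.le hGLi n i)
    refine ⟨G, K, hGm, hGK, hGL, ?_, ?_⟩
    · refine le_trans (Finset.sum_le_sum fun n _ => Finset.sum_le_sum fun i _ => ?_) hη1.le
      exact rpow_integral_le_add hpq.lt (hWL n i) (hZL n i) (by positivity) (hGZ n i)
    · have hdiff : ∀ n i, ∫ x, D n x i * Z n x i ∂μ - b n i * (2 * η)
          ≤ ∫ x, D n x i * (G - predictableProj μ G) n x i ∂μ := by
        intro n i
        have h1 := abs_integral_mul_le hpq (hD n i)
          (v := fun x => (G - predictableProj μ G) n x i - Z n x i)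
          ((hWL n i).sub (hZL n i)) (by positivity) (hGZ n i)
        have i1 := integrable_mul_of_memLp hpq (hD n i) (hWL n i)
        have i2 := integrable_mul_of_memLp hpq (hD n i) (hZL n i)
        simp only [mul_sub] at h1
        rw [integral_sub i1 i2] at h1
        have := (abs_le.1 h1).1
        simp only [hb]
        linarith
      have hsum := Finset.sum_le_sum fun n (_ : n ∈ Finset.univ) =>
        Finset.sum_le_sum fun i (_ : i ∈ Finset.univ) => hdiff n i
      simp only [Finset.sum_sub_distrib] at hsum
      rw [hZD] at hsum
      have hγa : γ * a = a - ε / 2 := by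
        rw [hγ]; field_simp
      linarith

end lower

/-- The first order lower bound for the objective along bicausal couplings. -/
lemma exists_le_objective_sub {p q : ℝ} (hpq : p.HolderConjugate q) {f : PathSpace N d → ℝ}
    (hf : ContDiff ℝ 1 f)
    (hfgrowth : ∃ C : ℝ, ∀ x : PathSpace N d,
      pathNorm p (fun n => malliavin f n x) ≤ C * (1 + pathNorm p x ^ (p - 1)))
    {μ : Measure (PathSpace N d)} (hμ : μ ∈ martingaleMeasures N d p)
    {h : Fin N → PathSpace N d → Fin d → ℝ}
    (hh : IsBestPredictable q μ (optionalProj μ (malliavin f)) h) {ε : ℝ} (hε : 0 < ε) :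
    ∃ (C : ℝ) (K : ℝ≥0), 0 ≤ C ∧ ∀ t : ℝ, 0 ≤ t → t * K < 1 →
      ∃ ν ∈ martingaleMeasures N d p, ∃ π ∈ bicausalCouplings μ ν,
        Integrable (fun z => cost p z.1 z.2) π ∧ ∫ z, cost p z.1 z.2 ∂π ≤ t ^ p ∧
        (lqDist q μ (optionalProj μ (malliavin f) - h) - ε) * t - C * t ^ p
          ≤ ∫ x, f x ∂ν - ∫ x, f x ∂μ := by
  have hprob := hμ.1
  have hp := hpq.pos
  obtain ⟨c₀, hc0, hc⟩ := exists_norm_fderiv_le hpq.lt hfgrowth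
  have hμi := integrable_norm_rpow_of_mem hp hμ
  have hD := memLp_malliavin hpq hf hfgrowth hμi
  obtain ⟨C, hC, hR⟩ := exists_integral_remainder_le hpq hf hc0 hc hμi (half_pos hε)
  obtain ⟨G, K, hGm, hGK, hGL, hWp, hWD⟩ := hh.exists_direction hpq hD (half_pos hε)
  set W := G - predictableProj μ G with hW
  have hGLi : ∀ n i, MemLp (fun x => G n x i) (ENNReal.ofReal p) μ := fun n i => (hGL n).eval i
  have hcL : ∀ n, MemLp (predictableProj μ G n) (ENNReal.ofReal p) μ := fun n =>
    MemLp.of_eval fun i => memLp_predictableProj hpq.lt.le hGLi n i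
  have hcm : ∀ n : Fin N, Measurable[canonFiltration N d n.castSucc] (predictableProj μ G n) :=
    measurable_predictableProj G
  have hWL : ∀ n, MemLp (W n) (ENNReal.ofReal p) μ := fun n => (hGL n).sub (hcL n)
  have hWm : ∀ n : Fin N, Measurable[canonFiltration N d n.succ] (W n) := fun n =>
    (hGm n).sub ((hcm n).mono ((canonFiltration N d).mono n.castSucc_lt_succ.le) le_rfl)
  have hW0 : ∀ n : Fin N, μ[W n | canonFiltration N d n.castSucc] =ᵐ[μ] 0 := by
    intro n
    have i1 : Integrable (G n) μ := integrable_of_memLp hpq.lt.le (hGL n)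
    have i2 : Integrable (predictableProj μ G n) μ := integrable_of_memLp hpq.lt.le (hcL n)
    refine (condExp_sub i1 i2 _).trans ?_
    rw [condExp_of_stronglyMeasurable (canonFiltration_le _) (hcm n).stronglyMeasurable i2]
    exact ae_of_all _ fun x => sub_self _
  refine ⟨C, K, hC, fun t ht htK => ?_⟩
  have hT : Measurable (perturb t W) :=
    measurable_perturb fun n => (hWm n).mono (canonFiltration_le _) le_rfl
  have hν : μ.map (perturb t W) ∈ martingaleMeasures N d p :=
    map_perturb_mem_martingaleMeasures hpq.lt hμ hWm hWL hW0
  have hπ := map_graph_mem_bicausalCouplings (μ := μ) hT (freeze_perturb_freeze hWm)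
    (freeze_eq_of_freeze_perturb_eq hGm hGK hcm (by rwa [abs_of_nonneg ht]))
  have hprobν := hν.1
  have hνi := integrable_norm_rpow_of_mem hp hν
  have hgraph : Measurable fun x => (x, perturb t W x) := measurable_id.prodMk hT
  refine ⟨_, hν, _, hπ, ?_⟩
  obtain ⟨hprobπ, hfst, hsnd, -, -⟩ := hπ
  obtain ⟨-, hcost⟩ := integrable_cost
    (π := μ.map fun x => (x, perturb t W x)) hpq.lt (by rwa [hfst]) (by rwa [hsnd])
  have hWi : ∀ n i, Integrable (fun x => |W n x i| ^ p) μ := fun n i =>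
    integrable_abs_rpow hp ((hWL n).eval i)
  -- The increments move by exactly `t • W`, and W lies in the unit ball of L^p; hence the transport
  -- distance is at most t.
  have hcostpt : ∀ x, cost p x (perturb t W x) = t ^ p * ∑ n, ∑ i, |W n x i| ^ p := by
    intro x
    rw [cost_eq_sum hp]
    simp only [increment_perturb_sub, Pi.smul_apply, smul_eq_mul, abs_mul, abs_of_nonneg ht,
      Real.mul_rpow ht (abs_nonneg _), Finset.mul_sum]
  have hcostint : ∫ z, cost p z.1 z.2 ∂(μ.map fun x => (x, perturb t W x)) ≤ t ^ p := by
    rw [integral_map hgraph.aemeasurable (measurable_cost p).aestronglyMeasurable]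
    simp only [hcostpt]
    rw [integral_const_mul, integral_finsetSum _ fun n _ => integrable_finsetSum _ fun i _ =>
      hWi n i]
    have : ∑ n, ∫ x, ∑ i, |W n x i| ^ p ∂μ = ∑ n, ∑ i, ∫ x, |W n x i| ^ p ∂μ :=
      Finset.sum_congr rfl fun n _ => integral_finsetSum _ fun i _ => hWi n i
    rw [this]
    exact mul_le_of_le_one_right (by positivity) hWp
  refine ⟨hcost, hcostint, ?_⟩
  have hRπ := hR _ hfst hcost
  have hcost0 : 0 ≤ ∫ z, cost p z.1 z.2 ∂(μ.map fun x => (x, perturb t W x)) :=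
    integral_nonneg fun z => cost_nonneg _ _ _
  have hroot : (∫ z, cost p z.1 z.2 ∂(μ.map fun x => (x, perturb t W x))) ^ (1 / p) ≤ t := by
    calc _ ≤ (t ^ p) ^ (1 / p) := Real.rpow_le_rpow hcost0 hcostint (by positivity)
      _ = t := by rw [← Real.rpow_mul ht, mul_one_div_cancel hp.ne', Real.rpow_one]
  have fμ := integrable_objective hpq.lt hf hc0 hc hμi
  have fν := integrable_objective hpq.lt hf hc0 hc hνi
  have fT : Integrable (fun x => f (perturb t W x)) μ := fν.comp_measurable hT
  have iDW : ∀ n i, Integrable (fun x => malliavin f n x i * W n x i) μ := fun n i =>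
    integrable_mul_of_memLp hpq (hD n i) ((hWL n).eval i)
  have hFpt : ∀ x, fderiv ℝ f x (perturb t W x - x)
      = t * ∑ n, ∑ i, malliavin f n x i * W n x i := by
    intro x
    rw [fderiv_apply_eq_sum]
    simp only [increment_perturb_sub, Pi.smul_apply, smul_eq_mul, Finset.mul_sum]
    exact Finset.sum_congr rfl fun n _ => Finset.sum_congr rfl fun i _ => by ring
  have iF : Integrable (fun x => fderiv ℝ f x (perturb t W x - x)) μ := by
    simp only [hFpt]
    exact (integrable_finsetSum _ fun n _ => integrable_finsetSum _ fun i _ =>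
      iDW n i).const_mul t
  have eF : ∫ x, fderiv ℝ f x (perturb t W x - x) ∂μ
      = t * ∑ n, ∑ i, ∫ x, malliavin f n x i * W n x i ∂μ := by
    simp only [hFpt]
    rw [integral_const_mul, integral_finsetSum _ fun n _ => integrable_finsetSum _ fun i _ =>
      iDW n i]
    congr 1
    exact Finset.sum_congr rfl fun n _ => integral_finsetSum _ fun i _ => iDW n i
  have hRm : Continuous fun z : PathSpace N d × PathSpace N d =>
      |f z.2 - f z.1 - fderiv ℝ f z.1 (z.2 - z.1)| :=
    (((hf.continuous.comp continuous_snd).sub (hf.continuous.comp continuous_fst)).sub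
      (((hf.continuous_fderiv one_ne_zero).comp continuous_fst).clm_apply
        (continuous_snd.sub continuous_fst))).abs
  rw [integral_map hgraph.aemeasurable hRm.aestronglyMeasurable] at hRπ
  have i21 : Integrable (fun x => f (perturb t W x) - f x) μ := fT.sub fμ
  have iR : Integrable (fun x => f (perturb t W x) - f x - fderiv ℝ f x (perturb t W x - x)) μ :=
    i21.sub iF
  have hR1 := (neg_le_of_abs_le (abs_integral_le_integral_abs (μ := μ) (f := fun x =>
    f (perturb t W x) - f x - fderiv ℝ f x (perturb t W x - x))))
  rw [integral_sub i21 iF, integral_sub fT fμ, eF] at hR1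
  have eν : ∫ x, f x ∂(μ.map (perturb t W)) = ∫ x, f (perturb t W x) ∂μ :=
    integral_map hT.aemeasurable hf.continuous.aestronglyMeasurable
  rw [eν]
  have h1 : ε / 2 * (∫ z, cost p z.1 z.2 ∂(μ.map fun x => (x, perturb t W x))) ^ (1 / p)
      ≤ ε / 2 * t := by gcongr
  have h2 : C * ∫ z, cost p z.1 z.2 ∂(μ.map fun x => (x, perturb t W x)) ≤ C * t ^ p := by gcongr
  have h3 := mul_le_mul_of_nonneg_right hWD ht
  linarith

end MartDRO

/-! ### From first-order bounds to the expansion of the value -/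

namespace MartDRO

variable {N d : ℕ}

section bicausalCost

variable {p : ℝ} {μ ν : Measure (PathSpace N d)}
  {π : Measure (PathSpace N d × PathSpace N d)}

lemma bicausalCost_le (hπ : π ∈ bicausalCouplings μ ν)
    (hc : Integrable (fun z => cost p z.1 z.2) π) :
    bicausalCost p μ ν ≤ ENNReal.ofReal (∫ z, cost p z.1 z.2 ∂π) := by
  rw [ofReal_integral_eq_lintegral_ofReal hc (ae_of_all _ fun z => cost_nonneg p z.1 z.2)]
  exact iInf₂_le π hπ

lemma exists_integral_cost_lt {s : ℝ} (hs : bicausalCost p μ ν < ENNReal.ofReal s)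
    (hc : ∀ π ∈ bicausalCouplings μ ν, Integrable (fun z => cost p z.1 z.2) π) :
    ∃ π ∈ bicausalCouplings μ ν, ∫ z, cost p z.1 z.2 ∂π < s := by
  simp only [bicausalCost, iInf_lt_iff] at hs
  obtain ⟨π, hπ, h⟩ := hs
  rw [← ofReal_integral_eq_lintegral_ofReal (hc π hπ)
    (ae_of_all _ fun z => cost_nonneg p z.1 z.2)] at h
  exact ⟨π, hπ, lt_of_not_ge fun h' => h.not_ge (ENNReal.ofReal_le_ofReal h')⟩

end bicausalCost

section expansion

variable {p : ℝ} {L : ℝ≥0 → ℝ≥0∞}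

/-- For `z = ⊤` the difference is `⊥` and nothing is required: infinitely penalized measures drop
out of upper bounds. -/
lemma coe_sub_coe_le_iff {x c : ℝ} {z : ℝ≥0∞} :
    (x : EReal) - (z : EReal) ≤ (c : EReal) ↔ (z ≠ ⊤ → x - z.toReal ≤ c) := by
  rcases eq_or_ne z ⊤ with rfl | hz
  · simp
  · lift z to ℝ≥0 using hz
    simp only [ne_eq, ENNReal.coe_ne_top, not_false_eq_true, ENNReal.coe_toReal, forall_const]
    rw [← EReal.coe_le_coe_iff, EReal.coe_sub]
    rfl

lemma coe_le_coe_sub {x c : ℝ} {z : ℝ≥0∞} (hz : z ≠ ⊤) (h : c ≤ x - z.toReal) :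
    (c : EReal) ≤ (x : EReal) - (z : EReal) := by
  lift z to ℝ≥0 using hz
  rw [← EReal.coe_le_coe_iff, EReal.coe_sub] at h
  exact h

lemma coe_mul_ofReal {a : ℝ} (ha : 0 ≤ a) (u : ℝ≥0) :
    (((u : ℝ≥0∞) * ENNReal.ofReal a : ℝ≥0∞) : EReal) = ((u * a : ℝ) : EReal) := by
  rw [← ENNReal.ofReal_coe_nnreal, ← ENNReal.ofReal_mul u.coe_nonneg,
    EReal.coe_ennreal_ofReal, max_eq_left (by positivity)]

lemma exists_mul_rpow_le (hp : 0 < p)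
    (hLgrowth : liminf (fun u : ℝ≥0 => L u / (u : ℝ≥0∞) ^ p) atTop = ⊤) {M : ℝ} (hM : 0 ≤ M) :
    ∃ U : ℝ≥0, 1 ≤ U ∧ ∀ u, U ≤ u → L u ≠ ⊤ → M * (u : ℝ) ^ p ≤ (L u).toReal := by
  have h := eventually_lt_of_lt_liminf (f := atTop) (u := fun u : ℝ≥0 => L u / (u : ℝ≥0∞) ^ p)
    (b := ENNReal.ofReal M) (by rw [hLgrowth]; exact ENNReal.ofReal_lt_top)
  obtain ⟨U, hU⟩ := eventually_atTop.1 h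
  refine ⟨max U 1, le_max_right _ _, fun u hu hLu => ?_⟩
  have h1 := ENNReal.mul_le_of_le_div (hU u ((le_max_left _ _).trans hu)).le
  rw [← ENNReal.ofReal_coe_nnreal, ENNReal.ofReal_rpow_of_nonneg u.coe_nonneg hp.le,
    ← ENNReal.ofReal_mul hM] at h1
  exact (ENNReal.ofReal_le_iff_le_toReal hLu).1 h1

/-- The conjugate is finite: beyond some U ≥ 1 the penalty exceeds a u^p ≥ a u, so only u ≤ U
matters and U a is a bound. The point u = 0 gives nonnegativity. -/
lemma exists_convexConj_eq (hp : 1 < p) (hL0 : L 0 = 0)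
    (hLgrowth : liminf (fun u : ℝ≥0 => L u / (u : ℝ≥0∞) ^ p) atTop = ⊤) {a : ℝ} (ha : 0 ≤ a) :
    ∃ Υ : ℝ, 0 ≤ Υ ∧ (Υ : EReal) = convexConj L (ENNReal.ofReal a) := by
  obtain ⟨U, hU1, hU⟩ := exists_mul_rpow_le (by linarith) hLgrowth ha
  have h0 : (0 : EReal) ≤ convexConj L (ENNReal.ofReal a) :=
    le_iSup_of_le 0 (by simp [hL0])
  have htop : convexConj L (ENNReal.ofReal a) ≤ ((U * a : ℝ) : EReal) := by
    refine iSup_le fun u => ?_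
    rw [coe_mul_ofReal ha, coe_sub_coe_le_iff]
    intro hu
    rcases le_total U u with h | h
    · have h1 : (1 : ℝ) ≤ u := by exact_mod_cast hU1.trans h
      have h2 := Real.self_le_rpow_of_one_le h1 hp.le
      have := hU u h hu
      have : 0 ≤ (U : ℝ) * a := by positivity
      nlinarith
    · have : (u : ℝ) * a ≤ U * a := by gcongr
      have := ENNReal.toReal_nonneg (a := L u)
      linarith
  have hne : convexConj L (ENNReal.ofReal a) ≠ ⊤ := ne_top_of_le_ne_top (EReal.coe_ne_top _) htop
  have hne' : convexConj L (ENNReal.ofReal a) ≠ ⊥ := ne_bot_of_le_ne_bot (by simp) h0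
  exact ⟨_, EReal.toReal_nonneg h0, EReal.coe_toReal hne hne'⟩

lemma scaledPenalty_ne_top_iff {δ : ℝ≥0} (hδ : δ ≠ 0) {u : ℝ≥0∞} :
    scaledPenalty L δ u ≠ ⊤ ↔ u ≠ ⊤ ∧ L (u.toNNReal / δ) ≠ ⊤ := by
  by_cases hu : u = ⊤
  · simp [scaledPenalty, hu]
  · simp [scaledPenalty, hu, hδ, ENNReal.mul_eq_top]

lemma toReal_scaledPenalty {δ : ℝ≥0} (hδ : δ ≠ 0) {u : ℝ≥0∞} (hu : u ≠ ⊤) :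
    (scaledPenalty L δ u).toReal = δ * (L (u.toNNReal / δ)).toReal := by
  simp [scaledPenalty, hu, hδ]

variable {ι : Type*} {S : Set ι} {G : ι → ℝ} {D : ι → ℝ≥0∞} {E a Υ : ℝ}

/-- Here and below `G ν` stands for the gain E_ν f - E_μ f and `D ν` for the transport distance. At
δ = 0 only distance zero is admitted, where the upper bound forces a nonpositive gain; whether such
a ν equals μ plays no role. -/
lemma iSup_sub_scaledPenalty_zero (hp : 0 < p)
    (hupper : ∃ b C : ℝ, ∀ ν ∈ S, D ν ≠ ⊤ → G ν ≤ b * (D ν).toReal + C * (D ν).toReal ^ p)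
    (hlower : ∃ ν ∈ S, D ν = 0 ∧ 0 ≤ G ν) :
    ⨆ ν ∈ S, ((E + G ν : ℝ) : EReal) - (scaledPenalty L 0 (D ν) : EReal) = (E : EReal) := by
  refine le_antisymm (iSup₂_le fun ν hν => ?_) ?_
  · rw [coe_sub_coe_le_iff]
    intro h
    have h0 : D ν = 0 := by
      by_contra h0
      simp [scaledPenalty, h0] at h
    obtain ⟨b, C, hb⟩ := hupper
    have := hb ν hν (by simp [h0])
    simp only [h0, ENNReal.toReal_zero, mul_zero, Real.zero_rpow hp.ne', add_zero] at this
    simpa [scaledPenalty, h0] using this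
  · obtain ⟨ν, hν, h0, hG⟩ := hlower
    refine le_iSup₂_of_le ν hν (coe_le_coe_sub ?_ ?_) <;> simp [scaledPenalty, h0, hG]

lemma tendsto_const_mul_rpow (hp : 1 < p) (b : ℝ) :
    Tendsto (fun δ : ℝ≥0 => b * (δ : ℝ) ^ (p - 1)) (𝓝[>] 0) (𝓝 0) := by
  have h : Continuous fun δ : ℝ≥0 => b * (δ : ℝ) ^ (p - 1) :=
    continuous_const.mul (NNReal.continuous_coe.rpow_const fun _ => Or.inr (by linarith))
  have := (h.tendsto 0).mono_left (nhdsWithin_le_nhds (s := Set.Ioi 0))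
  simpa [Real.zero_rpow (sub_pos.2 hp).ne'] using this

lemma mul_rpow_eq (hp : 1 < p) {δ : ℝ} (hδ : 0 < δ) {u : ℝ} (hu : 0 ≤ u) :
    (δ * u) ^ p = δ * (δ ^ (p - 1) * u ^ p) := by
  rw [Real.mul_rpow hδ.le hu, ← mul_assoc]
  congr 1
  rw [← Real.rpow_one_add' hδ.le (by linarith)]
  congr 1
  ring

lemma eventually_iSup_sub_scaledPenalty_le (hp : 1 < p)
    (hLgrowth : liminf (fun u : ℝ≥0 => L u / (u : ℝ≥0∞) ^ p) atTop = ⊤) (ha : 0 ≤ a)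
    (hupper : ∀ ε : ℝ, 0 < ε → ∃ C : ℝ, 0 ≤ C ∧ ∀ ν ∈ S, D ν ≠ ⊤ →
      G ν ≤ (a + ε) * (D ν).toReal + C * (D ν).toReal ^ p)
    (hΥ0 : 0 ≤ Υ) (hΥ : (Υ : EReal) = convexConj L (ENNReal.ofReal a)) {η : ℝ} (hη : 0 < η) :
    ∀ᶠ δ : ℝ≥0 in 𝓝[>] 0,
      ⨆ ν ∈ S, ((E + G ν : ℝ) : EReal) - (scaledPenalty L δ (D ν) : EReal)
        ≤ ((E + (Υ + η) * δ : ℝ) : EReal) := by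
  obtain ⟨C₁, hC₁0, hC₁⟩ := hupper 1 one_pos
  -- With distance δu, the gain is at most δ((a + 1)u + C₁ δ^(p-1) u^p). For u ≥ U and δ ≤ 1 the
  -- penalty exceeds this, so such ν contribute at most `E`.
  obtain ⟨U, hU1, hU⟩ := exists_mul_rpow_le (by linarith) hLgrowth
    (show 0 ≤ a + 1 + C₁ by positivity)
  have hU0 : (0 : ℝ) < U := by exact_mod_cast zero_lt_one.trans_le hU1
  -- For u ≤ U the slope error costs at most η/2, and the power term C δ^(p-1) U^p at most the other
  -- η/2 for small δ.
  obtain ⟨C, hC0, hC⟩ := hupper (η / (2 * U)) (by positivity)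
  have hlim := (tendsto_const_mul_rpow hp (C * (U : ℝ) ^ p)).eventually_le_const
    (half_pos hη)
  filter_upwards [hlim, self_mem_nhdsWithin,
    nhdsWithin_le_nhds (Iic_mem_nhds (zero_lt_one : (0 : ℝ≥0) < 1))] with δ hδ hδ0 hδ1
  have hδ0' : (0 : ℝ) < δ := hδ0
  have hδne : δ ≠ 0 := (Set.mem_Ioi.1 hδ0).ne'
  refine iSup₂_le fun ν hν => ?_
  rw [coe_sub_coe_le_iff, scaledPenalty_ne_top_iff hδne]
  rintro ⟨hD, hL⟩
  rw [toReal_scaledPenalty hδne hD]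
  obtain ⟨u, hu⟩ : ∃ u, u = (D ν).toNNReal / δ := ⟨_, rfl⟩
  have hDu : (D ν).toReal = δ * u := by
    rw [hu, NNReal.coe_div, ENNReal.coe_toNNReal_eq_toReal]
    field_simp
  rw [← hu] at hL ⊢
  have hu0 := u.coe_nonneg
  have hup : (0 : ℝ) ≤ (u : ℝ) ^ p := by positivity
  rcases le_total U u with h | h
  · have h1 : (1 : ℝ) ≤ u := by exact_mod_cast hU1.trans h
    have h2 := Real.self_le_rpow_of_one_le h1 hp.le
    have h3 := hU u h hL
    have h4 := hC₁ ν hν hD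
    rw [hDu, mul_rpow_eq hp hδ0' hu0] at h4
    have h5 : (δ : ℝ) ^ (p - 1) ≤ 1 :=
      Real.rpow_le_one hδ0'.le (by exact_mod_cast hδ1) (by linarith)
    have h6 : C₁ * ((δ : ℝ) ^ (p - 1) * (u : ℝ) ^ p) ≤ C₁ * (u : ℝ) ^ p :=
      mul_le_mul_of_nonneg_left (mul_le_of_le_one_left hup h5) hC₁0
    have h7 : (a + 1) * (u : ℝ) ≤ (a + 1) * (u : ℝ) ^ p :=
      mul_le_mul_of_nonneg_left h2 (by positivity)
    have h8 : 0 ≤ δ * ((L u).toReal - (a + 1) * u - C₁ * ((δ : ℝ) ^ (p - 1) * (u : ℝ) ^ p)) :=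
      mul_nonneg hδ0'.le (by linarith)
    have h9 : 0 ≤ (Υ + η) * δ := by positivity
    linarith
  · have hle : (u : ℝ) ≤ U := by exact_mod_cast h
    have h1 : (u : ℝ) * a - (L u).toReal ≤ Υ := by
      refine coe_sub_coe_le_iff.1 ?_ hL
      rw [hΥ, ← coe_mul_ofReal ha]
      exact le_iSup (fun u : ℝ≥0 =>
        (((u : ℝ≥0∞) * ENNReal.ofReal a : ℝ≥0∞) : EReal) - (L u : EReal)) u
    have h4 := hC ν hν hD
    rw [hDu, mul_rpow_eq hp hδ0' hu0] at h4
    have h5 : C * ((δ : ℝ) ^ (p - 1) * (u : ℝ) ^ p) ≤ C * (U : ℝ) ^ p * (δ : ℝ) ^ (p - 1) := by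
      rw [mul_assoc, mul_comm ((U : ℝ) ^ p)]
      gcongr
    have h6 : η / (2 * U) * u ≤ η / 2 := by
      calc η / (2 * U) * u ≤ η / (2 * U) * U := by gcongr
        _ = η / 2 := by field_simp
    have h8 : 0 ≤ δ * (Υ + η - (a + η / (2 * U)) * u - C * ((δ : ℝ) ^ (p - 1) * (u : ℝ) ^ p)
        + (L u).toReal) := mul_nonneg hδ0'.le (by linarith)
    linarith

/-- Fix u nearly optimal in the conjugate and take the measure provided for t = δu. Its distance is
only known to be at most δu; monotonicity of `L` turns this into a penalty of at most δ L(u). -/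
lemma eventually_le_iSup_sub_scaledPenalty (hp : 1 < p) (hLmono : Monotone L) (ha : 0 ≤ a)
    (hlower : ∀ ε : ℝ, 0 < ε → ∃ (C : ℝ) (K : ℝ≥0), 0 ≤ C ∧ ∀ t : ℝ, 0 ≤ t → t * K < 1 →
      ∃ ν ∈ S, D ν ≤ ENNReal.ofReal t ∧ (a - ε) * t - C * t ^ p ≤ G ν)
    (hΥ : (Υ : EReal) = convexConj L (ENNReal.ofReal a)) {η : ℝ} (hη : 0 < η) :
    ∀ᶠ δ : ℝ≥0 in 𝓝[>] 0, ((E + (Υ - η) * δ : ℝ) : EReal)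
      ≤ ⨆ ν ∈ S, ((E + G ν : ℝ) : EReal) - (scaledPenalty L δ (D ν) : EReal) := by
  have hlt : ((Υ - η / 2 : ℝ) : EReal) < convexConj L (ENNReal.ofReal a) := by
    rw [← hΥ, EReal.coe_lt_coe_iff]
    linarith
  obtain ⟨u, hu⟩ := lt_iSup_iff.1 hlt
  rw [coe_mul_ofReal ha] at hu
  have hu' := hu.not_ge
  rw [coe_sub_coe_le_iff, Classical.not_imp, not_le] at hu'
  obtain ⟨hLu, hval⟩ := hu'
  have hu0 := u.coe_nonneg
  -- The loss `η` is split into η/2 for the choice of u, η/4 for the slope error and η/4 for the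
  -- power term.
  obtain ⟨C, K, hC0, hC⟩ := hlower (η / (4 * (u + 1))) (by positivity)
  have hlim := (tendsto_const_mul_rpow hp (C * (u : ℝ) ^ p)).eventually_le_const
    (show 0 < η / 4 by linarith)
  have hsmall : ∀ᶠ δ : ℝ≥0 in 𝓝[>] 0, (δ : ℝ) * u * K < 1 := by
    have hcont : Continuous fun δ : ℝ≥0 => (δ : ℝ) * u * K := by fun_prop
    have := (hcont.tendsto 0).mono_left (nhdsWithin_le_nhds (s := Set.Ioi 0))
    exact this.eventually_lt_const (by simp)
  filter_upwards [hlim, hsmall, self_mem_nhdsWithin] with δ hδ hδK hδ0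
  have hδ0' : (0 : ℝ) < δ := hδ0
  have hδne : δ ≠ 0 := (Set.mem_Ioi.1 hδ0).ne'
  obtain ⟨ν, hν, hD, hG⟩ := hC (δ * u) (by positivity) hδK
  have hDtop : D ν ≠ ⊤ := ne_top_of_le_ne_top ENNReal.ofReal_ne_top hD
  have hDu : (D ν).toNNReal / δ ≤ u := by
    rw [div_le_iff₀ (pos_iff_ne_zero.2 hδne), mul_comm, ← NNReal.coe_le_coe,
      ENNReal.coe_toNNReal_eq_toReal, NNReal.coe_mul]
    exact ENNReal.toReal_le_of_le_ofReal (by positivity) hD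
  have hLle := hLmono hDu
  refine le_iSup₂_of_le ν hν (coe_le_coe_sub ((scaledPenalty_ne_top_iff hδne).2
    ⟨hDtop, ne_top_of_le_ne_top hLu hLle⟩) ?_)
  rw [toReal_scaledPenalty hδne hDtop]
  have h1 : δ * (L ((D ν).toNNReal / δ)).toReal ≤ δ * (L u).toReal :=
    mul_le_mul_of_nonneg_left (ENNReal.toReal_mono hLu hLle) hδ0'.le
  rw [mul_rpow_eq hp hδ0' hu0] at hG
  have h6 : η / (4 * (u + 1)) * u ≤ η / 4 := by
    rw [div_mul_eq_mul_div, div_le_div_iff₀ (by positivity) (by positivity)]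
    nlinarith
  have h8 : 0 ≤ δ * ((a - η / (4 * (u + 1))) * u - C * ((δ : ℝ) ^ (p - 1) * (u : ℝ) ^ p)
      - (L u).toReal - (Υ - η)) := mul_nonneg hδ0'.le (by linarith)
  linarith

/-- A function of `δ` that is squeezed between affine functions whose slopes are arbitrarily
close to `Υ` is finite near `0` and differentiable there. -/
lemma isLittleO_of_eventually_le {V : ℝ≥0 → EReal} (hV0 : V 0 = (E : EReal))
    (hle : ∀ η : ℝ, 0 < η → ∀ᶠ δ : ℝ≥0 in 𝓝[>] 0, V δ ≤ ((E + (Υ + η) * δ : ℝ) : EReal))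
    (hge : ∀ η : ℝ, 0 < η → ∀ᶠ δ : ℝ≥0 in 𝓝[>] 0, ((E + (Υ - η) * δ : ℝ) : EReal) ≤ V δ) :
    (∀ᶠ δ : ℝ≥0 in 𝓝[>] 0, V δ ≠ ⊤ ∧ V δ ≠ ⊥) ∧
      (fun δ : ℝ≥0 => (V δ).toReal - (V 0).toReal - Υ * (δ : ℝ))
        =o[𝓝[>] 0] (fun δ : ℝ≥0 => (δ : ℝ)) := by
  have hfin : ∀ᶠ δ : ℝ≥0 in 𝓝[>] 0, V δ ≠ ⊤ ∧ V δ ≠ ⊥ := by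
    filter_upwards [hle 1 one_pos, hge 1 one_pos] with δ h1 h2
    exact ⟨ne_top_of_le_ne_top (EReal.coe_ne_top _) h1,
      ne_bot_of_le_ne_bot (EReal.coe_ne_bot _) h2⟩
  refine ⟨hfin, isLittleO_iff.2 fun η hη => ?_⟩
  filter_upwards [hfin, hle η hη, hge η hη] with δ h h1 h2
  rw [← EReal.coe_toReal h.1 h.2, EReal.coe_le_coe_iff] at h1 h2
  rw [hV0, EReal.toReal_coe, Real.norm_eq_abs, Real.norm_of_nonneg δ.coe_nonneg, abs_le]
  constructor <;> linarith

end expansion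

section value

variable {p q : ℝ} {f : PathSpace N d → ℝ} {μ : Measure (PathSpace N d)}
  {h : Fin N → PathSpace N d → Fin d → ℝ}

/-- The infimum over couplings need not be known to be attained: the bound holds for every s above
the optimal cost and passes to the limit by continuity in s. -/
lemma exists_objective_sub_le_bicausalCost (hpq : p.HolderConjugate q) (hf : ContDiff ℝ 1 f)
    (hfgrowth : ∃ C : ℝ, ∀ x : PathSpace N d,
      pathNorm p (fun n => malliavin f n x) ≤ C * (1 + pathNorm p x ^ (p - 1)))
    (hμ : μ ∈ martingaleMeasures N d p) (hh : h ∈ predictableLq q μ) {ε : ℝ} (hε : 0 < ε) :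
    ∃ C : ℝ, 0 ≤ C ∧ ∀ ν ∈ martingaleMeasures N d p, bicausalCost p μ ν ^ (1 / p) ≠ ⊤ →
      ∫ x, f x ∂ν - ∫ x, f x ∂μ
        ≤ (lqDist q μ (optionalProj μ (malliavin f) - h) + ε)
            * (bicausalCost p μ ν ^ (1 / p)).toReal
          + C * (bicausalCost p μ ν ^ (1 / p)).toReal ^ p := by
  have hp := hpq.pos
  obtain ⟨C, hC0, hC⟩ := exists_objective_sub_le hpq hf hfgrowth hμ hh hε
  refine ⟨C, hC0, fun ν hν htop => ?_⟩
  have hb0 := add_nonneg (lqDist_nonneg q μ (optionalProj μ (malliavin f) - h)) hε.le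
  have htop' : bicausalCost p μ ν ≠ ⊤ := fun h => htop (by
    rw [h, ENNReal.top_rpow_of_pos (by positivity)])
  rw [← ENNReal.toReal_rpow, ← Real.rpow_mul ENNReal.toReal_nonneg, one_div_mul_cancel hp.ne',
    Real.rpow_one]
  set b := lqDist q μ (optionalProj μ (malliavin f) - h) + ε
  set s₀ := (bicausalCost p μ ν).toReal
  have hcont : Continuous fun s : ℝ => b * s ^ (1 / p) + C * s :=
    (continuous_const.mul (continuous_id.rpow_const fun _ => Or.inr (by positivity))).add
      (continuous_const.mul continuous_id)
  refine ge_of_tendsto ((hcont.tendsto s₀).mono_left (nhdsWithin_le_nhds (s := Set.Ioi s₀))) ?_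
  filter_upwards [self_mem_nhdsWithin] with s hs
  obtain ⟨π, hπ, hlt⟩ := exists_integral_cost_lt
    ((ENNReal.lt_ofReal_iff_toReal_lt htop').2 hs) fun π hπ => (hC ν hν π hπ).1
  have h0 : 0 ≤ ∫ z, cost p z.1 z.2 ∂π := integral_nonneg fun z => cost_nonneg p z.1 z.2
  refine (hC ν hν π hπ).2.trans ?_
  gcongr

lemma exists_bicausalCost_le (hpq : p.HolderConjugate q) (hf : ContDiff ℝ 1 f)
    (hfgrowth : ∃ C : ℝ, ∀ x : PathSpace N d,
      pathNorm p (fun n => malliavin f n x) ≤ C * (1 + pathNorm p x ^ (p - 1)))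
    (hμ : μ ∈ martingaleMeasures N d p)
    (hh : IsBestPredictable q μ (optionalProj μ (malliavin f)) h) {ε : ℝ} (hε : 0 < ε) :
    ∃ (C : ℝ) (K : ℝ≥0), 0 ≤ C ∧ ∀ t : ℝ, 0 ≤ t → t * K < 1 →
      ∃ ν ∈ martingaleMeasures N d p, bicausalCost p μ ν ^ (1 / p) ≤ ENNReal.ofReal t ∧
        (lqDist q μ (optionalProj μ (malliavin f) - h) - ε) * t - C * t ^ p
          ≤ ∫ x, f x ∂ν - ∫ x, f x ∂μ := by
  have hp := hpq.pos
  obtain ⟨C, K, hC0, hC⟩ := exists_le_objective_sub hpq hf hfgrowth hμ hh hε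
  refine ⟨C, K, hC0, fun t ht htK => ?_⟩
  obtain ⟨ν, hν, π, hπ, hint, hcost, hobj⟩ := hC t ht htK
  refine ⟨ν, hν, ?_, hobj⟩
  rw [one_div, ENNReal.rpow_inv_le_iff hp, ENNReal.ofReal_rpow_of_nonneg ht hp.le]
  exact (bicausalCost_le hπ hint).trans (ENNReal.ofReal_le_ofReal hcost)

end value

end MartDRO

/-! ### The theorem -/

theorem mainTheorem2 {N d : ℕ} (hN : 1 ≤ N) (hd : 1 ≤ d)
    (p q : ℝ) (hp : 1 < p) (hq : q = p / (p - 1))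
    (L : ℝ≥0 → ℝ≥0∞) (hLlsc : LowerSemicontinuous L) (hLmono : Monotone L) (hL0 : L 0 = 0)
    (hLgrowth : liminf (fun u : ℝ≥0 => L u / (u : ℝ≥0∞) ^ p) atTop = ⊤)
    (f : MartDRO.PathSpace N d → ℝ) (hf : ContDiff ℝ 1 f)
    (hfgrowth : ∃ C : ℝ, ∀ x : MartDRO.PathSpace N d,
      MartDRO.pathNorm p (fun n => MartDRO.malliavin f n x)
        ≤ C * (1 + MartDRO.pathNorm p x ^ (p - 1)))
    (μ : Measure (MartDRO.PathSpace N d)) (hμ : μ ∈ MartDRO.martingaleMeasures N d p) :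
    MartDRO.VMart p L f μ 0 = ((∫ x, f x ∂μ : ℝ) : EReal) ∧
    (∀ᶠ δ : ℝ≥0 in 𝓝[>] 0, MartDRO.VMart p L f μ δ ≠ ⊤ ∧ MartDRO.VMart p L f μ δ ≠ ⊥) ∧
    ∃ Υ : ℝ,
      (fun δ : ℝ≥0 => (MartDRO.VMart p L f μ δ).toReal - (MartDRO.VMart p L f μ 0).toReal
        - Υ * (δ : ℝ)) =o[𝓝[>] 0] (fun δ : ℝ≥0 => (δ : ℝ)) ∧
      (Υ : EReal) = MartDRO.convexConj L (⨅ h ∈ MartDRO.predictableLq q μ,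
        MartDRO.LqNorm q μ (MartDRO.optionalProj μ (MartDRO.malliavin f) - h)) ∧
      (p = 2 → (Υ : EReal) = MartDRO.convexConj L
        (MartDRO.LqNorm 2 μ (MartDRO.optionalProj μ (MartDRO.malliavin f)
          - MartDRO.predictableProj μ (MartDRO.malliavin f)))) := by
  have hpq : p.HolderConjugate q := hq ▸ Real.HolderConjugate.conjExponent hp
  have hprob := hμ.1
  have hD := MartDRO.memLp_malliavin hpq hf hfgrowth
    (MartDRO.integrable_norm_rpow_of_mem hpq.pos hμ)
  have hA := MartDRO.memLp_optionalProj hpq.symm.lt.le hD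
  obtain ⟨h, hh⟩ := MartDRO.exists_isBestPredictable hpq hA
  set a := MartDRO.lqDist q μ (MartDRO.optionalProj μ (MartDRO.malliavin f) - h)
  have ha : 0 ≤ a := MartDRO.lqDist_nonneg _ _ _
  obtain ⟨Υ, hΥ0, hΥ⟩ := MartDRO.exists_convexConj_eq hp hL0 hLgrowth ha
  have hupper := fun (ε : ℝ) (hε : 0 < ε) =>
    MartDRO.exists_objective_sub_le_bicausalCost hpq hf hfgrowth hμ hh.1 hε
  have hlower := fun (ε : ℝ) (hε : 0 < ε) =>
    MartDRO.exists_bicausalCost_le hpq hf hfgrowth hμ hh hε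
  have hV : ∀ δ, MartDRO.VMart p L f μ δ = ⨆ ν ∈ MartDRO.martingaleMeasures N d p,
      ((∫ x, f x ∂μ + (∫ x, f x ∂ν - ∫ x, f x ∂μ) : ℝ) : EReal)
        - (MartDRO.scaledPenalty L δ (MartDRO.bicausalCost p μ ν ^ (1 / p)) : EReal) := fun δ => by
    simp only [MartDRO.VMart, add_sub_cancel]
  have hV0 : MartDRO.VMart p L f μ 0 = ((∫ x, f x ∂μ : ℝ) : EReal) := by
    rw [hV]
    refine MartDRO.iSup_sub_scaledPenalty_zero
      (G := fun ν => ∫ x, f x ∂ν - ∫ x, f x ∂μ) hpq.pos ?_ ?_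
    · obtain ⟨C, -, hC⟩ := hupper 1 one_pos
      exact ⟨_, C, hC⟩
    · obtain ⟨C, K, -, hC⟩ := hlower 1 one_pos
      -- The lower bound at t = 0 supplies a measure at distance zero with nonnegative gain.
      obtain ⟨ν, hν, h1, h2⟩ := hC 0 le_rfl (by simp)
      refine ⟨ν, hν, le_antisymm (by simpa using h1) bot_le, ?_⟩
      simpa [Real.zero_rpow hpq.pos.ne'] using h2
  obtain ⟨hfin, hlittle⟩ := MartDRO.isLittleO_of_eventually_le (Υ := Υ) hV0
    (fun η hη => by
      simp only [hV]
      exact MartDRO.eventually_iSup_sub_scaledPenalty_le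
        (G := fun ν => ∫ x, f x ∂ν - ∫ x, f x ∂μ) hp hLgrowth ha hupper hΥ0 hΥ hη)
    (fun η hη => by
      simp only [hV]
      exact MartDRO.eventually_le_iSup_sub_scaledPenalty
        (G := fun ν => ∫ x, f x ∂ν - ∫ x, f x ∂μ) hp hLmono ha hlower hΥ hη)
  have hinf := hh.iInf_eq hpq hA
  refine ⟨hV0, hfin, Υ, hlittle, hinf ▸ hΥ, fun hp2 => ?_⟩
  obtain rfl : q = 2 := by rw [hq, hp2]; norm_num
  have hb := MartDRO.isBestPredictable_predictableProj hD
  have hnorm := MartDRO.LqNorm_eq (B := MartDRO.optionalProj μ (MartDRO.malliavin f)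
      - MartDRO.predictableProj μ (MartDRO.malliavin f)) two_pos fun n i =>
    (hA n i).sub (MartDRO.predictableLq.memLp two_pos hb.1 n i)
  -- For p = 2 both `h` and the predictable projection satisfy the first-order condition, so both
  -- realize the same infimum.
  rw [hΥ, ← hinf, hb.iInf_eq hpq hA, hnorm]
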